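/- **Setting.** Let $m\ge 1$, $n=2m+1$, and let $(M^n,H,J)$ be a smooth strictly pseudoconvex, partially integrable CR manifold: $H\subset TM$ is a smooth hyperplane subbundle with a smooth complex structure $J$, and $[X,Y]-[JX,JY]\in\Gamma(H)$ for all $X,Y\in\Gamma(H)$. A pseudo-Hermitian form is a nowhere vanishing $\theta\in\Omega^1(M)$ with $\theta|_H=0$ whose Levi form $L_\theta(X,Y)=d\theta(X,JY)$ on $H$ is positive definite, where $d\theta(X,Y)=X\theta(Y)-Y\theta(X)-\theta([X,Y])$. The Reeb field $T$ is given by $\theta(T)=1$, $d\theta(T,\cdot)=0$; $L_\theta$ is extended to $TM$ by $L_\theta(T,\cdot)=0$, and $J$ by $JT=0$. Let $\ell\in\Omega^1(M;i\mathbb R)$. *Tanaka–Webster connection.* $\nabla^W$ is the unique linear connection on $TM$ for which $\theta$ and $L_\theta$ are parallel and whose torsion satisfies, for $X,Y\in\Gamma(H)$, $Tor(X,Y)=L_\theta(JX,Y)\,T-\frac14\mathcal N_J(X,Y)$ and $Tor(T,X)=-\frac12([T,X]+J[T,JX])$, where $\mathcal N_J(X,Y)=[X,Y]-[JX,JY]+J([JX,Y]+[X,JY])$.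 With $R(X,Y)=[\nabla^W_X,\nabla^W_Y]-\nabla^W_{[X,Y]}$ and an $L_\theta$-orthonormal basis $(e_1,Je_1,\dots,e_m,Je_m)$ of $H$, put $Ric^W(X,Y)=i\sum_\alpha L_\theta(R(X,Y)e_\alpha,Je_\alpha)$ and $scal^W=i\sum_\alpha Ric^W(e_\alpha,Je_\alpha)$. *Fefferman space.* Let $\Lambda^{m+1,0}$ be the complex line bundle of the complex-valued $(m+1)$-forms annihilated by insertion of $X+iJX$, $X\in H$, and let $\pi:F_c=(\Lambda^{m+1,0}\setminus\{0\})/\mathbb R^+\to M$, an $S^1$-principal bundle. $\nabla^W$ induces a connection form $A^W:TF_c\to i\mathbb R$. Put $$A_\theta=A^W-\tfrac{i}{2(m+1)}scal^W\,\pi^*\theta,\qquad A_{\theta,\ell}=A_\theta+\pi^*\ell,\qquad f_{\theta,\ell}=\pi^*L_\theta-\tfrac{4i}{m+2}\,\pi^*\theta\circ A_{\theta,\ell},$$ with $\alpha\circ\beta=\frac12(\alpha\otimes\beta+\beta\otimes\alpha)$; $f_{\theta,\ell}$ is a Lorentzian metric on $F_c$, and $\dim F_c=n+1$. Let $S$ be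 the vertical vector field with $A_{\theta,\ell}(S)=\frac{i(m+2)}2$, $R=2S$, and let $J_{\theta,\ell}$ be the endomorphism of $TF_c$ that is the horizontal lift (with respect to $A_{\theta,\ell}$) of $J$ on the lift of $H$ and is zero on $S$ and on the horizontal lift of $T$. *Tractors.* Let $c=[g_0]=\{e^{2\phi}g_0:\phi\in C^\infty\}$ be a conformal class of metrics on a manifold $F$. The standard tractor bundle $\mathcal T(F)$ is the vector bundle which each $g\in c$ identifies with $\mathbb R\oplus TF\oplus\mathbb R$, where for $\tilde g=e^{2\phi}g$, $\Upsilon=d\phi$, $g(\Upsilon^\sharp,\cdot)=\Upsilon$, the components $(a,\xi,b)$ with respect to $g$ become, with respect to $\tilde g$, $$\bigl(e^{-\phi}(a-\Upsilon(\xi)-\tfrac12\Upsilon(\Upsilon^\sharp)b),\ e^{-\phi}(\xi+b\Upsilon^\sharp),\ e^{\phi}b\bigr).$$ It carries the invariant metric $\langle(a,\xi,b),(a',\xi',b')\rangle=ab'+ba'+g(\xi,\xi')$, and the adjoint tractor bundle is $\mathcal A(F)=\mathfrak{so}(\mathcal T(F))$. A triple $(\tau,\psi,\eta)$ consisting of a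 vector, a $g$-skew endomorphism and a covector is, by means of $g$, the adjoint tractor $(a,\xi,b)\mapsto(\eta(\xi),\ a\tau+\psi\xi-b\eta^\sharp,\ -g(\tau,\xi))$. **Proposition.** (1) For any two pseudo-Hermitian forms $\theta,\theta'$ on $(M,H,J)$ the metrics $f_{\theta,\ell}$ and $f_{\theta',\ell}$ are conformally equivalent, and the section $$J_{CR}=\bigl(R,\ J_{\theta,\ell},\ \tfrac{2i}{n+3}A_{\theta,\ell}\bigr)$$ of the adjoint tractor bundle $\mathcal A(F_c)$ of the conformal class $[f_{\theta,\ell}]$, given with respect to the metric $f_{\theta,\ell}$, does not depend on the choice of $\theta$: the triple of $\theta'$ with respect to $f_{\theta',\ell}$ defines the same section. (2) $J_{CR}^2=-\mathrm{id}$ on the standard tractor bundle $\mathcal T(F_c)$. -/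

import Mathlib

open scoped Manifold ContDiff Topology
open Bundle

noncomputable section

set_option linter.unusedSectionVars false

namespace CRTractor

/-! ## Almost CR structures -/

/-- The model space of a manifold of dimension `n = 2m + 1`. -/
abbrev CRModel (m : ℕ) : Type := EuclideanSpace ℝ (Fin (2 * m + 1))

instance (m : ℕ) {M : Type*} [TopologicalSpace M] [ChartedSpace (CRModel m) M] (x : M) :
    FiniteDimensional ℝ (TangentSpace 𝓘(ℝ, CRModel m) x) :=
  inferInstanceAs (FiniteDimensional ℝ (CRModel m))

/-- The tangent space `T_x M` of a manifold of dimension `2m + 1`. -/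
abbrev Tan (m : ℕ) {M : Type*} [TopologicalSpace M] [ChartedSpace (CRModel m) M] (x : M) : Type :=
  TangentSpace 𝓘(ℝ, CRModel m) x

/-- A vector field, as a section of the tangent bundle. -/
def vfSection {m : ℕ} {M : Type*} [TopologicalSpace M] [ChartedSpace (CRModel m) M]
    (X : ∀ x : M, Tan m x) :
    M → TotalSpace (CRModel m) (TangentSpace 𝓘(ℝ, CRModel m) : M → Type) :=
  fun x ↦ TotalSpace.mk' (CRModel m) x (X x)

/-- The vector field `X` is smooth near the point `x`. -/
def SmoothVFAt {m : ℕ} {M : Type*} [TopologicalSpace M] [ChartedSpace (CRModel m) M]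
    [IsManifold 𝓘(ℝ, CRModel m) ∞ M] (X : ∀ x : M, Tan m x) (x : M) : Prop :=
  ContMDiffAt 𝓘(ℝ, CRModel m) (𝓘(ℝ, CRModel m).prod 𝓘(ℝ, CRModel m)) ∞ (vfSection X) x

/-- The Lie bracket `[X, Y]` at `x`. -/
abbrev bracket {m : ℕ} {M : Type*} [TopologicalSpace M] [ChartedSpace (CRModel m) M]
    (X Y : ∀ x : M, Tan m x) (x : M) : Tan m x :=
  VectorField.mlieBracket 𝓘(ℝ, CRModel m) X Y x

/-- A field of hyperplanes `H ⊂ TM` with a complex structure `J` on `H` (without smoothness). -/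
structure CRData (m : ℕ) (M : Type*) [TopologicalSpace M] [ChartedSpace (CRModel m) M] where
  H : ∀ x : M, Submodule ℝ (Tan m x)
  finrank_H : ∀ x, Module.finrank ℝ (H x) = 2 * m
  J : ∀ x, H x →ₗ[ℝ] H x
  J_sq : ∀ x v, J x (J x v) = -v

variable {m : ℕ} {M : Type*} [TopologicalSpace M] [ChartedSpace (CRModel m) M]

/-- A section of `H`, regarded as a vector field. -/
abbrev CRData.vf (D : CRData m M) (Y : ∀ x, D.H x) : ∀ x : M, Tan m x := fun x ↦ (Y x : Tan m x)

/-- The section `JY` of `H`. -/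
abbrev CRData.Jf (D : CRData m M) (Y : ∀ x, D.H x) : ∀ x, D.H x := fun x ↦ D.J x (Y x)

/-- A smooth local frame `(N, e_1, J e_1, …, e_m, J e_m)` of `TM` over an open set `U` such that the
`e_α` and `J e_α` are sections of `H` (hence a frame of `H`). -/
structure CRFrame [IsManifold 𝓘(ℝ, CRModel m) ∞ M] (D : CRData m M) where
  U : Set M
  isOpen_U : IsOpen U
  N : ∀ x : M, Tan m x
  e : Fin m → ∀ x : M, D.H x
  smooth_N : ∀ x ∈ U, SmoothVFAt N x
  smooth_e : ∀ α, ∀ x ∈ U, SmoothVFAt (D.vf (e α)) x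
  smooth_Je : ∀ α, ∀ x ∈ U, SmoothVFAt (D.vf (D.Jf (e α))) x
  linearIndependent : ∀ x ∈ U, LinearIndependent ℝ
    (fun i : Option (Fin m ⊕ Fin m) ↦ (i.elim (N x)
      (Sum.elim (fun α ↦ (e α x : Tan m x)) (fun α ↦ (D.J x (e α x) : Tan m x))) : Tan m x))

/-- A smooth, partially integrable almost CR structure `(H, J)` on `M`.
The existence of frames says that `H` is a smooth subbundle of `TM` and that `J` is smooth.
Partial integrability says that `[X, Y] ≡ [JX, JY]` modulo `H` for (local) sections of `H`. -/
structure CRStructure (m : ℕ) (M : Type*) [TopologicalSpace M] [ChartedSpace (CRModel m) M]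
    [IsManifold 𝓘(ℝ, CRModel m) ∞ M] extends CRData m M where
  exists_frame : ∀ x : M, ∃ f : CRFrame toCRData, x ∈ f.U
  partiallyIntegrable : ∀ (X Y : ∀ x, H x) (x : M), SmoothVFAt (fun y ↦ (X y : Tan m y)) x →
    SmoothVFAt (fun y ↦ (Y y : Tan m y)) x →
    bracket (fun y ↦ (X y : Tan m y)) (fun y ↦ (Y y : Tan m y)) x
      - bracket (fun y ↦ (J y (X y) : Tan m y)) (fun y ↦ (J y (Y y) : Tan m y)) x ∈ H x

variable [IsManifold 𝓘(ℝ, CRModel m) ∞ M]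

/-! ### Frames and their coordinates -/

namespace CRFrame

variable {D : CRData m M} (f : CRFrame D)

/-- The frame `(N, e_1, J e_1, …, e_m, J e_m)` at `x`. -/
def vec (x : M) (i : Option (Fin m ⊕ Fin m)) : Tan m x :=
  i.elim (f.N x) (Sum.elim (fun α ↦ (f.e α x : Tan m x)) (fun α ↦ (D.J x (f.e α x) : Tan m x)))

lemma smooth_vec (i : Option (Fin m ⊕ Fin m)) {x : M} (hx : x ∈ f.U) :
    SmoothVFAt (fun y ↦ f.vec y i) x := by
  rcases i with _ | α | α
  · exact f.smooth_N x hx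
  · exact f.smooth_e α x hx
  · exact f.smooth_Je α x hx

lemma card_index (x : M) :
    Fintype.card (Option (Fin m ⊕ Fin m)) = Module.finrank ℝ (Tan m x) := by
  have : Module.finrank ℝ (Tan m x) = Module.finrank ℝ (CRModel m) := rfl
  rw [this]
  simp [two_mul]

/-- The frame as a basis of the tangent space. -/
def basis {x : M} (hx : x ∈ f.U) : Module.Basis (Option (Fin m ⊕ Fin m)) ℝ (Tan m x) :=
  basisOfLinearIndependentOfCardEqFinrank (b := f.vec x) (f.linearIndependent x hx)
    (card_index x)

lemma basis_apply {x : M} (hx : x ∈ f.U) (i) : f.basis hx i = f.vec x i :=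
  congrFun (coe_basisOfLinearIndependentOfCardEqFinrank _ _) i

/-- The coordinates of a tangent vector in the frame (zero outside the domain of the frame). -/
def coord (x : M) : Tan m x →ₗ[ℝ] (Option (Fin m ⊕ Fin m) → ℝ) :=
  open Classical in if hx : x ∈ f.U then (f.basis hx).equivFun.toLinearMap else 0

lemma sum_coord {x : M} (hx : x ∈ f.U) (v : Tan m x) : ∑ i, f.coord x v i • f.vec x i = v := by
  have := (f.basis hx).sum_equivFun v
  simpa [coord, hx, basis_apply] using this

lemma coord_vec {x : M} (hx : x ∈ f.U) (i) : f.coord x (f.vec x i) = Pi.single i 1 := by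
  classical
  rw [← f.basis_apply hx]
  simp only [coord, hx, dite_true]
  ext j
  simp [Pi.single_apply, eq_comm]

lemma coord_unique {x : M} (hx : x ∈ f.U) (c : Option (Fin m ⊕ Fin m) → ℝ) :
    f.coord x (∑ i, c i • f.vec x i) = c := by
  classical
  simp only [map_sum, map_smul, f.coord_vec hx]
  ext j
  simp [Finset.sum_apply, Pi.single_apply]

/-- The fields `N, e_1, …, e_m` (a complex frame of `TM^ℂ / T_{01}`). -/
def cvec (x : M) : Fin (m + 1) → Tan m x :=
  Fin.cons (f.N x) (fun α ↦ (f.e α x : Tan m x))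

/-- The complex-valued coframe `(η^0, …, η^m)` with `η^0 = 0` on `H`, `η^α ∘ J = i η^α` on `H`,
that is dual to `(N, e_1, …, e_m)`. -/
def coframe (x : M) : Tan m x →ₗ[ℝ] (Fin (m + 1) → ℂ) :=
  LinearMap.pi (Fin.cons
    (Complex.ofRealCLM.toLinearMap ∘ₗ LinearMap.proj none ∘ₗ f.coord x)
    (fun α ↦ Complex.ofRealCLM.toLinearMap ∘ₗ LinearMap.proj (some (Sum.inl α)) ∘ₗ f.coord x
      + (Complex.I • Complex.ofRealCLM.toLinearMap) ∘ₗ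
          LinearMap.proj (some (Sum.inr α)) ∘ₗ f.coord x))

lemma coframe_zero (x : M) (v : Tan m x) : f.coframe x v 0 = f.coord x v none := by
  simp [coframe]

lemma coframe_succ (x : M) (v : Tan m x) (α : Fin m) :
    f.coframe x v α.succ =
      f.coord x v (some (Sum.inl α)) + Complex.I * f.coord x v (some (Sum.inr α)) := by
  simp [coframe]

end CRFrame

namespace CRStructure

variable (C : CRStructure m M)

/-- A chosen frame around the point `x`. -/
def frameAt (x : M) : CRFrame C.toCRData := (C.exists_frame x).choose

lemma mem_frameAt (x : M) : x ∈ (C.frameAt x).U := (C.exists_frame x).choose_spec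

end CRStructure


namespace CRFrame

variable {D : CRData m M} (f : CRFrame D)

lemma smooth_coord {V : ∀ x : M, Tan m x} {x : M} (hx : x ∈ f.U) (hV : SmoothVFAt V x) :
    ContMDiffAt 𝓘(ℝ, CRModel m) 𝓘(ℝ, Option (Fin m ⊕ Fin m) → ℝ) ∞
      (fun y ↦ f.coord y (V y)) x := by
  classical
  set e := trivializationAt (CRModel m) (TangentSpace 𝓘(ℝ, CRModel m) : M → Type) x with he
  have hxe : x ∈ e.baseSet := FiberBundle.mem_baseSet_trivializationAt' x
  let b : Option (Fin m ⊕ Fin m) → M → CRModel m := fun i y ↦ (e ⟨y, f.vec y i⟩).2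
  let L : M → ((Option (Fin m ⊕ Fin m) → ℝ) →L[ℝ] CRModel m) := fun y ↦
    ∑ i, (ContinuousLinearMap.proj (R := ℝ) i).smulRight (b i y)
  have hb : ∀ i, ContMDiffAt 𝓘(ℝ, CRModel m) 𝓘(ℝ, CRModel m) ∞ (b i) x := fun i ↦
    (Bundle.contMDiffAt_section (s := fun y ↦ f.vec y i) x).1 (f.smooth_vec i hx)
  have hv : ContMDiffAt 𝓘(ℝ, CRModel m) 𝓘(ℝ, CRModel m) ∞ (fun y ↦ (e ⟨y, V y⟩).2) x :=
    (Bundle.contMDiffAt_section (s := V) x).1 hV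
  have hL : ContMDiffAt 𝓘(ℝ, CRModel m)
      𝓘(ℝ, (Option (Fin m ⊕ Fin m) → ℝ) →L[ℝ] CRModel m) ∞ L x := by
    refine ContMDiffAt.sum fun i _ ↦ ?_
    have h := (ContinuousLinearMap.smulRightL ℝ (Option (Fin m ⊕ Fin m) → ℝ) (CRModel m)
      (ContinuousLinearMap.proj (R := ℝ) (φ := fun _ ↦ ℝ) i)).contDiff (n := ∞)
    exact h.contMDiff.contMDiffAt.comp x (hb i)
  let Φ : ∀ y, y ∈ f.U → y ∈ e.baseSet →
      ((Option (Fin m ⊕ Fin m) → ℝ) ≃L[ℝ] CRModel m) := fun y hyU hy ↦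
    ((f.basis hyU).equivFun.symm.trans
      (e.continuousLinearEquivAt ℝ y hy).toLinearEquiv).toContinuousLinearEquiv
  have he' : ∀ y (hy : y ∈ e.baseSet) (w : Tan m y),
      (e ⟨y, w⟩).2 = e.continuousLinearEquivAt ℝ y hy w := fun y hy w ↦ by simp
  have key : ∀ y (hyU : y ∈ f.U) (hy : y ∈ e.baseSet),
      L y = (Φ y hyU hy : (Option (Fin m ⊕ Fin m) → ℝ) →L[ℝ] CRModel m) := by
    intro y hyU hy
    ext1 c
    have h2 : (f.basis hyU).equivFun.symm c = ∑ i, c i • f.vec y i := by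
      simp [Module.Basis.equivFun_symm_apply, basis_apply]
    have h3 : Φ y hyU hy c = e.continuousLinearEquivAt ℝ y hy ((f.basis hyU).equivFun.symm c) := rfl
    rw [ContinuousLinearEquiv.coe_coe, h3, h2, map_sum]
    simp only [L, b, he' y hy, sum_apply, ContinuousLinearMap.smulRight_apply,
      ContinuousLinearMap.proj_apply]
    exact Finset.sum_congr rfl fun i _ ↦
      ((e.continuousLinearEquivAt ℝ y hy).map_smul (c i) (f.vec y i)).symm
  have hinv : ContMDiffAt 𝓘(ℝ, CRModel m) 𝓘(ℝ, CRModel m →L[ℝ] (Option (Fin m ⊕ Fin m) → ℝ)) ∞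
      (fun y ↦ (L y).inverse) x := by
    have := contDiffAt_map_inverse (𝕜 := ℝ) (n := ∞) (Φ x hx hxe)
    rw [← key x hx hxe] at this
    exact this.contMDiffAt.comp x hL
  refine (hinv.clm_apply hv).congr_of_eventuallyEq ?_
  filter_upwards [f.isOpen_U.mem_nhds hx, e.open_baseSet.mem_nhds hxe] with y hyU hy
  rw [key y hyU hy, ContinuousLinearMap.inverse_equiv, he' y hy]
  have h4 : (Φ y hyU hy).symm (e.continuousLinearEquivAt ℝ y hy (V y)) =
      (f.basis hyU).equivFun ((e.continuousLinearEquivAt ℝ y hy).symm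
        (e.continuousLinearEquivAt ℝ y hy (V y))) := rfl
  rw [ContinuousLinearEquiv.coe_coe, h4, ContinuousLinearEquiv.symm_apply_apply]
  simp [coord, hyU]

lemma smooth_coframe {V : ∀ x : M, Tan m x} {x : M} (hx : x ∈ f.U) (hV : SmoothVFAt V x)
    (j : Fin (m + 1)) :
    ContMDiffAt 𝓘(ℝ, CRModel m) 𝓘(ℝ, ℂ) ∞ (fun y ↦ f.coframe y (V y) j) x := by
  have h := f.smooth_coord hx hV
  have hi : ∀ i, ContMDiffAt 𝓘(ℝ, CRModel m) 𝓘(ℝ, ℂ) ∞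
      (fun y ↦ ((f.coord y (V y) i : ℝ) : ℂ)) x := fun i ↦
    (Complex.ofRealCLM.contDiff.contMDiff.contMDiffAt).comp x
      ((contMDiffAt_pi_space.1 h) i)
  refine Fin.cases ?_ (fun α ↦ ?_) j
  · simpa only [coframe_zero] using hi none
  · simp only [coframe_succ]
    exact (hi _).add ((ContinuousLinearMap.mul ℝ ℂ Complex.I).contDiff.contMDiff.contMDiffAt.comp
      x (hi _))

lemma coframe_cvec {x : M} (hx : x ∈ f.U) (i j : Fin (m + 1)) :
    f.coframe x (f.cvec x i) j = if i = j then 1 else 0 := by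
  classical
  have h0 : f.cvec x 0 = f.vec x none := rfl
  have hs : ∀ α : Fin m, f.cvec x α.succ = f.vec x (some (Sum.inl α)) := fun α ↦ rfl
  refine Fin.cases ?_ (fun α ↦ ?_) i <;> refine Fin.cases ?_ (fun β ↦ ?_) j
  · simp [coframe_zero, h0, coord_vec, hx]
  · simp [coframe_succ, h0, coord_vec, hx, (Fin.succ_ne_zero β).symm]
  · simp [coframe_zero, hs, coord_vec, hx, Fin.succ_ne_zero]
  · simp [coframe_succ, hs, coord_vec, hx, Pi.single_apply, eq_comm, apply_ite]

lemma smooth_cvec (j : Fin (m + 1)) {x : M} (hx : x ∈ f.U) :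
    SmoothVFAt (fun y ↦ f.cvec y j) x := by
  refine Fin.cases ?_ (fun α ↦ ?_) j
  · exact f.smooth_N x hx
  · exact f.smooth_e α x hx

end CRFrame


/-! ## The canonical circle bundle -/

/-- Complex-valued `(m + 1)`-forms at `x`. -/
abbrev Form (m : ℕ) {M : Type*} [TopologicalSpace M] [ChartedSpace (CRModel m) M] (x : M) : Type :=
  Tan m x [⋀^Fin (m + 1)]→ₗ[ℝ] ℂ

/-- `ρ ∈ Λ^{m+1,0}_x`: the insertion of any vector `v + i Jv` of `T_{01}` into `ρ` vanishes. -/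
def CRData.IsCanonical (D : CRData m M) (x : M) (ρ : Form m x) : Prop :=
  ∀ v : D.H x, ρ.curryLeft (v : Tan m x) + Complex.I • ρ.curryLeft (D.J x v : Tan m x) = 0

/-- The fibre of `K^*`, the canonical line bundle `Λ^{m+1,0}` without its zero section. -/
def CRData.CanonicalFibre (D : CRData m M) (x : M) : Type :=
  {ρ : Form m x // D.IsCanonical x ρ ∧ ρ ≠ 0}

/-- Two forms are identified if they differ by a positive real factor. -/
def CRData.rayRel (D : CRData m M) (x : M) : Setoid (D.CanonicalFibre x) where
  r ρ ρ' := ∃ r : ℝ, 0 < r ∧ ρ'.1 = r • ρ.1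
  iseqv :=
    { refl := fun ρ ↦ ⟨1, one_pos, by simp⟩
      symm := by
        rintro ρ ρ' ⟨r, hr, h⟩
        exact ⟨r⁻¹, inv_pos.2 hr, by rw [h, smul_smul, inv_mul_cancel₀ hr.ne', one_smul]⟩
      trans := by
        rintro ρ ρ' ρ'' ⟨r, hr, h⟩ ⟨s, hs, h'⟩
        exact ⟨s * r, mul_pos hs hr, by rw [h', h, smul_smul]⟩ }

/-- The total space of the canonical circle bundle `F_c = K^* / ℝ⁺` of an almost CR structure. -/
def CircleBundle (C : CRStructure m M) : Type _ :=
  Σ x : M, Quotient (C.rayRel x)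

/-- The phase `z / |z|` of a complex number (with value `1` at `0`). -/
def phase (z : ℂ) : Circle :=
  if h : z = 0 then 1 else
    ⟨z / ‖z‖, mem_sphere_zero_iff_norm.2 (by
      rw [norm_div, Complex.norm_real, norm_norm, div_self (norm_ne_zero_iff.2 h)])⟩

lemma coe_phase {z : ℂ} (h : z ≠ 0) : (phase z : ℂ) = z / ‖z‖ := by
  simp [phase, h]

lemma phase_mul {z w : ℂ} (hz : z ≠ 0) (hw : w ≠ 0) : phase (z * w) = phase z * phase w := by
  ext
  rw [coe_phase (mul_ne_zero hz hw), Circle.coe_mul, coe_phase hz, coe_phase hw, norm_mul]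
  push_cast
  rw [div_mul_div_comm]

lemma phase_coe (c : Circle) : phase (c : ℂ) = c := by
  ext
  rw [coe_phase c.coe_ne_zero, Circle.norm_coe]
  simp

lemma phase_real_smul {r : ℝ} (hr : 0 < r) (z : ℂ) : phase (r • z) = phase z := by
  by_cases hz : z = 0
  · simp [hz]
  · have h : r • z ≠ 0 := smul_ne_zero hr.ne' hz
    ext
    rw [coe_phase h, coe_phase hz, Complex.real_smul, norm_mul, Complex.norm_real,
      Real.norm_of_nonneg hr.le]
    push_cast
    rw [mul_div_mul_left _ _ (Complex.ofReal_ne_zero.2 hr.ne')]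

lemma eq_norm_smul_phase (z : ℂ) : z = ‖z‖ • (phase z : ℂ) := by
  by_cases hz : z = 0
  · simp [hz]
  · rw [coe_phase hz, Complex.real_smul, mul_div_cancel₀]
    exact Complex.ofReal_ne_zero.2 (norm_ne_zero_iff.2 hz)

lemma phase_eq_exp (z : ℂ) : phase z = Circle.exp z.arg := by
  ext
  by_cases hz : z = 0
  · simp [phase, hz]
  · rw [coe_phase hz, Circle.coe_exp, div_eq_iff (Complex.ofReal_ne_zero.2 (norm_ne_zero_iff.2 hz)),
      mul_comm, Complex.norm_mul_exp_arg_mul_I]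

lemma contMDiffAt_phase {z : ℂ} (hz : z ≠ 0) :
    ContMDiffAt 𝓘(ℝ, ℂ) (𝓡 1) ∞ phase z := by
  have h1 : z * z⁻¹ ∈ Complex.slitPlane := by rw [mul_inv_cancel₀ hz]; simp
  have h2 : ContDiffAt ℝ ∞ (fun w : ℂ ↦ (w * z⁻¹).arg) z := by
    have h := ((Complex.contDiffAt_log (n := ∞) h1).restrict_scalars ℝ).comp z
      (contDiffAt_id.mul contDiffAt_const)
    have h' := Complex.imCLM.contDiff.contDiffAt.comp z h
    exact h'.congr_of_eventuallyEq (Filter.Eventually.of_forall fun w ↦ by simp [Complex.log_im])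
  have h3 : ContMDiffAt 𝓘(ℝ, ℂ) (𝓡 1) ∞ (fun w : ℂ ↦ phase z * Circle.exp (w * z⁻¹).arg) z :=
    contMDiffAt_const.mul ((contMDiff_circleExp (m := ∞)).contMDiffAt.comp z h2.contMDiffAt)
  refine h3.congr_of_eventuallyEq ?_
  filter_upwards [isOpen_ne.mem_nhds hz] with w hw
  rw [← phase_eq_exp, ← phase_mul hz (mul_ne_zero hw (inv_ne_zero hz))]
  congr 1
  field_simp

namespace CRFrame

variable {D : CRData m M} (f : CRFrame D)

lemma canonical_J {x : M} {ρ : Form m x} (hρ : D.IsCanonical x ρ) (v : Fin (m + 1) → Tan m x)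
    (i : Fin (m + 1)) (w : D.H x) :
    ρ (Function.update v i (D.J x w : Tan m x)) =
      Complex.I * ρ (Function.update v i (w : Tan m x)) := by
  classical
  have h0 : ∀ (u : Fin m → Tan m x), ρ (Fin.cons (D.J x w : Tan m x) u) =
      Complex.I * ρ (Fin.cons (w : Tan m x) u) := by
    intro u
    have h := congrArg (fun σ : Tan m x [⋀^Fin m]→ₗ[ℝ] ℂ ↦ σ u) (hρ w)
    have h' : ρ (Fin.cons (w : Tan m x) u) +
        Complex.I * ρ (Fin.cons (D.J x w : Tan m x) u) = 0 := h
    linear_combination (-Complex.I) * h' + ρ (Fin.cons (D.J x w : Tan m x) u) * Complex.I_mul_I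
  have h1 : ∀ a : Tan m x, ∀ v : Fin (m + 1) → Tan m x,
      Function.update v 0 a = Fin.cons a (Fin.tail v) := by
    intro a v
    conv_lhs => rw [← Fin.cons_self_tail v, Fin.update_cons_zero]
  by_cases hi : i = 0
  · subst hi
    rw [h1, h1, h0]
  · have hsw : ∀ a : Tan m x, ρ (Function.update v i a) =
        - ρ (Function.update (v ∘ Equiv.swap 0 i) 0 a) := by
      intro a
      have : Function.update (v ∘ Equiv.swap 0 i) 0 a =
          (Function.update v i a) ∘ Equiv.swap 0 i := by
        ext j : 1
        by_cases hj : j = 0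
        · subst hj; simp
        · have : Equiv.swap 0 i j ≠ i := fun h ↦ hj (by
            have := congrArg (Equiv.swap 0 i) h
            simpa using this)
          simp [hj, this]
      rw [this, ρ.map_swap _ (Ne.symm hi), neg_neg]
    rw [hsw, hsw, h1, h1, h0]
    ring

/-- The local section `η^0 ∧ … ∧ η^m` of `Λ^{m+1,0}`, whose value on `(N, e_1, …, e_m)` is `1`. -/
def detForm (x : M) : Form m x :=
  { ((Matrix.detRowAlternating (n := Fin (m + 1)) (R := ℂ)).toMultilinearMap.restrictScalars
      ℝ).compLinearMap (fun _ ↦ f.coframe x) with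
    map_eq_zero_of_eq' := fun v i j hij hne ↦
      (Matrix.detRowAlternating (n := Fin (m + 1)) (R := ℂ)).map_eq_zero_of_eq
        (fun k ↦ f.coframe x (v k)) (by simp [hij]) hne }

lemma detForm_apply (x : M) (v : Fin (m + 1) → Tan m x) :
    f.detForm x v = Matrix.det (Matrix.of fun i ↦ f.coframe x (v i)) := rfl

lemma detForm_cvec {x : M} (hx : x ∈ f.U) : f.detForm x (f.cvec x) = 1 := by
  have : (Matrix.of fun i ↦ f.coframe x (f.cvec x i)) = (1 : Matrix _ _ ℂ) := by
    ext i j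
    simp [f.coframe_cvec hx, Matrix.one_apply]
  rw [detForm_apply, this, Matrix.det_one]

lemma detForm_ne_zero {x : M} (hx : x ∈ f.U) : f.detForm x ≠ 0 := fun h ↦ by
  have := f.detForm_cvec hx
  simp [h] at this

lemma span_H {x : M} (hx : x ∈ f.U) (v : D.H x) :
    ∃ a b : Fin m → ℝ, v = ∑ α, (a α • f.e α x + b α • D.J x (f.e α x)) := by
  let w : Fin m ⊕ Fin m → D.H x := Sum.elim (fun α ↦ f.e α x) (fun α ↦ D.J x (f.e α x))
  have hli : LinearIndependent ℝ w := by
    refine LinearIndependent.of_comp (D.H x).subtype ?_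
    have := (f.linearIndependent x hx).comp _ (Option.some_injective _)
    convert this using 1
    ext i
    rcases i with α | α <;> rfl
  have hc : Fintype.card (Fin m ⊕ Fin m) = Module.finrank ℝ (D.H x) := by
    rw [D.finrank_H x]; simp [two_mul]
  let b := (Module.Basis.mk (v := w) hli (hli.span_eq_top_of_card_eq_finrank' hc).ge)
  refine ⟨fun α ↦ b.repr v (Sum.inl α), fun α ↦ b.repr v (Sum.inr α), ?_⟩
  rw [Finset.sum_add_distrib]
  conv_lhs => rw [← b.sum_repr v]
  simp [b, w]

lemma coord_sum {x : M} (hx : x ∈ f.U) (a b : Fin m → ℝ) :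
    f.coord x ((∑ α, (a α • f.e α x + b α • D.J x (f.e α x)) : D.H x) : Tan m x) =
      fun i ↦ i.elim 0 (Sum.elim a b) := by
  rw [← f.coord_unique hx (fun i ↦ i.elim 0 (Sum.elim a b))]
  congr 1
  simp [Fintype.sum_option, vec, Finset.sum_add_distrib]

lemma coframe_J {x : M} (hx : x ∈ f.U) (v : D.H x) :
    f.coframe x (D.J x v : Tan m x) = Complex.I • f.coframe x (v : Tan m x) := by
  obtain ⟨a, b, rfl⟩ := f.span_H hx v
  have h : D.J x (∑ α, (a α • f.e α x + b α • D.J x (f.e α x))) =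
      ∑ α, ((- b α) • f.e α x + a α • D.J x (f.e α x)) := by
    rw [map_sum]
    refine Finset.sum_congr rfl fun α _ ↦ ?_
    rw [map_add, map_smul, map_smul, D.J_sq]
    module
  rw [h]
  ext j
  refine Fin.cases ?_ (fun α ↦ ?_) j
  · simp only [coframe_zero, Pi.smul_apply, coord_sum f hx, smul_eq_mul]
    simp
  · simp only [coframe_succ, Pi.smul_apply, coord_sum f hx, smul_eq_mul]
    simp [mul_add, ← mul_assoc, add_comm]

lemma detForm_canonical {x : M} (hx : x ∈ f.U) : D.IsCanonical x (f.detForm x) := by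
  intro v
  ext u
  have h : f.detForm x (Fin.cons (D.J x v : Tan m x) u) =
      Complex.I * f.detForm x (Fin.cons (v : Tan m x) u) := by
    have h0 : ∀ w : Tan m x, (Matrix.of fun i ↦ f.coframe x (Fin.cons (α := fun _ ↦ Tan m x) w u i))
        = Matrix.updateRow (Matrix.of fun i ↦ f.coframe x
          (Fin.cons (α := fun _ ↦ Tan m x) 0 u i)) 0 (f.coframe x w) := by
      intro w
      ext i j
      refine Fin.cases ?_ (fun k ↦ ?_) i
      · simp
      · simp
    rw [detForm_apply, detForm_apply, h0, h0 (v : Tan m x), f.coframe_J hx, Matrix.det_updateRow_smul]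
  have h' : f.detForm x (Fin.cons (v : Tan m x) u) +
      Complex.I * f.detForm x (Fin.cons (D.J x v : Tan m x) u) = 0 := by
    rw [h]
    linear_combination f.detForm x (Fin.cons (v : Tan m x) u) * Complex.I_mul_I
  exact h'

lemma canonical_ext {x : M} (hx : x ∈ f.U) {ρ : Form m x} (hρ : D.IsCanonical x ρ)
    (h : ρ (f.cvec x) = 0) : ρ = 0 := by
  classical
  -- the values on tuples of the vectors `N, e_α`
  have h1 : ∀ k : Fin (m + 1) → Fin (m + 1), ρ (fun i ↦ f.cvec x (k i)) = 0 := by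
    intro k
    by_cases hk : Function.Injective k
    · have := ρ.map_perm (f.cvec x) (Equiv.ofBijective k (Finite.injective_iff_bijective.1 hk))
      have h2 : ρ (fun i ↦ f.cvec x (k i)) = _ := this
      rw [h2, h, smul_zero]
    · simp only [Function.Injective, not_forall] at hk
      obtain ⟨i, j, hij, hne⟩ := hk
      exact ρ.map_eq_zero_of_eq _ (congrArg _ hij) hne
  have hv : ∀ w : Option (Fin m ⊕ Fin m), (∃ k, f.vec x w = f.cvec x k) ∨
      ∃ α, f.vec x w = (D.J x (f.e α x) : Tan m x) := by
    rintro (_ | α | α)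
    · exact Or.inl ⟨0, rfl⟩
    · exact Or.inl ⟨α.succ, rfl⟩
    · exact Or.inr ⟨α, rfl⟩
  -- replace the vectors `J e_α` by `e_α`, one slot at a time
  have h2 : ∀ (s : Finset (Fin (m + 1))) (v : Fin (m + 1) → Tan m x),
      (∀ i, i ∈ s → ∃ w, v i = f.vec x w) → (∀ i, i ∉ s → ∃ k, v i = f.cvec x k) → ρ v = 0 := by
    intro s
    induction s using Finset.induction_on with
    | empty =>
      intro v _ hc
      choose k hk using fun i ↦ hc i (Finset.notMem_empty i)
      rw [funext hk]
      exact h1 k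
    | insert i s hi ih =>
      intro v hs hc
      obtain ⟨w, hw⟩ := hs i (Finset.mem_insert_self i s)
      have key : ∀ k, ρ (Function.update v i (f.cvec x k)) = 0 := by
        intro k
        refine ih _ (fun j hj ↦ ?_) (fun j hj ↦ ?_)
        · have hji : j ≠ i := fun h ↦ hi (h ▸ hj)
          rw [Function.update_of_ne hji]
          exact hs j (Finset.mem_insert_of_mem hj)
        · by_cases hji : j = i
          · subst hji
            exact ⟨k, Function.update_self ..⟩
          · rw [Function.update_of_ne hji]
            exact hc j (by simp [hji, hj])
      rcases hv w with ⟨k, hk⟩ | ⟨α, hα⟩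
      · rw [← Function.update_eq_self i v, hw, hk]
        exact key k
      · rw [← Function.update_eq_self i v, hw, hα, canonical_J hρ]
        have : ((f.e α x : D.H x) : Tan m x) = f.cvec x α.succ := rfl
        rw [this, key, mul_zero]
  refine Module.Basis.ext_alternating (f.basis hx) fun v _ ↦ ?_
  exact h2 Finset.univ _ (fun i _ ↦ ⟨v i, f.basis_apply hx _⟩)
    (fun i hi ↦ absurd (Finset.mem_univ i) hi)

end CRFrame

/-- The `S¹`-action on `K^*`: multiplication of a form by a unit complex number. -/
def CRFrame.unitForm {C : CRStructure m M} (f : CRFrame C.toCRData) {x : M} (hx : x ∈ f.U)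
    (z : Circle) : C.CanonicalFibre x :=
  ⟨(z : ℂ) • f.detForm x, by
    constructor
    · intro v
      have h := congrArg (fun σ : Tan m x [⋀^Fin m]→ₗ[ℝ] ℂ ↦ (z : ℂ) • σ) (f.detForm_canonical hx v)
      simp only [smul_zero, smul_add] at h
      rw [smul_comm (z : ℂ) Complex.I] at h
      exact h
    · exact smul_ne_zero z.coe_ne_zero (f.detForm_ne_zero hx)⟩

namespace CircleBundle

variable {C : CRStructure m M}

/-- The projection `π : F_c → M`. -/
def proj (p : CircleBundle C) : M := p.1

end CircleBundle

namespace CRFrame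

variable {C : CRStructure m M} (f : CRFrame C.toCRData)

/-- The fibre coordinate on `F_c` of a local frame: the phase of `ρ(N, e_1, …, e_m)`. -/
def angle (p : CircleBundle C) : Circle :=
  Quotient.lift (fun ρ : C.CanonicalFibre p.1 ↦ phase (ρ.1 (f.cvec p.1))) (by
    rintro ρ ρ' ⟨r, hr, h⟩
    rw [h]
    exact (phase_real_smul hr _).symm) p.2

lemma angle_mk (x : M) (ρ : C.CanonicalFibre x) :
    f.angle (⟨x, Quotient.mk (C.rayRel x) ρ⟩ : CircleBundle C) = phase (ρ.1 (f.cvec x)) := rfl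

lemma eval_ne_zero {x : M} (hx : x ∈ f.U) (ρ : C.CanonicalFibre x) : ρ.1 (f.cvec x) ≠ 0 :=
  fun h ↦ ρ.2.2 (f.canonical_ext hx ρ.2.1 h)

lemma eq_smul_detForm {x : M} (hx : x ∈ f.U) (ρ : C.CanonicalFibre x) :
    ρ.1 = ρ.1 (f.cvec x) • f.detForm x := by
  refine sub_eq_zero.1 (f.canonical_ext hx ?_ ?_)
  · intro v
    have h1 := ρ.2.1 v
    have h2 := congrArg (fun σ : Tan m x [⋀^Fin m]→ₗ[ℝ] ℂ ↦ ρ.1 (f.cvec x) • σ)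
      (f.detForm_canonical hx v)
    simp only [smul_zero, smul_add] at h2
    rw [smul_comm _ Complex.I] at h2
    have h3 := congrArg₂ (fun a b ↦ a - b) h1 h2
    simp only [sub_zero] at h3
    rw [← h3]
    ext u
    simp
    ring
  · simp [f.detForm_cvec hx]

/-- The point of `F_c` over `x` with given fibre coordinate. -/
def point {x : M} (hx : x ∈ f.U) (z : Circle) : CircleBundle C :=
  ⟨x, Quotient.mk (C.rayRel x) (f.unitForm hx z)⟩

lemma angle_point {x : M} (hx : x ∈ f.U) (f' : CRFrame C.toCRData) (hx' : x ∈ f'.U) (z : Circle) :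
    f'.angle (f.point hx z) = z * phase (f.detForm x (f'.cvec x)) := by
  have h : f.detForm x (f'.cvec x) ≠ 0 :=
    f'.eval_ne_zero hx' ⟨f.detForm x, f.detForm_canonical hx, f.detForm_ne_zero hx⟩
  change phase ((z : ℂ) • f.detForm x (f'.cvec x)) = _
  rw [smul_eq_mul, phase_mul z.coe_ne_zero h, phase_coe]

lemma angle_point_self {x : M} (hx : x ∈ f.U) (z : Circle) : f.angle (f.point hx z) = z := by
  rw [angle_point f hx f hx, f.detForm_cvec hx]
  have : phase (1 : ℂ) = 1 := by simpa using phase_coe 1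
  rw [this, mul_one]

lemma point_angle (p : CircleBundle C) (hp : p.1 ∈ f.U) : f.point hp (f.angle p) = p := by
  obtain ⟨x, q⟩ := p
  induction q using Quotient.inductionOn with
  | _ ρ =>
    refine Sigma.ext rfl (heq_of_eq (Quotient.sound ?_))
    refine ⟨‖ρ.1 (f.cvec x)‖, norm_pos_iff.2 (f.eval_ne_zero hp ρ), ?_⟩
    rw [unitForm, angle_mk, ← smul_assoc, ← eq_norm_smul_phase]
    exact f.eq_smul_detForm hp ρ

/-- The local trivialization of `F_c` given by a frame. -/
def chart : PartialEquiv (CircleBundle C) (M × Circle) where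
  toFun p := (p.1, f.angle p)
  invFun q := open Classical in
    if h : q.1 ∈ f.U then f.point h q.2 else (C.frameAt q.1).point (C.mem_frameAt q.1) q.2
  source := {p | p.1 ∈ f.U}
  target := f.U ×ˢ Set.univ
  map_source' p hp := ⟨hp, trivial⟩
  map_target' q hq := by
    have h : q.1 ∈ f.U := hq.1
    simp only [h, dite_true]
    exact h
  left_inv' p hp := by
    have h : p.1 ∈ f.U := hp
    simp [h, point_angle]
  right_inv' q hq := by
    have h : q.1 ∈ f.U := hq.1
    simp only [h, dite_true]
    exact Prod.ext rfl (f.angle_point_self h q.2)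

lemma chart_symm {q : M × Circle} (h : q.1 ∈ f.U) : f.chart.symm q = f.point h q.2 := dif_pos h

lemma smooth_transition (f' : CRFrame C.toCRData) {x : M} (hx : x ∈ f.U) (hx' : x ∈ f'.U) :
    ContMDiffAt 𝓘(ℝ, CRModel m) (𝓡 1) ∞ (fun y ↦ phase (f.detForm y (f'.cvec y))) x := by
  have h : f.detForm x (f'.cvec x) ≠ 0 :=
    f'.eval_ne_zero hx' ⟨f.detForm x, f.detForm_canonical hx, f.detForm_ne_zero hx⟩
  have h1 : ContMDiffAt 𝓘(ℝ, CRModel m) 𝓘(ℝ, Fin (m + 1) → Fin (m + 1) → ℂ) ∞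
      (fun y i j ↦ f.coframe y (f'.cvec y i) j) x :=
    contMDiffAt_pi_space.2 fun i ↦ contMDiffAt_pi_space.2 fun j ↦
      f.smooth_coframe hx (f'.smooth_cvec i hx') j
  have h2 : ContDiff ℝ ∞ (fun A : Fin (m + 1) → Fin (m + 1) → ℂ ↦ Matrix.det (Matrix.of A)) := by
    simp only [Matrix.det_apply]
    refine ContDiff.sum fun σ _ ↦ ContDiff.const_smul _ ?_
    refine contDiff_prod fun i _ ↦ ?_
    simp only [Matrix.of_apply]
    fun_prop
  exact (contMDiffAt_phase h).comp x (h2.contMDiff.contMDiffAt.comp x h1)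

lemma chart_transition (f' : CRFrame C.toCRData) (q : M × Circle)
    (hq : q ∈ (f.chart.symm.trans f'.chart).source) :
    (f.chart.symm.trans f'.chart) q = (q.1, q.2 * phase (f.detForm q.1 (f'.cvec q.1))) ∧
      q.1 ∈ f.U ∧ q.1 ∈ f'.U := by
  have h1 : q.1 ∈ f.U := hq.1.1
  have h3 : f.chart.symm q = f.point h1 q.2 := f.chart_symm h1
  have h2 : q.1 ∈ f'.U := by
    have : f.chart.symm q ∈ f'.chart.source := hq.2
    rw [h3] at this
    exact this
  refine ⟨?_, h1, h2⟩
  have h4 : (f.chart.symm.trans f'.chart) q = f'.chart (f.chart.symm q) := rfl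
  rw [h4, h3]
  exact Prod.ext rfl (f.angle_point h1 f' h2 q.2)

lemma chart_transition_source (f' : CRFrame C.toCRData) :
    (f.chart.symm.trans f'.chart).source = (f.U ∩ f'.U) ×ˢ Set.univ := by
  ext q
  constructor
  · intro hq
    exact ⟨(f.chart_transition f' q hq).2, trivial⟩
  · rintro ⟨⟨h1, h2⟩, -⟩
    refine ⟨⟨h1, trivial⟩, ?_⟩
    have h3 : f.chart.symm q = f.point h1 q.2 := f.chart_symm h1
    change f.chart.symm q ∈ f'.chart.source
    rw [h3]
    exact h2

lemma contMDiffOn_chart_transition (f' : CRFrame C.toCRData) :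
    ContMDiffOn (𝓘(ℝ, CRModel m).prod (𝓡 1)) (𝓘(ℝ, CRModel m).prod (𝓡 1)) ∞
      (f.chart.symm.trans f'.chart) (f.chart.symm.trans f'.chart).source := by
  have h : ContMDiffOn (𝓘(ℝ, CRModel m).prod (𝓡 1)) (𝓘(ℝ, CRModel m).prod (𝓡 1)) ∞
      (fun q : M × Circle ↦ (q.1, q.2 * phase (f.detForm q.1 (f'.cvec q.1))))
      (f.chart.symm.trans f'.chart).source := by
    intro q hq
    obtain ⟨-, h1, h2⟩ := f.chart_transition f' q hq
    exact (contMDiffAt_fst.prodMk (contMDiffAt_snd.mul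
      ((f.smooth_transition f' h1 h2).comp q contMDiffAt_fst))).contMDiffWithinAt
  exact h.congr fun q hq ↦ (f.chart_transition f' q hq).1

end CRFrame

/-! ### The manifold structure of `F_c` -/

namespace CircleBundle

variable {C : CRStructure m M}

/-- The local trivializations as an atlas of `F_c`. -/
def core (C : CRStructure m M) : ChartedSpaceCore (M × Circle) (CircleBundle C) where
  atlas := Set.range fun f : CRFrame C.toCRData ↦ f.chart
  chartAt p := (C.frameAt p.1).chart
  mem_chart_source p := C.mem_frameAt p.1
  chart_mem_atlas p := ⟨_, rfl⟩
  open_source := by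
    rintro _ _ ⟨f, rfl⟩ ⟨f', rfl⟩
    rw [f.chart_transition_source f']
    exact (f.isOpen_U.inter f'.isOpen_U).prod isOpen_univ
  continuousOn_toFun := by
    rintro _ _ ⟨f, rfl⟩ ⟨f', rfl⟩
    exact (f.contMDiffOn_chart_transition f').continuousOn

instance : TopologicalSpace (CircleBundle C) := (core C).toTopologicalSpace

instance : ChartedSpace (M × Circle) (CircleBundle C) := (core C).toChartedSpace

/-- The model with corners of `F_c`. -/
abbrev model (m : ℕ) := 𝓘(ℝ, CRModel m).prod (𝓡 1)

instance : ChartedSpace (ModelProd (CRModel m) (EuclideanSpace ℝ (Fin 1))) (CircleBundle C) :=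
  ChartedSpace.comp (ModelProd (CRModel m) (EuclideanSpace ℝ (Fin 1))) (M × Circle) (CircleBundle C)

/-- The groupoid of local diffeomorphisms of `M × S¹`. -/
def smoothGroupoid (m : ℕ) (M : Type*) [TopologicalSpace M] [ChartedSpace (CRModel m) M] :
    StructureGroupoid (M × Circle) :=
  Pregroupoid.groupoid
    { property := fun g s ↦ ContMDiffOn (model m) (model m) ∞ g s
      comp := fun {_ _ _ _} hf hg _ _ _ ↦ hg.comp (hf.mono Set.inter_subset_left)
        Set.inter_subset_right
      id_mem := contMDiffOn_id
      locality := fun {_ _} _ h x hx ↦ by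
        obtain ⟨v, hv, hxv, h'⟩ := h x hx
        exact (contMDiffWithinAt_inter (hv.mem_nhds hxv)).1 (h' x ⟨hx, hxv⟩)
      congr := fun {_ _ _} _ h hf ↦ hf.congr h }

instance : HasGroupoid (CircleBundle C) (smoothGroupoid m M) where
  compatible := by
    have h : ∀ e e' : OpenPartialHomeomorph (CircleBundle C) (M × Circle),
        e ∈ atlas (M × Circle) (CircleBundle C) → e' ∈ atlas (M × Circle) (CircleBundle C) →
        ContMDiffOn (model m) (model m) ∞ (e.symm.trans e') (e.symm.trans e').source := by
      intro e e' he he'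
      obtain ⟨_, ⟨_, rfl⟩, _, ⟨⟨f, rfl⟩, rfl⟩, rfl⟩ := he
      obtain ⟨_, ⟨_, rfl⟩, _, ⟨⟨f', rfl⟩, rfl⟩, rfl⟩ := he'
      exact f.contMDiffOn_chart_transition f'
    exact fun {e e'} he he' ↦ ⟨h e e' he he', h e' e he' he⟩

instance : IsManifold (model m) ∞ (CircleBundle C) := by
  refine { StructureGroupoid.HasGroupoid.comp (smoothGroupoid m M) ?_ with }
  intro e he
  rw [isLocalStructomorphOn_contDiffGroupoid_iff]
  exact he

end CircleBundle

/-! ## Pseudo-Hermitian structures -/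

/-- A one-form `θ` in the preferred chart at `x₀`. -/
def formInChart (θ : ∀ x : M, Tan m x →L[ℝ] ℝ) (x₀ : M) (y : CRModel m) : CRModel m →L[ℝ] ℝ :=
  (θ ((extChartAt 𝓘(ℝ, CRModel m) x₀).symm y)).comp
    (mfderiv 𝓘(ℝ, CRModel m) 𝓘(ℝ, CRModel m) (extChartAt 𝓘(ℝ, CRModel m) x₀).symm y)

/-- The exterior derivative `dθ(v, w) = D_v θ(w) - D_w θ(v)` at `x`, computed in the preferred chart
at `x`, which identifies `T_x M` with the model space. -/
def extD (θ : ∀ x : M, Tan m x →L[ℝ] ℝ) (x : M) : Tan m x →ₗ[ℝ] Tan m x →ₗ[ℝ] ℝ :=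
  let D : Tan m x →L[ℝ] Tan m x →L[ℝ] ℝ :=
    fderiv ℝ (formInChart θ x) (extChartAt 𝓘(ℝ, CRModel m) x x)
  LinearMap.mk₂ ℝ (fun v w : Tan m x ↦ D v w - D w v)
    (by intros; simp; ring) (by intros; simp; ring) (by intros; simp; ring) (by intros; simp; ring)

lemma extD_antisymm (θ : ∀ x : M, Tan m x →L[ℝ] ℝ) (x : M) (v w : Tan m x) :
    extD θ x v w = - extD θ x w v := (neg_sub _ _).symm

/-- Smoothness of a one-form with values in a normed space. -/
def SmoothForm {V : Type*} [NormedAddCommGroup V] [NormedSpace ℝ V]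
    (θ : ∀ x : M, Tan m x →L[ℝ] V) : Prop :=
  ContMDiff 𝓘(ℝ, CRModel m) (𝓘(ℝ, CRModel m).prod 𝓘(ℝ, CRModel m →L[ℝ] V)) ∞
    (fun x ↦ TotalSpace.mk' (CRModel m →L[ℝ] V)
      (E := fun x : M ↦ TangentSpace 𝓘(ℝ, CRModel m) x →L[ℝ] Bundle.Trivial M V x) x (θ x))

/-- A (positive) pseudo-Hermitian form: a smooth nowhere vanishing one-form `θ` with `θ|_H = 0`
whose Levi form `L_θ(v, w) = dθ(v, J w)` on `H` is positive definite. -/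
structure PseudoHermitian (C : CRStructure m M) where
  form : ∀ x : M, Tan m x →L[ℝ] ℝ
  smooth : SmoothForm form
  ne_zero : ∀ x, form x ≠ 0
  vanish : ∀ x (v : C.H x), form x (v : Tan m x) = 0
  pos : ∀ x (v : C.H x), v ≠ 0 → 0 < extD form x (v : Tan m x) (C.J x v : Tan m x)

namespace PseudoHermitian

variable {C : CRStructure m M} (θ : PseudoHermitian C)

lemma mem_H {x : M} {v : Tan m x} : v ∈ C.H x ↔ θ.form x v = 0 := by
  have hle : C.H x ≤ LinearMap.ker (θ.form x).toLinearMap := fun v hv ↦ θ.vanish x ⟨v, hv⟩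
  have hne : (θ.form x).toLinearMap ≠ 0 := fun h ↦ θ.ne_zero x (by ext v; exact congr($h v))
  have h1 := Module.Dual.finrank_ker_add_one_of_ne_zero (f := (θ.form x).toLinearMap) hne
  have h2 : Module.finrank ℝ (Tan m x) = 2 * m + 1 := by
    change Module.finrank ℝ (CRModel m) = _
    simp
  have h3 := Submodule.eq_of_le_of_finrank_eq hle (by rw [C.finrank_H]; omega)
  rw [h3]
  rfl

lemma exists_reeb (x : M) :
    ∃ T : Tan m x, θ.form x T = 1 ∧ ∀ v, extD θ.form x T v = 0 := by
  let Φ : Tan m x →ₗ[ℝ] Module.Dual ℝ (Tan m x) :=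
    extD θ.form x + (θ.form x).toLinearMap.smulRight (θ.form x).toLinearMap
  have hΦ : ∀ v w, Φ v w = extD θ.form x v w + θ.form x v * θ.form x w := fun v w ↦ rfl
  have hd : ∀ v, extD θ.form x v v = 0 := fun v ↦ by
    have := extD_antisymm θ.form x v v
    linarith
  have hH : ∀ v (hv : θ.form x v = 0), (∀ w ∈ C.H x, extD θ.form x v w = 0) → v = 0 := by
    intro v hv h
    by_contra hne
    have := θ.pos x ⟨v, θ.mem_H.2 hv⟩ (fun h ↦ hne (congrArg Subtype.val h))
    exact this.ne' (h _ (C.J x _).2)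
  have hinj : Function.Injective Φ := by
    rw [injective_iff_map_eq_zero]
    intro v hv
    have h0 : θ.form x v = 0 := by
      have := hΦ v v
      rw [hv, hd, zero_add] at this
      simpa using this.symm
    refine hH v h0 fun w _ ↦ ?_
    have := hΦ v w
    rw [hv, h0, zero_mul, add_zero] at this
    simpa using this.symm
  obtain ⟨T, hT⟩ := (LinearMap.injective_iff_surjective_of_finrank_eq_finrank
    (Subspace.dual_finrank_eq (K := ℝ) (V := Tan m x)).symm).1 hinj (θ.form x).toLinearMap
  have h1 : ∀ w, extD θ.form x T w + θ.form x T * θ.form x w = θ.form x w := fun w ↦ by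
    rw [← hΦ, hT]; rfl
  have h2 : θ.form x T = 1 := by
    have h3 := h1 T
    rw [hd, zero_add] at h3
    by_contra hne
    have h4 : θ.form x T = 0 := by
      have : θ.form x T * (θ.form x T - 1) = 0 := by linarith
      rcases mul_eq_zero.1 this with h | h
      · exact h
      · exact absurd (by linarith) hne
    have h5 : T = 0 := hH T h4 fun w hw ↦ by
      have := h1 w
      rw [h4, zero_mul, add_zero, θ.mem_H.1 hw] at this
      exact this
    apply θ.ne_zero x
    ext w
    have := h1 w
    rw [h5] at this
    simpa using this.symm
  refine ⟨T, h2, fun v ↦ ?_⟩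
  have := h1 v
  rw [h2] at this
  linarith

/-- The Reeb vector field `T`, determined by `θ(T) = 1` and `dθ(T, ·) = 0`. -/
def reeb (x : M) : Tan m x := (θ.exists_reeb x).choose

lemma form_reeb (x : M) : θ.form x (θ.reeb x) = 1 := (θ.exists_reeb x).choose_spec.1

/-- The projection of `TM = H ⊕ ℝT` onto `H`. -/
def projH (x : M) : Tan m x →ₗ[ℝ] C.H x :=
  LinearMap.codRestrict (C.H x)
    (LinearMap.id - (θ.form x).toLinearMap.smulRight (θ.reeb x))
    (fun v ↦ θ.mem_H.2 (by simp [θ.form_reeb]))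

lemma projH_apply (x : M) (v : Tan m x) :
    (θ.projH x v : Tan m x) = v - θ.form x v • θ.reeb x := rfl

lemma projH_coe (x : M) (v : C.H x) : θ.projH x (v : Tan m x) = v := by
  ext1
  rw [projH_apply, θ.vanish x v, zero_smul, sub_zero]

/-- The extension of `J` to `TM` with `J T = 0`. -/
def extJ (x : M) : Tan m x →ₗ[ℝ] Tan m x := (C.H x).subtype ∘ₗ C.J x ∘ₗ θ.projH x

/-- The symmetric bilinear form `L_θ` on `TM` (the real part of the Levi form): on `H` it is the
symmetric part of `dθ(v, J w)` (which is symmetric by partial integrability); `L_θ(T, ·) = 0`. -/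
def levi (x : M) : Tan m x →ₗ[ℝ] Tan m x →ₗ[ℝ] ℝ :=
  LinearMap.mk₂ ℝ (fun v w : Tan m x ↦
      (extD θ.form x (θ.projH x v : Tan m x) (θ.extJ x w)
        + extD θ.form x (θ.projH x w : Tan m x) (θ.extJ x v)) / 2)
    (by intros; simp; ring) (by intros; simp; ring) (by intros; simp; ring) (by intros; simp; ring)

lemma levi_symm (x : M) (v w : Tan m x) : θ.levi x v w = θ.levi x w v := by
  simp only [levi, LinearMap.mk₂_apply]; ring

lemma levi_coe (x : M) (v w : C.H x) : θ.levi x (v : Tan m x) (w : Tan m x) =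
    (extD θ.form x (v : Tan m x) (C.J x w : Tan m x)
      + extD θ.form x (w : Tan m x) (C.J x v : Tan m x)) / 2 := by
  simp [levi, extJ, projH_coe]

lemma levi_pos (x : M) (v : C.H x) (hv : v ≠ 0) : 0 < θ.levi x (v : Tan m x) (v : Tan m x) := by
  have := θ.pos x v hv
  rw [levi_coe]; linarith

lemma levi_projH (x : M) (v w : Tan m x) : θ.levi x (θ.projH x v : Tan m x) w = θ.levi x v w := by
  simp [levi, extJ, projH_coe]

lemma levi_J (x : M) (v w : C.H x) : θ.levi x (C.J x v : Tan m x) (w : Tan m x) =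
    - θ.levi x (v : Tan m x) (C.J x w : Tan m x) := by
  rw [levi_coe, levi_coe, C.J_sq, C.J_sq]
  have h1 := extD_antisymm θ.form x (v : Tan m x) (w : Tan m x)
  have h2 := extD_antisymm θ.form x (C.J x v : Tan m x) (C.J x w : Tan m x)
  simp only [Submodule.coe_neg, map_neg]
  linarith

end PseudoHermitian

/-! ### The Tanaka-Webster connection -/

/-- Linear connections on `TM`. -/
abbrev Connection (m : ℕ) (M : Type*) [TopologicalSpace M] [ChartedSpace (CRModel m) M]
    [IsManifold 𝓘(ℝ, CRModel m) ∞ M] : Type _ :=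
  CovariantDerivative 𝓘(ℝ, CRModel m) (CRModel m) (TangentSpace 𝓘(ℝ, CRModel m) : M → Type)

namespace PseudoHermitian

variable {C : CRStructure m M} (θ : PseudoHermitian C)

/-- The Nijenhuis tensor `N_J(X, Y) = [X, Y] - [JX, JY] + J([JX, Y] + [X, JY])` at `x`. -/
def nijenhuis (X Y : ∀ x, C.H x) (x : M) : Tan m x :=
  bracket (C.vf X) (C.vf Y) x - bracket (C.vf (C.Jf X)) (C.vf (C.Jf Y)) x
    + θ.extJ x (bracket (C.vf (C.Jf X)) (C.vf Y) x + bracket (C.vf X) (C.vf (C.Jf Y)) x)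

/-- The characterization of the Tanaka-Webster connection `∇` of `θ` as a connection on `TM`:
`θ` and `L_θ` are parallel (hence `∇T = 0` and `∇` preserves `H`), and the torsion is
`Tor(X, Y) = L_θ(JX, Y) T - N_J(X, Y) / 4` and `Tor(T, X) = - ([T, X] + J[T, JX]) / 2` for sections
`X`, `Y` of `H`. In terms of `T_{10}`, the latter mean that `∇_T U = pr_{10} [T, U]`,
`∇_{V̄} U = pr_{10} [V̄, U]` for sections `U`, `V` of `T_{10}`, and `∇J = 0`. -/
structure IsTanakaWebster (D : Connection m M) : Prop where
  form_parallel : ∀ (Y : ∀ x : M, Tan m x) (x : M), SmoothVFAt Y x → ∀ v : Tan m x,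
    mvfderiv 𝓘(ℝ, CRModel m) (fun y ↦ θ.form y (Y y)) x v = θ.form x (D.toFun Y x v)
  levi_parallel : ∀ (Y Z : ∀ x : M, Tan m x) (x : M), SmoothVFAt Y x → SmoothVFAt Z x →
    ∀ v : Tan m x, mvfderiv 𝓘(ℝ, CRModel m) (fun y ↦ θ.levi y (Y y) (Z y)) x v =
      θ.levi x (D.toFun Y x v) (Z x) + θ.levi x (Y x) (D.toFun Z x v)
  torsion_H : ∀ (X Y : ∀ x, C.H x) (x : M), SmoothVFAt (C.vf X) x → SmoothVFAt (C.vf (C.Jf X)) x →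
    SmoothVFAt (C.vf Y) x → SmoothVFAt (C.vf (C.Jf Y)) x →
    D.torsion x (X x : Tan m x) (Y x : Tan m x) =
      θ.levi x (C.J x (X x) : Tan m x) (Y x : Tan m x) • θ.reeb x
        - (1 / 4 : ℝ) • θ.nijenhuis X Y x
  torsion_reeb : ∀ (X : ∀ x, C.H x) (x : M), SmoothVFAt (C.vf X) x →
    SmoothVFAt (C.vf (C.Jf X)) x →
    D.torsion x (θ.reeb x) (X x : Tan m x) =
      - (1 / 2 : ℝ) • (bracket θ.reeb (C.vf X) x
        + θ.extJ x (bracket θ.reeb (C.vf (C.Jf X)) x))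

/-- The covariant derivative of the Tanaka-Webster connection (which exists and is unique):
`tanakaWebster Y x v = ∇_v Y`. -/
def tanakaWebster (Y : ∀ x : M, Tan m x) (x : M) : Tan m x →L[ℝ] Tan m x :=
  open Classical in if h : ∃ D : Connection m M, θ.IsTanakaWebster D then h.choose.toFun Y x else 0

/-- The curvature `R(v, w)u = ∇_V ∇_W U - ∇_W ∇_V U - ∇_{[V, W]} U` at `x`, where `U`, `V`, `W` are
smooth local extensions of `u`, `v`, `w`. -/
def curvature (x : M) (v w u : Tan m x) : Tan m x :=
  let ext : Tan m x → ∀ y : M, Tan m y := fun a ↦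
    FiberBundle.extend (E := (TangentSpace 𝓘(ℝ, CRModel m) : M → Type)) (CRModel m) a
  θ.tanakaWebster (fun y ↦ θ.tanakaWebster (ext u) y (ext w y)) x v
    - θ.tanakaWebster (fun y ↦ θ.tanakaWebster (ext u) y (ext v y)) x w
    - θ.tanakaWebster (ext u) x (bracket (ext v) (ext w) x)

lemma exists_orthonormal (x : M) : ∃ ε : Fin m → C.H x, ∀ α β,
    θ.levi x (ε α : Tan m x) (ε β : Tan m x) = (if α = β then 1 else 0) ∧
    θ.levi x (ε α : Tan m x) (C.J x (ε β) : Tan m x) = 0 := by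
  let B : C.H x →ₗ[ℝ] C.H x →ₗ[ℝ] ℝ :=
    ((θ.levi x).domRestrict₁₂ (C.H x) (C.H x))
  have hB : ∀ v w : C.H x, B v w = θ.levi x (v : Tan m x) (w : Tan m x) := fun v w ↦ rfl
  have hs : ∀ v w, B v w = B w v := fun v w ↦ θ.levi_symm x v w
  have hJ : ∀ v w, B (C.J x v) w = - B v (C.J x w) := fun v w ↦ θ.levi_J x v w
  have hJ0 : ∀ v, B v (C.J x v) = 0 := fun v ↦ by
    have h1 := hJ v v
    have h2 := hs (C.J x v) v
    linarith
  have key : ∀ k ≤ m, ∃ ε : ℕ → C.H x, ∀ α < k, ∀ β < k,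
      B (ε α) (ε β) = (if α = β then 1 else 0) ∧ B (ε α) (C.J x (ε β)) = 0 := by
    intro k
    induction k with
    | zero => exact fun _ ↦ ⟨0, fun α h ↦ absurd h (Nat.not_lt_zero α)⟩
    | succ k ih =>
      intro hk
      obtain ⟨ε, hε⟩ := ih (by omega)
      let Φ : C.H x →ₗ[ℝ] (Fin k ⊕ Fin k → ℝ) := LinearMap.pi
        (Sum.elim (fun α ↦ B (ε α)) (fun α ↦ B (C.J x (ε α))))
      have hker := LinearMap.ker_ne_bot_of_finrank_lt (f := Φ) (by
        rw [C.finrank_H]; simp; omega)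
      obtain ⟨v, hv, hne⟩ := Submodule.exists_mem_ne_zero_of_ne_bot hker
      have hv1 : ∀ α < k, B (ε α) v = 0 := fun α hα ↦
        congrFun (LinearMap.mem_ker.1 hv) (Sum.inl ⟨α, hα⟩)
      have hv2 : ∀ α < k, B (C.J x (ε α)) v = 0 := fun α hα ↦
        congrFun (LinearMap.mem_ker.1 hv) (Sum.inr ⟨α, hα⟩)
      have hpos : 0 < B v v := θ.levi_pos x v hne
      let r := (Real.sqrt (B v v))⁻¹
      have hr : r * r * B v v = 1 := by
        have := Real.mul_self_sqrt hpos.le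
        have h0 := (Real.sqrt_pos.2 hpos).ne'
        simp only [r]
        nth_rewrite 3 [← this]
        field_simp
      refine ⟨Function.update ε k (r • v), fun α hα β hβ ↦ ?_⟩
      rcases Nat.lt_succ_iff_lt_or_eq.1 hα with hα | rfl <;>
        rcases Nat.lt_succ_iff_lt_or_eq.1 hβ with hβ | rfl
      · rw [Function.update_of_ne hα.ne, Function.update_of_ne hβ.ne]
        exact hε α hα β hβ
      · rw [Function.update_of_ne hα.ne, Function.update_self, map_smul, map_smul, map_smul,
          hv1 α hα]
        have : B (ε α) (C.J x v) = 0 := by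
          have := hJ (ε α) v
          rw [hv2 α hα] at this
          linarith
        simp [this, hα.ne]
      · rw [Function.update_of_ne hβ.ne, Function.update_self, map_smul, LinearMap.smul_apply,
          LinearMap.smul_apply, hs v, hs v, hv1 β hβ, hv2 β hβ]
        simp [hβ.ne']
      · simp only [Function.update_self, map_smul, LinearMap.smul_apply, hJ0, smul_eq_mul]
        refine ⟨?_, by simp⟩
        rw [← mul_assoc, hr]
        simp
  obtain ⟨ε, hε⟩ := key m le_rfl
  refine ⟨fun α ↦ ε α, fun α β ↦ ?_⟩
  have := hε α α.2 β β.2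
  simp only [hB, ← Fin.ext_iff] at this
  exact this

/-- The vectors `e_1, e_3, …, e_{2m-1}` of an orthonormal basis `(e_1, J e_1, …)` of `H_x`. -/
def onb (x : M) : Fin m → C.H x := (θ.exists_orthonormal x).choose

/-- The Webster-Ricci curvature `Ric^W(v, w) = i ∑_α L_θ(R(v, w) e_α, J e_α)`. -/
def ricci (x : M) (v w : Tan m x) : ℂ :=
  Complex.I * ∑ α, (θ.levi x (θ.curvature x v w (θ.onb x α : Tan m x))
    (C.J x (θ.onb x α) : Tan m x) : ℂ)

/-- The Webster scalar curvature `scal^W = i ∑_α Ric^W(e_α, J e_α)` (a real number). -/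
def scal (x : M) : ℝ :=
  (Complex.I * ∑ α, θ.ricci x (θ.onb x α : Tan m x) (C.J x (θ.onb x α) : Tan m x)).re

end PseudoHermitian

/-! ## The geometry of the circle bundle -/

namespace CircleBundle

variable {C : CRStructure m M}

/-- The tangent space of `F_c` at `p`. -/
abbrev FTan (p : CircleBundle C) : Type := TangentSpace (model m) p

instance (p : CircleBundle C) : FiniteDimensional ℝ (FTan p) :=
  inferInstanceAs (FiniteDimensional ℝ (CRModel m × EuclideanSpace ℝ (Fin 1)))

lemma finrank_FTan (p : CircleBundle C) : Module.finrank ℝ (FTan p) = 2 * m + 2 := by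
  change Module.finrank ℝ (CRModel m × EuclideanSpace ℝ (Fin 1)) = _
  simp

/-- The differential `dπ : T_p F_c → T_{π(p)} M`. -/
def dproj (p : CircleBundle C) : FTan p →L[ℝ] Tan m p.proj :=
  mfderiv (model m) 𝓘(ℝ, CRModel m) (CircleBundle.proj : CircleBundle C → M) p

/-- The fibre coordinate `u` with values in `S¹ ⊂ ℂ` that belongs to the chosen frame at `π(p)`. -/
def fibreCoord (p q : CircleBundle C) : ℂ := ((C.frameAt p.proj).angle q : Circle)

/-- The differential `du` at `p` of the fibre coordinate `u`. -/
def dfibreCoord (p : CircleBundle C) : FTan p →L[ℝ] ℂ := mvfderiv (model m) (fibreCoord p) p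

/-- The local trivialization of `F_c` around `p` given by the chosen frame. -/
def triv (p q : CircleBundle C) : M × Circle := (q.proj, (C.frameAt p.proj).angle q)

lemma hasMFDerivAt_triv (p : CircleBundle C) :
    HasMFDerivAt (model m) (model m) (triv p) p
      (ContinuousLinearMap.id ℝ (CRModel m × EuclideanSpace ℝ (Fin 1))) := by
  let e : OpenPartialHomeomorph (CircleBundle C) (M × Circle) := chartAt (M × Circle) p
  have he : ∀ q, e q = triv p q := fun q ↦ rfl
  have hp : p ∈ e.source := mem_chart_source _ p
  refine ⟨(e.continuousAt hp).congr (Filter.Eventually.of_forall he), ?_⟩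
  have h : ∀ q, extChartAt (model m) (triv p p) (triv p q) = extChartAt (model m) p q := fun q ↦ rfl
  refine (hasFDerivWithinAt_id _ _).congr_of_eventuallyEq ?_ ?_
  · filter_upwards [extChartAt_target_mem_nhdsWithin (I := model m) p] with y hy
    exact (h _).trans ((extChartAt (model m) p).right_inv hy)
  · exact (h _).trans ((extChartAt (model m) p).right_inv (mem_extChartAt_target p))

lemma dproj_apply (p : CircleBundle C) (w : CRModel m × EuclideanSpace ℝ (Fin 1)) :
    dproj p w = w.1 := by
  have h := (hasMFDerivAt_fst (I := 𝓘(ℝ, CRModel m)) (I' := 𝓡 1) (triv p p)).comp p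
    (hasMFDerivAt_triv p)
  exact congr($(h.mfderiv) w)

lemma contMDiff_circle_coe : ContMDiff (𝓡 1) 𝓘(ℝ, ℂ) ∞ (fun z : Circle ↦ (z : ℂ)) :=
  have : Fact (Module.finrank ℝ ℂ = 1 + 1) := ⟨by simp [Complex.finrank_real_complex]⟩
  contMDiff_coe_sphere (E := ℂ) (n := 1)

lemma hasMFDerivAt_fibreCoord (p : CircleBundle C) :
    HasMFDerivAt (model m) 𝓘(ℝ, ℂ) (fibreCoord p) p
      ((mfderiv (𝓡 1) 𝓘(ℝ, ℂ) (fun z : Circle ↦ (z : ℂ)) (triv p p).2).comp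
        (ContinuousLinearMap.snd ℝ (CRModel m) (EuclideanSpace ℝ (Fin 1)))) := by
  have h1 := (hasMFDerivAt_snd (I := 𝓘(ℝ, CRModel m)) (I' := 𝓡 1) (triv p p)).comp p
    (hasMFDerivAt_triv p)
  exact ((contMDiff_circle_coe _).mdifferentiableAt (by simp)).hasMFDerivAt.comp p h1

lemma dfibreCoord_apply (p : CircleBundle C) (w : CRModel m × EuclideanSpace ℝ (Fin 1)) :
    dfibreCoord p w = mvfderiv (𝓡 1) (fun z : Circle ↦ (z : ℂ)) (triv p p).2 w.2 :=
  congr($((hasMFDerivAt_fibreCoord p).mfderiv) w)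

lemma dfibreCoord_injective (p : CircleBundle C) (w : FTan p) (h1 : dproj p w = 0)
    (h2 : dfibreCoord p w = 0) : w = 0 := by
  have h3 : Function.Injective (mvfderiv (𝓡 1) (fun z : Circle ↦ (z : ℂ)) (triv p p).2) :=
    have : Fact (Module.finrank ℝ ℂ = 1 + 1) := ⟨by simp [Complex.finrank_real_complex]⟩
    injective_mvfderiv_subtypeVal_sphere (E := ℂ) (n := 1) (triv p p).2
  refine Prod.ext (dproj_apply p w ▸ h1) (h3 ?_)
  exact ((dfibreCoord_apply p w).symm.trans h2).trans (map_zero _).symm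

/-- Since `|u| = 1`, the one-form `du / u` is imaginary. -/
lemma dfibreCoord_re (p : CircleBundle C) (w : FTan p) :
    (dfibreCoord p w / fibreCoord p p).re = 0 := by
  have h1 := (hasStrictFDerivAt_norm_sq (fibreCoord p p)).hasFDerivAt.hasMFDerivAt.comp p
    ((hasMFDerivAt_fibreCoord p).mdifferentiableAt.hasMFDerivAt)
  have h2 : (fun x : ℂ ↦ ‖x‖ ^ 2) ∘ fibreCoord p = fun _ ↦ (1 : ℝ) := by
    ext q
    simp only [Function.comp_apply, fibreCoord, Circle.norm_coe, one_pow]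
  rw [h2] at h1
  have h3 := hasMFDerivAt_unique h1 (hasMFDerivAt_const (1 : ℝ) p)
  have h4 : 2 * inner ℝ (fibreCoord p p) (dfibreCoord p w) = 0 := by
    have h5 : (2 • innerSL ℝ (fibreCoord p p)) (dfibreCoord p w) = 0 := congr($h3 w)
    rw [← h5]
    simp [two_mul]
    ring
  rw [Complex.inner] at h4
  rw [Complex.div_re]
  simp only [Complex.mul_re, Complex.conj_re, Complex.conj_im] at h4
  rw [← add_div]
  rw [div_eq_zero_iff]
  left
  linarith


end CircleBundle

/-- Smooth one-forms on `M` with values in `iℝ`. -/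
structure ImaginaryForm (m : ℕ) (M : Type*) [TopologicalSpace M] [ChartedSpace (CRModel m) M]
    [IsManifold 𝓘(ℝ, CRModel m) ∞ M] where
  form : ∀ x : M, Tan m x →L[ℝ] ℂ
  smooth : SmoothForm form
  re_eq_zero : ∀ x v, (form x v).re = 0

namespace PseudoHermitian

open CircleBundle

variable {C : CRStructure m M} (θ : PseudoHermitian C) (ℓ : ImaginaryForm m M)

/-- The connection form `ω` of `∇^W` on `Λ^{m+1,0}` in the local section `σ = η^0 ∧ … ∧ η^m` of the
chosen frame at `x`: `∇_v σ = ω(v) σ`. As `σ(N, e_1, …, e_m) = 1`, it is given by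
`ω(v) = - ∑_i σ(N, …, ∇_v e_i, …, e_m)`. -/
def canonicalConnection (x : M) : Tan m x →ₗ[ℝ] ℂ :=
  -(∑ i, ((C.frameAt x).detForm x).toMultilinearMap.toLinearMap ((C.frameAt x).cvec x) i ∘ₗ
      (θ.tanakaWebster (fun y ↦ (C.frameAt x).cvec y i) x).toLinearMap)

/-- The connection form `A^W` on `F_c` induced by `∇^W`. At the point `p = [u σ]`, `u ∈ S¹`, it is
the imaginary part of `du / u + π^* ω` (the real part of `ω` accounts for the length of `σ`). -/
def websterForm (p : CircleBundle C) : FTan p →ₗ[ℝ] ℂ :=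
  (Complex.I • Complex.ofRealCLM.toLinearMap) ∘ₗ Complex.imCLM.toLinearMap ∘ₗ
    ((fibreCoord p p)⁻¹ • (dfibreCoord p).toLinearMap
      + θ.canonicalConnection p.proj ∘ₗ (dproj p).toLinearMap)

/-- The Weyl connection `A_θ = A^W - i / (2(m + 1)) scal^W π^*θ`. -/
def weylForm (p : CircleBundle C) : FTan p →ₗ[ℝ] ℂ :=
  θ.websterForm p - (Complex.I / (2 * (m + 1)) * θ.scal p.proj) •
    (Complex.ofRealCLM.toLinearMap ∘ₗ (θ.form p.proj).toLinearMap ∘ₗ (dproj p).toLinearMap)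

/-- The connection form `A_{θ,ℓ} = A_θ + π^*ℓ`. -/
def connForm (p : CircleBundle C) : FTan p →ₗ[ℝ] ℂ :=
  θ.weylForm p + (ℓ.form p.proj).toLinearMap ∘ₗ (dproj p).toLinearMap

lemma connForm_apply (p : CircleBundle C) (w : FTan p) : θ.connForm ℓ p w =
    Complex.I * (((fibreCoord p p)⁻¹ * dfibreCoord p w
      + θ.canonicalConnection p.proj (dproj p w)).im : ℝ)
    - (Complex.I / (2 * (m + 1)) * θ.scal p.proj) * (θ.form p.proj (dproj p w) : ℝ)
    + ℓ.form p.proj (dproj p w) := by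
  simp [connForm, weylForm, websterForm]

lemma connForm_re (p : CircleBundle C) (w : FTan p) : (θ.connForm ℓ p w).re = 0 := by
  have h : (Complex.I / (2 * (m + 1)) * θ.scal p.proj) * (θ.form p.proj (dproj p w) : ℝ) =
      ((θ.scal p.proj * θ.form p.proj (dproj p w) / (2 * (m + 1)) : ℝ) : ℂ) * Complex.I := by
    push_cast; ring
  have h1 : ∀ r : ℝ, ((r : ℂ) * Complex.I).re = 0 := fun r ↦ by simp
  rw [connForm_apply, h, Complex.add_re, Complex.sub_re, h1, ℓ.re_eq_zero, mul_comm Complex.I, h1]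
  simp

lemma connForm_eq (p : CircleBundle C) (w : FTan p) :
    θ.connForm ℓ p w = (θ.connForm ℓ p w).im * Complex.I := by
  apply Complex.ext <;> simp [θ.connForm_re ℓ p w]

/-- The isomorphism `(dπ, Im A_{θ,ℓ}) : T_p F_c → T_{π(p)} M × ℝ`. -/
def split (p : CircleBundle C) : FTan p ≃ₗ[ℝ] Tan m p.proj × ℝ :=
  LinearMap.linearEquivOfInjective
    (LinearMap.prod (dproj p).toLinearMap (Complex.imCLM.toLinearMap ∘ₗ θ.connForm ℓ p))
    (by
      rw [injective_iff_map_eq_zero]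
      intro w hw
      have h1 : dproj p w = 0 := congrArg Prod.fst hw
      have h2 : (θ.connForm ℓ p w).im = 0 := congrArg Prod.snd hw
      refine dfibreCoord_injective p w h1 ?_
      rw [connForm_apply, h1] at h2
      have h3 : ((fibreCoord p p)⁻¹ * dfibreCoord p w).im = 0 := by simpa using h2
      have h4 : ((fibreCoord p p)⁻¹ * dfibreCoord p w).re = 0 := by
        have := dfibreCoord_re p w
        rwa [div_eq_inv_mul] at this
      have h5 : (fibreCoord p p)⁻¹ * dfibreCoord p w = 0 := Complex.ext h4 h3
      rcases mul_eq_zero.1 h5 with h | h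
      · exact absurd h (inv_ne_zero (Circle.coe_ne_zero _))
      · exact h)
    (by
      rw [finrank_FTan, Module.finrank_prod]
      change _ = Module.finrank ℝ (CRModel m) + _
      simp)

lemma split_apply (p : CircleBundle C) (w : FTan p) :
    θ.split ℓ p w = (dproj p w, (θ.connForm ℓ p w).im) := rfl

/-- The horizontal lift with respect to `A_{θ,ℓ}`. -/
def hlift (p : CircleBundle C) : Tan m p.proj →ₗ[ℝ] FTan p :=
  (θ.split ℓ p).symm.toLinearMap ∘ₗ LinearMap.inl ℝ _ ℝ

lemma dproj_hlift (p : CircleBundle C) (v : Tan m p.proj) : dproj p (θ.hlift ℓ p v) = v :=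
  congrArg Prod.fst ((θ.split ℓ p).apply_symm_apply (v, 0))

lemma connForm_hlift (p : CircleBundle C) (v : Tan m p.proj) :
    θ.connForm ℓ p (θ.hlift ℓ p v) = 0 := by
  have h : (θ.connForm ℓ p (θ.hlift ℓ p v)).im = 0 :=
    congrArg Prod.snd ((θ.split ℓ p).apply_symm_apply (v, 0))
  rw [connForm_eq, h]; simp

/-- The vertical vector field `S` with `A_{θ,ℓ}(S) = i (m + 2) / 2`. -/
def vert (p : CircleBundle C) : FTan p := (θ.split ℓ p).symm (0, (m + 2) / 2)

lemma dproj_vert (p : CircleBundle C) : dproj p (θ.vert ℓ p) = 0 :=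
  congrArg Prod.fst ((θ.split ℓ p).apply_symm_apply (0, ((m : ℝ) + 2) / 2))

lemma connForm_vert (p : CircleBundle C) :
    θ.connForm ℓ p (θ.vert ℓ p) = Complex.I * (m + 2) / 2 := by
  have h : (θ.connForm ℓ p (θ.vert ℓ p)).im = ((m : ℝ) + 2) / 2 :=
    congrArg Prod.snd ((θ.split ℓ p).apply_symm_apply (0, ((m : ℝ) + 2) / 2))
  rw [connForm_eq, h]; push_cast; ring

/-- The bilinear form `f_{θ,ℓ} = π^* L_θ - i 4 / (m + 2) π^*θ ∘ A_{θ,ℓ}` at `p` (which is real),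
where `α ∘ β = (α ⊗ β + β ⊗ α) / 2`. -/
def feffermanForm (p : CircleBundle C) : FTan p →ₗ[ℝ] FTan p →ₗ[ℝ] ℝ :=
  LinearMap.mk₂ ℝ (fun v w ↦
      ((θ.levi p.proj (dproj p v) (dproj p w) : ℂ) - Complex.I * (4 / (m + 2)) *
        ((θ.form p.proj (dproj p v) * θ.connForm ℓ p w
          + θ.form p.proj (dproj p w) * θ.connForm ℓ p v) / 2)).re)
    (by intros; rw [← Complex.add_re]; congr 1; simp; ring)
    (by intros; rw [← Complex.smul_re]; congr 1; simp; ring)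
    (by intros; rw [← Complex.add_re]; congr 1; simp; ring)
    (by intros; rw [← Complex.smul_re]; congr 1; simp; ring)

lemma feffermanForm_apply (p : CircleBundle C) (v w : FTan p) : θ.feffermanForm ℓ p v w =
    θ.levi p.proj (dproj p v) (dproj p w) + 2 / (m + 2) *
      (θ.form p.proj (dproj p v) * (θ.connForm ℓ p w).im
        + θ.form p.proj (dproj p w) * (θ.connForm ℓ p v).im) := by
  have h : ∀ l t t' a b : ℝ, ((l : ℂ) - Complex.I * (4 / (m + 2)) *
      ((t * (b * Complex.I) + t' * (a * Complex.I)) / 2)).re = l + 2 / (m + 2) * (t * b + t' * a) := by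
    intro l t t' a b
    rw [← Complex.ofReal_re (l + 2 / (m + 2) * (t * b + t' * a))]
    congr 1
    push_cast
    linear_combination (- (2 / ((m : ℂ) + 2)) * (t * b + t' * a)) * Complex.I_mul_I
  rw [feffermanForm, LinearMap.mk₂_apply, ← h, ← connForm_eq, ← connForm_eq]

/-- The horizontal lift `J_{θ,ℓ}` of `J`, which is zero on the vertical vectors and on the horizontal
lift of `T`. -/
def liftJ (p : CircleBundle C) : FTan p →ₗ[ℝ] FTan p :=
  θ.hlift ℓ p ∘ₗ θ.extJ p.proj ∘ₗ (dproj p).toLinearMap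

lemma liftJ_skew (p : CircleBundle C) (v w : FTan p) :
    θ.feffermanForm ℓ p (θ.liftJ ℓ p v) w + θ.feffermanForm ℓ p v (θ.liftJ ℓ p w) = 0 := by
  have h : ∀ u, dproj p (θ.liftJ ℓ p u) = θ.extJ p.proj (dproj p u) := fun u ↦ dproj_hlift ..
  have h' : ∀ u, θ.connForm ℓ p (θ.liftJ ℓ p u) = 0 := fun u ↦ connForm_hlift ..
  have h0 : ∀ x (u : Tan m x), θ.form x (θ.extJ x u) = 0 := fun x u ↦ θ.vanish x _
  have h1 : ∀ x (u z : Tan m x), θ.levi x (θ.extJ x u) z + θ.levi x u (θ.extJ x z) = 0 := by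
    intro x u z
    have h2 := θ.levi_J x (θ.projH x u) (θ.projH x z)
    rw [levi_projH, levi_symm, levi_projH, levi_symm] at h2
    exact (add_eq_zero_iff_eq_neg).2 h2
  rw [feffermanForm_apply, feffermanForm_apply, h, h, h', h', h0, h0]
  simp only [Complex.zero_im, zero_mul, mul_zero, add_zero, h1]

end PseudoHermitian

/-! ## Conformal standard tractors -/

section Tractors

variable {E : Type*} [NormedAddCommGroup E] [NormedSpace ℝ E] [FiniteDimensional ℝ E]
  {H : Type*} [TopologicalSpace H] (I : ModelWithCorners ℝ E H)
  (F : Type*) [TopologicalSpace F] [ChartedSpace H F]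

/-- A field of non-degenerate symmetric bilinear forms on the tangent spaces. -/
structure MetricField where
  val : ∀ p : F, TangentSpace I p →ₗ[ℝ] TangentSpace I p →ₗ[ℝ] ℝ
  symm : ∀ p v w, val p v w = val p w v
  nondegenerate : ∀ p v, (∀ w, val p v w = 0) → v = 0

variable {I F}

instance (p : F) : FiniteDimensional ℝ (TangentSpace I p) :=
  inferInstanceAs (FiniteDimensional ℝ E)

/-- The isomorphism `v ↦ g(v, ·)`. -/
def MetricField.flat (g : MetricField I F) (p : F) :
    TangentSpace I p ≃ₗ[ℝ] Module.Dual ℝ (TangentSpace I p) :=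
  LinearMap.linearEquivOfInjective (g.val p)
    ((injective_iff_map_eq_zero _).2 fun v hv ↦ g.nondegenerate p v fun w ↦ by rw [hv]; rfl)
    (Subspace.dual_finrank_eq (K := ℝ) (V := TangentSpace I p)).symm

/-- The dual vector `η^♯` of a one-form. -/
def MetricField.sharp (g : MetricField I F) (p : F) :
    Module.Dual ℝ (TangentSpace I p) →ₗ[ℝ] TangentSpace I p := (g.flat p).symm.toLinearMap

lemma MetricField.val_sharp (g : MetricField I F) (p : F) (η v) : g.val p (g.sharp p η) v = η v :=
  congr($((g.flat p).apply_symm_apply η) v)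

lemma MetricField.sharp_eq (g : MetricField I F) (p : F) (η) (v : TangentSpace I p)
    (h : ∀ w, g.val p v w = η w) : g.sharp p η = v := by
  refine (LinearEquiv.symm_apply_eq (g.flat p)).2 ?_
  ext w
  exact (h w).symm

/-- `g' = e^{2φ} g` with a smooth function `φ`. -/
def ConformallyRelated (g g' : MetricField I F) (φ : F → ℝ) : Prop :=
  ContMDiff I 𝓘(ℝ) ∞ φ ∧ ∀ p v w, g'.val p v w = Real.exp (2 * φ p) * g.val p v w

/-- The conformal class `[g]` of a metric. -/
def conformalClass (g : MetricField I F) : Set (MetricField I F) :=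
  {g' | ∃ φ, ConformallyRelated g g' φ}

lemma self_mem_conformalClass (g : MetricField I F) : g ∈ conformalClass g :=
  ⟨fun _ ↦ 0, contMDiff_const, fun p v w ↦ by simp⟩

/-- The change of a standard tractor at `p` from its components `(a, ξ, b)` with respect to `g` to
those with respect to `e^{2φ} g`: with `Υ = dφ`,
`(e^{-φ} (a - Υ(ξ) - Υ(Υ^♯) b / 2), e^{-φ} (ξ + b Υ^♯), e^φ b)`. -/
def tractorChange (g : MetricField I F) (φ : F → ℝ) (p : F) :
    (ℝ × TangentSpace I p × ℝ) →ₗ[ℝ] (ℝ × TangentSpace I p × ℝ) :=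
  let Υ : Module.Dual ℝ (TangentSpace I p) := (mvfderiv I φ p).toLinearMap
  let a := LinearMap.fst ℝ ℝ (TangentSpace I p × ℝ)
  let ξ := LinearMap.fst ℝ (TangentSpace I p) ℝ ∘ₗ LinearMap.snd ℝ ℝ (TangentSpace I p × ℝ)
  let b := LinearMap.snd ℝ (TangentSpace I p) ℝ ∘ₗ LinearMap.snd ℝ ℝ (TangentSpace I p × ℝ)
  LinearMap.prod (Real.exp (- φ p) • (a - Υ ∘ₗ ξ - (Υ (g.sharp p Υ) / 2) • b))
    (LinearMap.prod (Real.exp (- φ p) • (ξ + b.smulRight (g.sharp p Υ))) (Real.exp (φ p) • b))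

lemma tractorChange_apply (g : MetricField I F) (φ : F → ℝ) (p : F) (a : ℝ) (ξ : TangentSpace I p)
    (b : ℝ) : tractorChange g φ p (a, ξ, b) =
      (Real.exp (- φ p) * (a - mvfderiv I φ p ξ -
          mvfderiv I φ p (g.sharp p (mvfderiv I φ p).toLinearMap) / 2 * b),
        Real.exp (- φ p) • (ξ + b • g.sharp p (mvfderiv I φ p).toLinearMap),
        Real.exp (φ p) * b) := rfl

/-- The fibre at `p` of the standard tractor bundle `𝒯` of the conformal class `c`: a standard
tractor has components `(a, ξ, b)` with respect to every metric in `c`, which are related by the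
above transformation law. -/
def TractorSpace (c : Set (MetricField I F)) (p : F) :
    Submodule ℝ (c → ℝ × TangentSpace I p × ℝ) where
  carrier := {t | ∀ (g g' : c) (φ : F → ℝ), ConformallyRelated g.1 g'.1 φ →
    t g' = tractorChange g.1 φ p (t g)}
  add_mem' ht hs g g' φ h := by simp [ht g g' φ h, hs g g' φ h]
  zero_mem' g g' φ _ := by simp
  smul_mem' r t ht g g' φ h := by simp [ht g g' φ h]

/-- The components of a standard tractor with respect to a metric in the conformal class. -/
def components {c : Set (MetricField I F)} {g : MetricField I F} (hg : g ∈ c) (p : F) :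
    TractorSpace c p →ₗ[ℝ] ℝ × TangentSpace I p × ℝ :=
  LinearMap.proj (⟨g, hg⟩ : c) ∘ₗ (TractorSpace c p).subtype

/-- The bilinear form `⟨(a, ξ, b), (a', ξ', b')⟩ = a b' + b a' + g(ξ, ξ')`. -/
def tractorForm (g : MetricField I F) (p : F) (t s : ℝ × TangentSpace I p × ℝ) : ℝ :=
  t.1 * s.2.2 + t.2.2 * s.1 + g.val p t.2.1 s.2.1

/-- The fibre at `p` of the adjoint tractor bundle `𝒜 = 𝔰𝔬(𝒯)`: the endomorphisms of the standard
tractors that are skew with respect to the tractor metric (in the splitting of any metric in the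
conformal class, since the tractor metric does not depend on it). -/
def AdjointTractor (c : Set (MetricField I F)) (p : F) : Type _ :=
  {A : Module.End ℝ (TractorSpace c p) // ∀ (g : MetricField I F) (hg : g ∈ c) (t s),
    tractorForm g p (components hg p (A t)) (components hg p s)
      + tractorForm g p (components hg p t) (components hg p (A s)) = 0}

/-- The matrix `(a, ξ, b) ↦ (η(ξ), a τ + A ξ - b η^♯, - g(τ, ξ))` of the triple `(τ, A, η)`. -/
def slotMatrix (g : MetricField I F) (p : F) (τ : TangentSpace I p)
    (A : Module.End ℝ (TangentSpace I p)) (η : Module.Dual ℝ (TangentSpace I p)) :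
    (ℝ × TangentSpace I p × ℝ) →ₗ[ℝ] (ℝ × TangentSpace I p × ℝ) :=
  let a := LinearMap.fst ℝ ℝ (TangentSpace I p × ℝ)
  let ξ := LinearMap.fst ℝ (TangentSpace I p) ℝ ∘ₗ LinearMap.snd ℝ ℝ (TangentSpace I p × ℝ)
  let b := LinearMap.snd ℝ (TangentSpace I p) ℝ ∘ₗ LinearMap.snd ℝ ℝ (TangentSpace I p × ℝ)
  LinearMap.prod (η ∘ₗ ξ)
    (LinearMap.prod (a.smulRight τ + A ∘ₗ ξ - b.smulRight (g.sharp p η)) (- (g.val p τ ∘ₗ ξ)))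

/-! ### The splitting of the tractor bundle by a metric in the conformal class -/

lemma ConformallyRelated.sharp {g g' : MetricField I F} {φ : F → ℝ}
    (h : ConformallyRelated g g' φ) (p : F) (η) :
    g'.sharp p η = Real.exp (- (2 * φ p)) • g.sharp p η := by
  refine g'.sharp_eq p η _ fun w ↦ ?_
  rw [h.2, map_smul, LinearMap.smul_apply, g.val_sharp, smul_eq_mul, ← mul_assoc, ← Real.exp_add]
  simp

lemma ConformallyRelated.mdiff {g g' : MetricField I F} {φ : F → ℝ}
    (h : ConformallyRelated g g' φ) (p : F) : MDifferentiableAt I 𝓘(ℝ) φ p :=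
  (h.1 p).mdifferentiableAt (by simp)

lemma tractorChange_trans {g g' g'' : MetricField I F} {φ ψ : F → ℝ}
    (h : ConformallyRelated g g' φ) (h' : ConformallyRelated g' g'' ψ) (p : F) (x) :
    tractorChange g' ψ p (tractorChange g φ p x) = tractorChange g (φ + ψ) p x := by
  obtain ⟨a, ξ, b⟩ := x
  have hd : mvfderiv I (φ + ψ) p = mvfderiv I φ p + mvfderiv I ψ p :=
    mvfderiv_add (h.mdiff p) (h'.mdiff p)
  have hs : mvfderiv I φ p (g.sharp p (mvfderiv I ψ p).toLinearMap) =
      mvfderiv I ψ p (g.sharp p (mvfderiv I φ p).toLinearMap) := by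
    have h1 := g.val_sharp p (mvfderiv I φ p).toLinearMap (g.sharp p (mvfderiv I ψ p).toLinearMap)
    have h2 := g.val_sharp p (mvfderiv I ψ p).toLinearMap (g.sharp p (mvfderiv I φ p).toLinearMap)
    rw [g.symm] at h1
    exact h1.symm.trans h2
  have hl : ((mvfderiv I φ p + mvfderiv I ψ p : TangentSpace I p →L[ℝ] ℝ)).toLinearMap =
      (mvfderiv I φ p).toLinearMap + (mvfderiv I ψ p).toLinearMap := rfl
  have e0 : Real.exp (φ p) ≠ 0 := (Real.exp_pos _).ne'
  have e1 : Real.exp (ψ p) ≠ 0 := (Real.exp_pos _).ne'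
  have e2 : Real.exp (-(2 * φ p)) = (Real.exp (φ p))⁻¹ * (Real.exp (φ p))⁻¹ := by
    rw [← Real.exp_neg, ← Real.exp_add]; ring_nf
  simp only [tractorChange_apply, hd, hl, h.sharp, map_add, map_smul, Pi.add_apply, neg_add,
    Real.exp_add, e2, Real.exp_neg, add_apply, smul_eq_mul, hs]
  refine Prod.ext ?_ (Prod.ext ?_ ?_)
  · field_simp
    ring
  · simp only [smul_add, smul_smul]
    match_scalars <;> field_simp
  · ring


lemma ConformallyRelated.trans {g g' g'' : MetricField I F} {φ ψ : F → ℝ}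
    (h : ConformallyRelated g g' φ) (h' : ConformallyRelated g' g'' ψ) :
    ConformallyRelated g g'' (φ + ψ) :=
  ⟨h.1.add h'.1, fun p v w ↦ by
    rw [h'.2, h.2, ← mul_assoc, ← Real.exp_add, Pi.add_apply]; ring_nf⟩

lemma ConformallyRelated.symm {g g' : MetricField I F} {φ : F → ℝ}
    (h : ConformallyRelated g g' φ) : ConformallyRelated g' g (-φ) :=
  ⟨h.1.neg, fun p v w ↦ by
    rw [h.2, ← mul_assoc, ← Real.exp_add, Pi.neg_apply]; ring_nf; simp⟩

lemma ConformallyRelated.unique [Nontrivial E] {g g' : MetricField I F} {φ ψ : F → ℝ}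
    (h : ConformallyRelated g g' φ) (h' : ConformallyRelated g g' ψ) : φ = ψ := by
  ext p
  have hnt : Nontrivial (TangentSpace I p) := inferInstanceAs (Nontrivial E)
  obtain ⟨v, hv⟩ := exists_ne (0 : TangentSpace I p)
  obtain ⟨w, hw⟩ : ∃ w, g.val p v w ≠ 0 := by
    by_contra! hc
    exact hv (g.nondegenerate p v hc)
  have h1 := (h.2 p v w).symm.trans (h'.2 p v w)
  have h2 := Real.exp_injective (mul_right_cancel₀ hw h1)
  linarith

lemma exists_related {g₀ g g' : MetricField I F} (hg : g ∈ conformalClass g₀)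
    (hg' : g' ∈ conformalClass g₀) : ∃ φ, ConformallyRelated g g' φ := by
  obtain ⟨φ, h⟩ := hg
  obtain ⟨ψ, h'⟩ := hg'
  exact ⟨_, h.symm.trans h'⟩

lemma components_bijective [Nontrivial E] {g₀ g : MetricField I F} (hg : g ∈ conformalClass g₀)
    (p : F) : Function.Bijective (components hg p) := by
  constructor
  · intro t s hts
    ext1
    funext ⟨g', hg'⟩
    obtain ⟨φ, h⟩ := exists_related hg hg'
    rw [t.2 ⟨g, hg⟩ ⟨g', hg'⟩ φ h, s.2 ⟨g, hg⟩ ⟨g', hg'⟩ φ h]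
    exact congrArg _ hts
  · intro x
    choose φ hφ using fun g' : conformalClass g₀ ↦ exists_related hg g'.2
    refine ⟨⟨fun g' ↦ tractorChange g (φ g') p x, fun g' g'' ψ h ↦ ?_⟩, ?_⟩
    · change tractorChange g (φ g'') p x = tractorChange g'.1 ψ p (tractorChange g (φ g') p x)
      rw [tractorChange_trans (hφ g') h, (hφ g'').unique ((hφ g').trans h)]
    · have h0 : φ ⟨g, hg⟩ = fun _ ↦ 0 :=
        (hφ ⟨g, hg⟩).unique ⟨contMDiff_const, fun p v w ↦ by simp⟩
      change tractorChange g (φ ⟨g, hg⟩) p x = x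
      obtain ⟨a, ξ, b⟩ := x
      rw [h0, tractorChange_apply, mvfderiv_const]
      simp

/-- The isomorphism `𝒯_p ≅ ℝ ⊕ T_p F ⊕ ℝ` given by a metric in the conformal class. -/
def splitting [Nontrivial E] {g₀ g : MetricField I F} (hg : g ∈ conformalClass g₀) (p : F) :
    TractorSpace (conformalClass g₀) p ≃ₗ[ℝ] ℝ × TangentSpace I p × ℝ :=
  LinearEquiv.ofBijective (components hg p) (components_bijective hg p)

lemma tractorForm_change {g g' : MetricField I F} {φ : F → ℝ}
    (h : ConformallyRelated g g' φ) (p : F) (t s : ℝ × TangentSpace I p × ℝ) :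
    tractorForm g' p (tractorChange g φ p t) (tractorChange g φ p s) = tractorForm g p t s := by
  obtain ⟨a, ξ, b⟩ := t
  obtain ⟨a', ξ', b'⟩ := s
  have h1 := g.val_sharp p (mvfderiv I φ p).toLinearMap
  have h2 : ∀ v, g.val p v (g.sharp p (mvfderiv I φ p).toLinearMap) = mvfderiv I φ p v := fun v ↦ by
    rw [g.symm]; exact h1 v
  have h3 : ∀ v, g.val p (g.sharp p (mvfderiv I φ p).toLinearMap) v = mvfderiv I φ p v := h1
  have e0 : Real.exp (φ p) ≠ 0 := (Real.exp_pos _).ne'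
  have e2 : Real.exp (2 * φ p) = Real.exp (φ p) * Real.exp (φ p) := by
    rw [← Real.exp_add]; ring_nf
  simp only [tractorForm, tractorChange_apply, h.2, e2, Real.exp_neg, map_add, map_smul,
    LinearMap.add_apply, LinearMap.smul_apply, smul_eq_mul, h2, h3]
  field_simp
  ring

lemma slotMatrix_skew (g : MetricField I F) (p : F) (τ : TangentSpace I p)
    (A : Module.End ℝ (TangentSpace I p)) (hA : ∀ v w, g.val p (A v) w + g.val p v (A w) = 0)
    (η : Module.Dual ℝ (TangentSpace I p)) (t s : ℝ × TangentSpace I p × ℝ) :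
    tractorForm g p (slotMatrix g p τ A η t) s + tractorForm g p t (slotMatrix g p τ A η s) = 0 := by
  obtain ⟨a, ξ, b⟩ := t
  obtain ⟨a', ξ', b'⟩ := s
  have h1 := g.val_sharp p η
  have h2 : ∀ v, g.val p v (g.sharp p η) = η v := fun v ↦ by rw [g.symm]; exact h1 v
  have h3 : ∀ v, g.val p v τ = g.val p τ v := fun v ↦ g.symm p v τ
  simp only [tractorForm, slotMatrix, LinearMap.prod_apply, LinearMap.comp_apply,
    LinearMap.sub_apply, LinearMap.add_apply, LinearMap.smulRight_apply, LinearMap.neg_apply,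
    LinearMap.fst_apply, LinearMap.snd_apply, Function.prod_apply, map_add, map_sub, map_smul,
    LinearMap.smul_apply, smul_eq_mul, h1, h2, h3]
  linear_combination hA ξ ξ'

/-- The adjoint tractor at `p` with components `(τ, A, η)` in the graded sum
`𝒜_p ≅ T_p F ⊕ 𝔠𝔬(T_p F) ⊕ T_p^* F` (with `A ∈ 𝔰𝔬(T_p F)`) given by a metric `g` in the conformal
class: it acts in the splitting of `𝒯_p` by `g` as the matrix of the triple. -/
def AdjointTractor.mk [Nontrivial E] {g₀ g : MetricField I F} (hg : g ∈ conformalClass g₀) (p : F)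
    (τ : TangentSpace I p) (A : Module.End ℝ (TangentSpace I p))
    (hA : ∀ v w, g.val p (A v) w + g.val p v (A w) = 0)
    (η : Module.Dual ℝ (TangentSpace I p)) : AdjointTractor (conformalClass g₀) p :=
  ⟨(splitting hg p).symm.conj (slotMatrix g p τ A η), by
    intro g' hg' t s
    obtain ⟨φ, h⟩ := exists_related hg hg'
    have h1 : ∀ t : TractorSpace (conformalClass g₀) p,
        components hg' p t = tractorChange g φ p (components hg p t) :=
      fun t ↦ t.2 ⟨g, hg⟩ ⟨g', hg'⟩ φ h
    have h2 : ∀ t, components hg p ((splitting hg p).symm.conj (slotMatrix g p τ A η) t) =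
        slotMatrix g p τ A η (components hg p t) := by
      intro t
      exact (splitting hg p).apply_symm_apply _
    rw [h1, h1, h1, h1, tractorForm_change h, tractorForm_change h, h2, h2]
    exact slotMatrix_skew g p τ A hA η _ _⟩

end Tractors

/-! ## The `ℓ`-Fefferman space and `J_CR` -/

namespace PseudoHermitian

open CircleBundle

variable {C : CRStructure m M} (θ : PseudoHermitian C) (ℓ : ImaginaryForm m M)

/-- The `ℓ`-Fefferman metric `f_{θ,ℓ}` on `F_c`. -/
def fefferman : MetricField (model m) (CircleBundle C) where
  val := θ.feffermanForm ℓ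
  symm p v w := by
    rw [feffermanForm_apply, feffermanForm_apply, θ.levi_symm]; ring
  nondegenerate p v h := by
    have hm : (2 : ℝ) / (m + 2) ≠ 0 := by positivity
    have h1 : θ.form p.proj (dproj p v) = 0 := by
      have := h (θ.vert ℓ p)
      rw [feffermanForm_apply, dproj_vert, connForm_vert] at this
      have hi : (Complex.I * (m + 2) / 2).im = ((m : ℝ) + 2) / 2 := by
        have : Complex.I * (m + 2) / 2 = ((((m : ℝ) + 2) / 2 : ℝ) : ℂ) * Complex.I := by
          push_cast; ring
        rw [this, Complex.im_ofReal_mul]; simp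
      rw [hi] at this
      simp only [map_zero, zero_mul, add_zero, zero_add] at this
      have h2 : ((m : ℝ) + 2) / 2 ≠ 0 := by positivity
      simpa [hm, h2] using this
    have h2 : (θ.connForm ℓ p v).im = 0 := by
      have := h (θ.hlift ℓ p (θ.reeb p.proj))
      have h3 : θ.levi p.proj (dproj p v) (θ.reeb p.proj) = 0 := by
        have h4 : θ.projH p.proj (θ.reeb p.proj) = 0 := by
          ext1
          rw [projH_apply, form_reeb, one_smul, sub_self]; rfl
        rw [levi_symm, ← levi_projH, h4]
        simp
      rw [feffermanForm_apply, dproj_hlift, connForm_hlift, form_reeb, h3] at this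
      simpa [hm] using this
    have h3 : dproj p v = 0 := by
      have := h v
      rw [feffermanForm_apply, h1] at this
      have h4 : θ.levi p.proj (dproj p v) (dproj p v) = 0 := by simpa using this
      by_contra hne
      have h5 := θ.levi_pos p.proj ⟨dproj p v, θ.mem_H.2 h1⟩ (fun h ↦ hne (congrArg Subtype.val h))
      exact h5.ne' h4
    refine (θ.split ℓ p).injective ?_
    rw [split_apply, h2, h3, map_zero]
    rfl

/-- The one-form `2i / (n + 3) A_{θ,ℓ}` (which is real), with `n = 2m + 1`. -/
def slotForm (p : CircleBundle C) : FTan p →ₗ[ℝ] ℝ :=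
  Complex.reCLM.toLinearMap ∘ₗ
    ((2 * Complex.I / (((2 * m + 1 : ℕ) : ℂ) + 3)) • θ.connForm ℓ p)

/-- The section `J_CR = (R, J_{θ,ℓ}, 2i / (n + 3) A_{θ,ℓ})`, `R = 2S`, of the adjoint tractor bundle of
the conformal class `c_ℓ = [g₀]`, defined in the graded sum given by the metric `f_{θ,ℓ} ∈ c_ℓ`. -/
def JCR {g₀ : MetricField (model m) (CircleBundle C)} (h : θ.fefferman ℓ ∈ conformalClass g₀)
    (p : CircleBundle C) : AdjointTractor (conformalClass g₀) p :=
  AdjointTractor.mk h p ((2 : ℝ) • θ.vert ℓ p) (θ.liftJ ℓ p) (θ.liftJ_skew ℓ p) (θ.slotForm ℓ p)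

end PseudoHermitian

end CRTractor

end

noncomputable section

set_option linter.unusedSectionVars false

namespace CRTractor

variable {m : ℕ} {M : Type*} [TopologicalSpace M] [ChartedSpace (CRModel m) M]
variable [IsManifold 𝓘(ℝ, CRModel m) ∞ M]

lemma SmoothVFAt.mdiff {X : ∀ x : M, Tan m x} {x : M} (hX : SmoothVFAt X x) :
    MDifferentiableAt 𝓘(ℝ, CRModel m) (𝓘(ℝ, CRModel m).prod 𝓘(ℝ, CRModel m)) (vfSection X) x :=
  ContMDiffAt.mdifferentiableAt hX (by simp)

lemma contMDiffAt_extChartAt_symm_self (x : M) :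
    ContMDiffAt 𝓘(ℝ, CRModel m) 𝓘(ℝ, CRModel m) ∞ (extChartAt 𝓘(ℝ, CRModel m) x).symm
      (extChartAt 𝓘(ℝ, CRModel m) x x) := by
  have := contMDiffWithinAt_extChartAt_symm_range (I := 𝓘(ℝ, CRModel m)) (n := ∞) x
    (mem_extChartAt_target x)
  rwa [modelWithCornersSelf_coe, Set.range_id, contMDiffWithinAt_univ] at this

lemma differentiableAt_formInChart {θ : ∀ x : M, Tan m x →L[ℝ] ℝ} (hθ : SmoothForm θ) (x : M) :
    DifferentiableAt ℝ (formInChart θ x) (extChartAt 𝓘(ℝ, CRModel m) x x) := by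
  have h1 := ((contMDiffAt_hom_bundle _).1 (hθ x)).2
  have h3 := h1.comp_of_eq (contMDiffAt_extChartAt_symm_self x) (extChartAt_to_inv x)
  have h4 := (h3.mdifferentiableAt (by simp)).differentiableAt
  refine h4.congr_of_eventuallyEq ?_
  filter_upwards [extChartAt_target_mem_nhds (I := 𝓘(ℝ, CRModel m)) x] with y hy
  have hs : (extChartAt 𝓘(ℝ, CRModel m) x).symm y ∈ (chartAt (CRModel m) x).source := by
    have := (extChartAt 𝓘(ℝ, CRModel m) x).map_target hy
    rwa [extChartAt_source] at this
  ext v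
  simp only [Function.comp_apply, formInChart, ContinuousLinearMap.inCoordinates,
    ContinuousLinearMap.comp_apply]
  rw [TangentBundle.symmL_trivializationAt hs, (extChartAt 𝓘(ℝ, CRModel m) x).right_inv hy]
  simp
  rfl

lemma mfderiv_extChartAt_symm_self (x : M) :
    mfderiv 𝓘(ℝ, CRModel m) 𝓘(ℝ, CRModel m) (extChartAt 𝓘(ℝ, CRModel m) x).symm
      (extChartAt 𝓘(ℝ, CRModel m) x x) = ContinuousLinearMap.id ℝ (CRModel m) := by
  refine HasMFDerivAt.mfderiv ⟨(contMDiffAt_extChartAt_symm_self x).continuousAt, ?_⟩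
  have h : ∀ y ∈ (extChartAt 𝓘(ℝ, CRModel m) x).target,
      writtenInExtChartAt 𝓘(ℝ, CRModel m) 𝓘(ℝ, CRModel m) (extChartAt 𝓘(ℝ, CRModel m) x x)
        (extChartAt 𝓘(ℝ, CRModel m) x).symm y = y := by
    intro y hy
    simp only [writtenInExtChartAt, extChartAt_to_inv, extChartAt_model_space_eq_id,
      PartialEquiv.refl_symm, PartialEquiv.refl_coe, Function.comp_apply, id]
    exact (extChartAt 𝓘(ℝ, CRModel m) x).right_inv hy
  refine (hasFDerivWithinAt_id _ _).congr_of_eventuallyEq ?_ (h _ (mem_extChartAt_target x))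
  exact mem_nhdsWithin_of_mem_nhds (Filter.mem_of_superset
    (extChartAt_target_mem_nhds (I := 𝓘(ℝ, CRModel m)) x) h)

/-- A vector field in the preferred chart at `x₀`. -/
def fieldInChart (X : ∀ x : M, Tan m x) (x₀ : M) (y : CRModel m) : CRModel m :=
  (mfderiv 𝓘(ℝ, CRModel m) 𝓘(ℝ, CRModel m) (extChartAt 𝓘(ℝ, CRModel m) x₀).symm y).inverse
    (X ((extChartAt 𝓘(ℝ, CRModel m) x₀).symm y))

lemma fieldInChart_eq (X : ∀ x : M, Tan m x) (x₀ : M) :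
    fieldInChart X x₀ = VectorField.mpullbackWithin 𝓘(ℝ, CRModel m) 𝓘(ℝ, CRModel m)
      (extChartAt 𝓘(ℝ, CRModel m) x₀).symm X (Set.range 𝓘(ℝ, CRModel m)) := by
  rw [modelWithCornersSelf_coe, Set.range_id, VectorField.mpullbackWithin_univ]
  rfl

lemma differentiableAt_fieldInChart {X : ∀ x : M, Tan m x} {x : M} (hX : SmoothVFAt X x) :
    DifferentiableAt ℝ (fieldInChart X x) (extChartAt 𝓘(ℝ, CRModel m) x x) := by
  have h := hX.mdiff
  rw [← mdifferentiableWithinAt_univ] at h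
  have h1 := h.differentiableWithinAt_mpullbackWithin_vectorField
  have h2 := fieldInChart_eq X x
  rw [modelWithCornersSelf_coe, Set.range_id] at h1 h2
  rw [Set.preimage_univ, Set.univ_inter] at h1
  refine differentiableWithinAt_univ.1 ?_
  rw [h2]
  exact h1

lemma formInChart_fieldInChart (θ : ∀ x : M, Tan m x →L[ℝ] ℝ) (X : ∀ x : M, Tan m x) (x : M)
    {y : CRModel m} (hy : y ∈ (extChartAt 𝓘(ℝ, CRModel m) x).target) :
    formInChart θ x y (fieldInChart X x y) =
      θ ((extChartAt 𝓘(ℝ, CRModel m) x).symm y) (X ((extChartAt 𝓘(ℝ, CRModel m) x).symm y)) := by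
  have h := isInvertible_mfderivWithin_extChartAt_symm (I := 𝓘(ℝ, CRModel m)) hy
  rw [modelWithCornersSelf_coe, Set.range_id, mfderivWithin_univ] at h
  have h3 := h.self_comp_inverse
  exact congrArg (θ ((extChartAt 𝓘(ℝ, CRModel m) x).symm y))
    (DFunLike.congr_fun h3 (X ((extChartAt 𝓘(ℝ, CRModel m) x).symm y)))

lemma inverse_id_apply (v : CRModel m) : (ContinuousLinearMap.id ℝ (CRModel m)).inverse v = v := by
  rw [ContinuousLinearMap.inverse_id]; rfl

lemma fieldInChart_self (X : ∀ x : M, Tan m x) (x : M) :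
    fieldInChart X x (extChartAt 𝓘(ℝ, CRModel m) x x) = X x := by
  have h := mfderiv_extChartAt_symm_self (m := m) x
  have h1 : fieldInChart X x (extChartAt 𝓘(ℝ, CRModel m) x x) =
      (ContinuousLinearMap.id ℝ (CRModel m)).inverse
        (X ((extChartAt 𝓘(ℝ, CRModel m) x).symm (extChartAt 𝓘(ℝ, CRModel m) x x))) :=
    congrArg (fun A : CRModel m →L[ℝ] CRModel m ↦ A.inverse
        (X ((extChartAt 𝓘(ℝ, CRModel m) x).symm (extChartAt 𝓘(ℝ, CRModel m) x x)))) h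
  rw [h1]
  refine (inverse_id_apply _).trans ?_
  rw [extChartAt_to_inv x]

lemma bracket_eq_fieldInChart (X Y : ∀ x : M, Tan m x) (x : M) :
    bracket X Y x = VectorField.lieBracket ℝ (fieldInChart X x) (fieldInChart Y x)
      (extChartAt 𝓘(ℝ, CRModel m) x x) := by
  have h := VectorField.mlieBracketWithin_apply (I := 𝓘(ℝ, CRModel m)) (V := X) (W := Y)
    (s := Set.univ) (x₀ := x)
  have h1 : mfderiv 𝓘(ℝ, CRModel m) 𝓘(ℝ, CRModel m) (extChartAt 𝓘(ℝ, CRModel m) x) x =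
      ContinuousLinearMap.id ℝ (CRModel m) := by
    have h2 := mfderivWithin_extChartAt_symm_comp_mfderiv_extChartAt' (I := 𝓘(ℝ, CRModel m))
      (mem_extChartAt_source (I := 𝓘(ℝ, CRModel m)) x)
    rw [modelWithCornersSelf_coe, Set.range_id, mfderivWithin_univ] at h2
    have h3 := mfderiv_extChartAt_symm_self (m := m) x
    ext1 v
    exact (congr($h3 (mfderiv 𝓘(ℝ, CRModel m) 𝓘(ℝ, CRModel m)
      (extChartAt 𝓘(ℝ, CRModel m) x) x v))).symm.trans congr($h2 v)
  rw [← fieldInChart_eq, ← fieldInChart_eq, modelWithCornersSelf_coe, Set.range_id,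
    Set.preimage_univ, Set.univ_inter, VectorField.lieBracketWithin_univ] at h
  refine h.trans ?_
  exact (congrArg (fun A : CRModel m →L[ℝ] CRModel m ↦ A.inverse _) h1).trans (inverse_id_apply _)

lemma mvfderiv_form_apply {θ : ∀ x : M, Tan m x →L[ℝ] ℝ} (hθ : SmoothForm θ)
    {X : ∀ x : M, Tan m x} {x : M} (hX : SmoothVFAt X x) (v : Tan m x) :
    mvfderiv 𝓘(ℝ, CRModel m) (fun y ↦ θ y (X y)) x v =
      fderiv ℝ (formInChart θ x) (extChartAt 𝓘(ℝ, CRModel m) x x) v (X x) +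
      θ x (fderiv ℝ (fieldInChart X x) (extChartAt 𝓘(ℝ, CRModel m) x x) v) := by
  have h0 : ContMDiffAt 𝓘(ℝ, CRModel m) 𝓘(ℝ) ∞ (fun y ↦ θ y (X y)) x := by
    have := (hθ x).clm_bundle_apply (hX : ContMDiffAt _ _ _ _ _)
    rw [contMDiffAt_section] at this
    exact this
  have h1 := (h0.mdifferentiableAt (by simp)).mvfderiv
  have h2 : writtenInExtChartAt 𝓘(ℝ, CRModel m) 𝓘(ℝ) x (fun y ↦ θ y (X y))
      =ᶠ[𝓝 (extChartAt 𝓘(ℝ, CRModel m) x x)]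
      fun y ↦ formInChart θ x y (fieldInChart X x y) := by
    filter_upwards [extChartAt_target_mem_nhds (I := 𝓘(ℝ, CRModel m)) x] with y hy
    rw [formInChart_fieldInChart θ X x hy]
    rfl
  rw [modelWithCornersSelf_coe, Set.range_id, fderivWithin_univ, h2.fderiv_eq] at h1
  have h3 := ((differentiableAt_formInChart hθ x).hasFDerivAt.clm_apply
    (differentiableAt_fieldInChart hX).hasFDerivAt).fderiv
  have h4 : formInChart θ x (extChartAt 𝓘(ℝ, CRModel m) x x) = θ x := by
    have h := mfderiv_extChartAt_symm_self (m := m) x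
    have h5 : formInChart θ x (extChartAt 𝓘(ℝ, CRModel m) x x) =
        (θ ((extChartAt 𝓘(ℝ, CRModel m) x).symm (extChartAt 𝓘(ℝ, CRModel m) x x))).comp
          (ContinuousLinearMap.id ℝ (CRModel m)) :=
      congrArg (fun A : CRModel m →L[ℝ] CRModel m ↦
        (θ ((extChartAt 𝓘(ℝ, CRModel m) x).symm (extChartAt 𝓘(ℝ, CRModel m) x x))).comp A) h
    refine h5.trans ?_
    rw [extChartAt_to_inv x]
    rfl
  rw [h3, fieldInChart_self, h4] at h1
  refine congr($h1 v).trans ?_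
  exact add_comm _ _

/-- The formula `dθ(X, Y) = X θ(Y) - Y θ(X) - θ([X, Y])`. -/
lemma extD_apply {θ : ∀ x : M, Tan m x →L[ℝ] ℝ} (hθ : SmoothForm θ)
    {X Y : ∀ x : M, Tan m x} {x : M} (hX : SmoothVFAt X x) (hY : SmoothVFAt Y x) :
    extD θ x (X x) (Y x) = mvfderiv 𝓘(ℝ, CRModel m) (fun y ↦ θ y (Y y)) x (X x) -
      mvfderiv 𝓘(ℝ, CRModel m) (fun y ↦ θ y (X y)) x (Y x) - θ x (bracket X Y x) := by
  rw [mvfderiv_form_apply hθ hX, mvfderiv_form_apply hθ hY, bracket_eq_fieldInChart]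
  have h : θ x (VectorField.lieBracket ℝ (E := CRModel m) (fieldInChart X x) (fieldInChart Y x)
      (extChartAt 𝓘(ℝ, CRModel m) x x)) =
      θ x (fderiv ℝ (fieldInChart Y x) (extChartAt 𝓘(ℝ, CRModel m) x x) (X x)) -
      θ x (fderiv ℝ (fieldInChart X x) (extChartAt 𝓘(ℝ, CRModel m) x x) (Y x)) := by
    rw [VectorField.lieBracket, fieldInChart_self, fieldInChart_self]
    exact (θ x).map_sub _ _
  have h' : extD θ x (X x) (Y x) =
     fderiv ℝ (formInChart θ x) (extChartAt 𝓘(ℝ, CRModel m) x x) (X x) (Y x) -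
     fderiv ℝ (formInChart θ x) (extChartAt 𝓘(ℝ, CRModel m) x x) (Y x) (X x) := rfl
  rw [h', h]
  ring

/-! ## Calculus of vector fields -/

/-- Smoothness of a function near a point. -/
abbrev SmoothAt (m : ℕ) {M : Type*} [TopologicalSpace M] [ChartedSpace (CRModel m) M]
    {F : Type*} [NormedAddCommGroup F] [NormedSpace ℝ F] (f : M → F) (x : M) : Prop :=
  ContMDiffAt 𝓘(ℝ, CRModel m) 𝓘(ℝ, F) ∞ f x

/-- The differential of a function. -/
abbrev der (m : ℕ) {M : Type*} [TopologicalSpace M] [ChartedSpace (CRModel m) M]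
    {F : Type*} [NormedAddCommGroup F] [NormedSpace ℝ F] (f : M → F) (x : M) : Tan m x →L[ℝ] F :=
  mvfderiv 𝓘(ℝ, CRModel m) f x

lemma SmoothAt.mdiff {F : Type*} [NormedAddCommGroup F] [NormedSpace ℝ F] {f : M → F} {x : M}
    (h : SmoothAt m f x) : MDifferentiableAt 𝓘(ℝ, CRModel m) 𝓘(ℝ, F) f x :=
  h.mdifferentiableAt (by simp)

lemma natCast_le_infty (k : ℕ) : ((k : ℕ∞) : WithTop ℕ∞) ≤ ∞ := WithTop.coe_le_coe.2 le_top

lemma SmoothAt.eventually_mdiff {F : Type*} [NormedAddCommGroup F] [NormedSpace ℝ F] {f : M → F}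
    {x : M} (h : SmoothAt m f x) :
    ∀ᶠ y in 𝓝 x, MDifferentiableAt 𝓘(ℝ, CRModel m) 𝓘(ℝ, F) f y := by
  have h1 : ContMDiffAt 𝓘(ℝ, CRModel m) 𝓘(ℝ, F) 1 f x := h.of_le (by exact_mod_cast le_top)
  have : IsManifold 𝓘(ℝ, CRModel m) 1 M := IsManifold.of_le (n := ∞) (by exact_mod_cast le_top)
  filter_upwards [contMDiffAt_iff_contMDiffAt_nhds (by simp) |>.1 h1] with y hy
  exact hy.mdifferentiableAt one_ne_zero

lemma SmoothVFAt.eventually_mdiff {X : ∀ x : M, Tan m x} {x : M} (h : SmoothVFAt X x) :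
    ∀ᶠ y in 𝓝 x, MDifferentiableAt 𝓘(ℝ, CRModel m) (𝓘(ℝ, CRModel m).prod 𝓘(ℝ, CRModel m))
      (vfSection X) y := by
  have h1 : ContMDiffAt 𝓘(ℝ, CRModel m) (𝓘(ℝ, CRModel m).prod 𝓘(ℝ, CRModel m)) 1
    (vfSection X) x := ContMDiffAt.of_le h (by exact_mod_cast le_top)
  have : IsManifold 𝓘(ℝ, CRModel m) 1 M := IsManifold.of_le (n := ∞) (by exact_mod_cast le_top)
  have : IsManifold 𝓘(ℝ, CRModel m) (1 + 1) M :=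
    IsManifold.of_le (n := ∞) (natCast_le_infty 2)
  filter_upwards [contMDiffAt_iff_contMDiffAt_nhds (by simp) |>.1 h1] with y hy
  exact hy.mdifferentiableAt one_ne_zero

/-- The instance that the identities for Lie brackets ask for. -/
lemma isManifold_minSmoothness (k : ℕ) :
    IsManifold 𝓘(ℝ, CRModel m) (minSmoothness ℝ (k : ℕ∞)) M :=
  IsManifold.of_le (n := ∞) (by simpa using natCast_le_infty k)

instance : IsManifold 𝓘(ℝ, CRModel m) (minSmoothness ℝ 2) M :=
  isManifold_minSmoothness 2

instance : IsManifold 𝓘(ℝ, CRModel m) (minSmoothness ℝ 3) M :=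
  isManifold_minSmoothness 3

section VF

variable {X Y Z : ∀ x : M, Tan m x} {x : M} {f g : M → ℝ}

lemma SmoothVFAt.add (hX : SmoothVFAt X x) (hY : SmoothVFAt Y x) : SmoothVFAt (X + Y) x :=
  ContMDiffAt.add_section hX hY

lemma SmoothVFAt.sub (hX : SmoothVFAt X x) (hY : SmoothVFAt Y x) : SmoothVFAt (X - Y) x :=
  ContMDiffAt.sub_section hX hY

lemma SmoothVFAt.neg (hX : SmoothVFAt X x) : SmoothVFAt (-X) x :=
  ContMDiffAt.neg_section hX

lemma SmoothVFAt.smul (hf : SmoothAt m f x) (hX : SmoothVFAt X x) : SmoothVFAt (f • X) x :=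
  ContMDiffAt.smul_section hf hX

lemma SmoothVFAt.const_smul (c : ℝ) (hX : SmoothVFAt X x) : SmoothVFAt (c • X) x :=
  ContMDiffAt.const_smul_section hX

lemma SmoothVFAt.sum {ι : Type*} {s : Finset ι} {X : ι → ∀ x : M, Tan m x}
    (hX : ∀ i ∈ s, SmoothVFAt (X i) x) : SmoothVFAt (fun y ↦ ∑ i ∈ s, X i y) x :=
  ContMDiffAt.sum_section hX

lemma SmoothVFAt.congr (hX : SmoothVFAt X x) (h : ∀ᶠ y in 𝓝 x, Y y = X y) : SmoothVFAt Y x := by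
  refine ContMDiffAt.congr_of_eventuallyEq hX ?_
  filter_upwards [h] with y hy
  simp [vfSection, hy]

lemma SmoothVFAt.bracket (hX : SmoothVFAt X x) (hY : SmoothVFAt Y x) :
    SmoothVFAt (bracket X Y) x := by
  have : IsManifold 𝓘(ℝ, CRModel m) ((⊤ : ℕ∞) + 1) M :=
    IsManifold.of_le (n := ∞) (by simp)
  exact ContMDiffAt.mlieBracket_vectorField (m := ⊤) (n := ⊤) hX hY (by simp)

lemma SmoothForm.apply {V : Type*} [NormedAddCommGroup V] [NormedSpace ℝ V]
    {θ : ∀ x : M, Tan m x →L[ℝ] V} (hθ : SmoothForm θ) (hX : SmoothVFAt X x) :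
    SmoothAt m (fun y ↦ θ y (X y)) x := by
  have := (hθ x).clm_bundle_apply (hX : ContMDiffAt _ _ _ _ _)
  rw [contMDiffAt_section] at this
  exact this

lemma bracket_add_right (hY : SmoothVFAt Y x) (hZ : SmoothVFAt Z x) :
    bracket X (Y + Z) x = bracket X Y x + bracket X Z x :=
  VectorField.mlieBracket_add_right hY.mdiff hZ.mdiff

lemma bracket_add_left (hX : SmoothVFAt X x) (hY : SmoothVFAt Y x) :
    bracket (X + Y) Z x = bracket X Z x + bracket Y Z x :=
  VectorField.mlieBracket_add_left hX.mdiff hY.mdiff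

lemma bracket_smul_right (hf : SmoothAt m f x) (hY : SmoothVFAt Y x) :
    bracket X (f • Y) x = der m f x (X x) • Y x + f x • bracket X Y x :=
  VectorField.mlieBracket_smul_right hf.mdiff hY.mdiff

lemma bracket_smul_left (hf : SmoothAt m f x) (hX : SmoothVFAt X x) :
    bracket (f • X) Y x = - der m f x (Y x) • X x + f x • bracket X Y x :=
  VectorField.mlieBracket_smul_left hf.mdiff hX.mdiff

lemma bracket_swap : bracket X Y x = - bracket Y X x :=
  VectorField.mlieBracket_swap_apply

lemma bracket_neg_right (hY : SmoothVFAt Y x) : bracket X (-Y) x = - bracket X Y x := by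
  have := VectorField.mlieBracket_const_smul_right (V := X) (c := (-1 : ℝ)) hY.mdiff
  simpa using this

lemma bracket_congr {X' Y' : ∀ x : M, Tan m x} (hX : ∀ᶠ y in 𝓝 x, X y = X' y)
    (hY : ∀ᶠ y in 𝓝 x, Y y = Y' y) : bracket X Y x = bracket X' Y' x :=
  Filter.EventuallyEq.mlieBracket_vectorField_eq hX hY

lemma jacobi (hX : SmoothVFAt X x) (hY : SmoothVFAt Y x) (hZ : SmoothVFAt Z x) :
    bracket X (bracket Y Z) x = bracket (bracket X Y) Z x + bracket Y (bracket X Z) x := by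
  have h : ∀ {X : ∀ x : M, Tan m x}, SmoothVFAt X x → ContMDiffAt 𝓘(ℝ, CRModel m)
      (𝓘(ℝ, CRModel m).prod 𝓘(ℝ, CRModel m)) (minSmoothness ℝ 2) (vfSection X) x := fun hX ↦
    ContMDiffAt.of_le hX (by simpa using natCast_le_infty 2)
  exact VectorField.leibniz_identity_mlieBracket_apply (h hX) (h hY) (h hZ)

end VF

section Der

variable {F : Type*} [NormedAddCommGroup F] [NormedSpace ℝ F] {x : M}

lemma der_congr {f g : M → F} (h : ∀ᶠ y in 𝓝 x, f y = g y) : der m f x = der m g x := by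
  have : f =ᶠ[𝓝 x] g := h
  ext v
  have h1 := congr($(this.mfderiv_eq (I := 𝓘(ℝ, CRModel m)) (I' := 𝓘(ℝ, F))) v)
  exact h1

lemma der_const (c : F) (v : Tan m x) : der m (fun _ : M ↦ c) x v = 0 := by
  rw [der, mvfderiv_const]; rfl

lemma der_eq_zero {f : M → F} (c : F) (h : ∀ᶠ y in 𝓝 x, f y = c) (v : Tan m x) :
    der m f x v = 0 := by
  rw [der_congr h, der_const]

lemma der_add {f g : M → F} (hf : SmoothAt m f x) (hg : SmoothAt m g x) (v : Tan m x) :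
    der m (fun y ↦ f y + g y) x v = der m f x v + der m g x v :=
  congr($(mvfderiv_add hf.mdiff hg.mdiff) v)

lemma der_sub {f g : M → F} (hf : SmoothAt m f x) (hg : SmoothAt m g x) (v : Tan m x) :
    der m (fun y ↦ f y - g y) x v = der m f x v - der m g x v :=
  congr($(mvfderiv_sub hf.mdiff hg.mdiff) v)

lemma der_neg {f : M → F} (v : Tan m x) : der m (fun y ↦ - f y) x v = - der m f x v :=
  congr($(mvfderiv_neg (g := f)) v)

lemma SmoothAt.sum {ι : Type*} {s : Finset ι} {f : ι → M → F}
    (hf : ∀ i ∈ s, SmoothAt m (f i) x) : SmoothAt m (fun y ↦ ∑ i ∈ s, f i y) x :=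
  ContMDiffAt.sum hf

lemma der_sum {ι : Type*} {s : Finset ι} {f : ι → M → F}
    (hf : ∀ i ∈ s, SmoothAt m (f i) x) (v : Tan m x) :
    der m (fun y ↦ ∑ i ∈ s, f i y) x v = ∑ i ∈ s, der m (f i) x v := by
  classical
  induction s using Finset.induction_on with
  | empty => simpa using der_const (0 : F) v
  | insert i s hi ih =>
    simp only [Finset.sum_insert hi]
    rw [der_add (hf i (Finset.mem_insert_self ..)) (SmoothAt.sum fun j hj ↦
      hf j (Finset.mem_insert_of_mem hj)), ih fun j hj ↦ hf j (Finset.mem_insert_of_mem hj)]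

lemma der_mul {𝔸 : Type*} [NormedRing 𝔸] [NormedAlgebra ℝ 𝔸] {f g : M → 𝔸} (hf : SmoothAt m f x)
    (hg : SmoothAt m g x) (v : Tan m x) :
    der m (fun y ↦ f y * g y) x v = f x * der m g x v + der m f x v * g x := by
  have h := (hf.mdiff.hasMFDerivAt.mul' hg.mdiff.hasMFDerivAt).mfderiv
  exact congr($h v)

lemma SmoothAt.mul {𝔸 : Type*} [NormedRing 𝔸] [NormedAlgebra ℝ 𝔸] {f g : M → 𝔸}
    (hf : SmoothAt m f x) (hg : SmoothAt m g x) : SmoothAt m (fun y ↦ f y * g y) x := by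
  have h : ContDiff ℝ ∞ (fun p : 𝔸 × 𝔸 ↦ p.1 * p.2) := contDiff_mul
  exact h.contMDiff.contMDiffAt.comp x (hf.prodMk_space hg)

end Der

namespace CRFrame

variable {D : CRData m M} (f : CRFrame D) {x : M}

lemma vec_ne_zero (hx : x ∈ f.U) (i) : f.vec x i ≠ 0 := by
  rw [← f.basis_apply hx]
  exact (f.basis hx).ne_zero i

lemma eventually_mem (hx : x ∈ f.U) : ∀ᶠ y in 𝓝 x, y ∈ f.U := f.isOpen_U.mem_nhds hx

lemma smoothAt_coord {V : ∀ x : M, Tan m x} (hx : x ∈ f.U) (hV : SmoothVFAt V x) (i) :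
    SmoothAt m (fun y ↦ f.coord y (V y) i) x :=
  contMDiffAt_pi_space.1 (f.smooth_coord hx hV) i

include f in
lemma smooth_der_real {h : M → ℝ} {X : ∀ x : M, Tan m x} (hx : x ∈ f.U) (hh : SmoothAt m h x)
    (hX : SmoothVFAt X x) : SmoothAt m (fun y ↦ der m h y (X y)) x := by
  have h1 := f.smooth_vec none hx
  have h2 := (hX.bracket (h1.smul hh)).sub ((hX.bracket h1).smul hh)
  refine (f.smoothAt_coord hx h2 none).congr_of_eventuallyEq ?_
  filter_upwards [hh.eventually_mdiff, h1.eventually_mdiff, f.eventually_mem hx] with y hy hy' hyU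
  have h3 : bracket X (h • fun y ↦ f.vec y none) y = _ :=
    VectorField.mlieBracket_smul_right hy hy'
  change _ = f.coord y (bracket X (h • fun y ↦ f.vec y none) y -
    h y • bracket X (fun y ↦ f.vec y none) y) none
  rw [h3, add_sub_cancel_right, map_smul, f.coord_vec hyU]
  simp

include f in
lemma bracket_der {h : M → ℝ} {X Y : ∀ x : M, Tan m x} (hx : x ∈ f.U) (hh : SmoothAt m h x)
    (hX : SmoothVFAt X x) (hY : SmoothVFAt Y x) :
    der m h x (bracket X Y x) = der m (fun y ↦ der m h y (Y y)) x (X x) -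
      der m (fun y ↦ der m h y (X y)) x (Y x) := by
  have hN := f.smooth_vec none hx
  have key : ∀ {X Y : ∀ x : M, Tan m x}, SmoothVFAt X x → SmoothVFAt Y x →
      bracket X (bracket Y (h • fun y ↦ f.vec y none)) x =
        (der m (fun y ↦ der m h y (Y y)) x (X x) • f.vec x none +
        der m h x (Y x) • bracket X (fun y ↦ f.vec y none) x) +
        (der m h x (X x) • bracket Y (fun y ↦ f.vec y none) x +
        h x • bracket X (bracket Y (fun y ↦ f.vec y none)) x) := by
    intro X Y hX hY
    have h1 : ∀ᶠ y in 𝓝 x, bracket Y (h • fun y ↦ f.vec y none) y =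
        ((fun y ↦ der m h y (Y y)) • (fun y ↦ f.vec y none) +
          h • bracket Y (fun y ↦ f.vec y none)) y := by
      filter_upwards [hh.eventually_mdiff, hN.eventually_mdiff] with y hy hy'
      exact VectorField.mlieBracket_smul_right hy hy'
    have h2 := f.smooth_der_real hx hh hY
    rw [bracket_congr (Filter.Eventually.of_forall fun _ ↦ rfl) h1,
      bracket_add_right (hN.smul h2) ((hY.bracket hN).smul hh), bracket_smul_right h2 hN,
      bracket_smul_right hh (hY.bracket hN)]
  have h3 := jacobi hX hY (hN.smul hh)
  rw [key hX hY, key hY hX, bracket_smul_right hh hN, jacobi hX hY hN] at h3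
  have h4 : (der m h x (bracket X Y x) - (der m (fun y ↦ der m h y (Y y)) x (X x) -
      der m (fun y ↦ der m h y (X y)) x (Y x))) • f.vec x none = 0 := by
    refine Eq.trans ?_ (neg_eq_zero.2 (sub_eq_zero.2 h3))
    module
  rcases smul_eq_zero.1 h4 with h | h
  · exact sub_eq_zero.1 h
  · exact absurd h (f.vec_ne_zero hx none)

end CRFrame

/-! ## Smoothness of the pseudo-Hermitian structure -/

/-- Smoothness of a vector field at all points of a neighbourhood. -/
def SmoothNear (X : ∀ x : M, Tan m x) (x : M) : Prop := ∀ᶠ y in 𝓝 x, SmoothVFAt X y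

/-- Smoothness of a function at all points of a neighbourhood. -/
def FunSmoothNear (m : ℕ) {M : Type*} [TopologicalSpace M] [ChartedSpace (CRModel m) M]
    (h : M → ℝ) (x : M) : Prop := ∀ᶠ y in 𝓝 x, SmoothAt m h y

section Near

variable {X Y Z : ∀ x : M, Tan m x} {x : M} {h k : M → ℝ}

lemma SmoothNear.self (hX : SmoothNear X x) : SmoothVFAt X x := hX.self_of_nhds

lemma FunSmoothNear.self (hh : FunSmoothNear m h x) : SmoothAt m h x := hh.self_of_nhds

lemma SmoothNear.nhds (hX : SmoothNear X x) : ∀ᶠ y in 𝓝 x, SmoothNear X y :=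
  eventually_eventually_nhds.2 hX

lemma SmoothNear.bracket (hX : SmoothNear X x) (hY : SmoothNear Y x) :
    SmoothNear (bracket X Y) x := by
  filter_upwards [hX, hY] with y h1 h2 using h1.bracket h2

end Near

namespace CRFrame

variable {D : CRData m M} (f : CRFrame D) {x : M}

/-- The frame `(e_1, …, e_m, J e_1, …, J e_m)` of `H`. -/
def hvec (i : Fin m ⊕ Fin m) : ∀ x, D.H x := Sum.elim f.e (fun α ↦ D.Jf (f.e α)) i

lemma vec_some (y : M) (i : Fin m ⊕ Fin m) : f.vec y (some i) = (f.hvec i y : Tan m y) := by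
  rcases i with α | α <;> rfl

lemma smooth_hvec (hx : x ∈ f.U) (i : Fin m ⊕ Fin m) : SmoothVFAt (D.vf (f.hvec i)) x := by
  have := f.smooth_vec (some i) hx
  simp only [vec_some] at this
  exact this

lemma smoothNear_hvec (hx : x ∈ f.U) (i : Fin m ⊕ Fin m) : SmoothNear (D.vf (f.hvec i)) x := by
  filter_upwards [f.eventually_mem hx] with y hy using f.smooth_hvec hy i

lemma coord_none_coe (hx : x ∈ f.U) (v : D.H x) : f.coord x (v : Tan m x) none = 0 := by
  obtain ⟨a, b, rfl⟩ := f.span_H hx v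
  rw [f.coord_sum hx]
  rfl

lemma sum_hvec (hx : x ∈ f.U) (v : D.H x) :
    ∑ i, f.coord x (v : Tan m x) (some i) • f.hvec i x = v := by
  have h := f.sum_coord hx (v : Tan m x)
  rw [Fintype.sum_option, f.coord_none_coe hx, zero_smul, zero_add] at h
  ext1
  rw [AddSubmonoidClass.coe_finsetSum, ← h]
  refine Finset.sum_congr rfl fun i _ ↦ ?_
  rw [vec_some, h]
  rfl

lemma coord_hvec (hx : x ∈ f.U) (i j : Fin m ⊕ Fin m) :
    f.coord x (f.hvec i x : Tan m x) (some j) = if j = i then 1 else 0 := by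
  classical
  rw [← vec_some, f.coord_vec hx, Pi.single_apply]
  simp

lemma smooth_Jhvec (hx : x ∈ f.U) (i : Fin m ⊕ Fin m) :
    SmoothVFAt (D.vf (D.Jf (f.hvec i))) x := by
  rcases i with α | α
  · exact f.smooth_hvec hx (Sum.inr α)
  · refine (f.smooth_hvec hx (Sum.inl α)).neg.congr (Filter.Eventually.of_forall fun y ↦ ?_)
    change (D.J y (D.J y (f.e α y)) : Tan m y) = - (f.e α y : Tan m y)
    rw [D.J_sq]
    rfl

lemma smooth_Jf {X : ∀ x, D.H x} (hx : x ∈ f.U) (hX : SmoothVFAt (D.vf X) x) :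
    SmoothVFAt (D.vf (D.Jf X)) x := by
  have h := SmoothVFAt.sum (s := Finset.univ) fun i _ ↦
    (f.smooth_Jhvec hx i).smul (f.smoothAt_coord hx hX (some i))
  refine h.congr ?_
  filter_upwards [f.eventually_mem hx] with y hy
  conv_lhs => rw [CRData.vf, CRData.Jf, ← f.sum_hvec hy (X y), map_sum]
  rw [AddSubmonoidClass.coe_finsetSum]
  refine Finset.sum_congr rfl fun i _ ↦ ?_
  rw [map_smul]
  rfl

/-- The extension of a tangent vector in `H` to a section of `H` with constant coefficients. -/
def extend {x : M} (v : D.H x) (y : M) : D.H y :=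
  ∑ i, f.coord x (v : Tan m x) (some i) • f.hvec i y

lemma extend_self (hx : x ∈ f.U) (v : D.H x) : f.extend v x = v := f.sum_hvec hx v

lemma smooth_extend {y : M} (hy : y ∈ f.U) (v : D.H x) : SmoothVFAt (D.vf (f.extend v)) y := by
  have h := SmoothVFAt.sum (s := Finset.univ) fun i _ ↦
    (f.smooth_hvec hy i).const_smul (f.coord x (v : Tan m x) (some i))
  refine h.congr (Filter.Eventually.of_forall fun z ↦ ?_)
  simp [extend, CRData.vf]

lemma smoothNear_extend {y : M} (hy : y ∈ f.U) (v : D.H x) :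
    SmoothNear (D.vf (f.extend v)) y := by
  filter_upwards [f.eventually_mem hy] with z hz using f.smooth_extend hz v

end CRFrame

namespace CRStructure

variable (C : CRStructure m M)

lemma smooth_Jf {X : ∀ x, C.H x} {x : M} (hX : SmoothVFAt (C.vf X) x) :
    SmoothVFAt (C.vf (C.Jf X)) x :=
  (C.frameAt x).smooth_Jf (C.mem_frameAt x) hX

lemma smoothNear_Jf {X : ∀ x, C.H x} {x : M} (hX : SmoothNear (C.vf X) x) :
    SmoothNear (C.vf (C.Jf X)) x := by
  filter_upwards [hX] with y hy using C.smooth_Jf hy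

lemma exists_extend {x : M} (v : C.H x) : ∃ X : ∀ y, C.H y, X x = v ∧ SmoothNear (C.vf X) x :=
  ⟨(C.frameAt x).extend v, (C.frameAt x).extend_self (C.mem_frameAt x) v,
    (C.frameAt x).smoothNear_extend (C.mem_frameAt x) v⟩

end CRStructure

namespace PseudoHermitian

variable {C : CRStructure m M} (θ : PseudoHermitian C) {x : M}

lemma extD_eq_bracket {X Y : ∀ y, C.H y} (hX : SmoothVFAt (C.vf X) x)
    (hY : SmoothVFAt (C.vf Y) x) :
    extD θ.form x (X x : Tan m x) (Y x : Tan m x) =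
      - θ.form x (bracket (C.vf X) (C.vf Y) x) := by
  rw [extD_apply θ.smooth hX hY]
  have h : ∀ (Z : ∀ y, C.H y) (v : Tan m x), der m (fun y ↦ θ.form y (Z y : Tan m y)) x v = 0 :=
    fun Z v ↦ der_eq_zero 0 (Filter.Eventually.of_forall fun y ↦ θ.vanish y (Z y)) v
  rw [h, h]
  ring

lemma extD_J_J (u v : C.H x) : extD θ.form x (C.J x u : Tan m x) (C.J x v : Tan m x) =
    extD θ.form x (u : Tan m x) (v : Tan m x) := by
  obtain ⟨X, rfl, hX⟩ := C.exists_extend u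
  obtain ⟨Y, rfl, hY⟩ := C.exists_extend v
  have h1 := θ.extD_eq_bracket hX.self hY.self
  have h2 := θ.extD_eq_bracket (C.smooth_Jf hX.self) (C.smooth_Jf hY.self)
  have h3 := θ.mem_H.1 (C.partiallyIntegrable X Y x hX.self hY.self)
  rw [map_sub] at h3
  have h2' : extD θ.form x (C.J x (X x) : Tan m x) (C.J x (Y x) : Tan m x) = _ := h2
  rw [h1, h2']
  change _ = - θ.form x (bracket (C.vf X) (C.vf Y) x)
  linarith

lemma extD_reeb (v : Tan m x) : extD θ.form x (θ.reeb x) v = 0 := (θ.exists_reeb x).choose_spec.2 v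

lemma extD_projH (u v : Tan m x) :
    extD θ.form x (θ.projH x u : Tan m x) v = extD θ.form x u v := by
  rw [projH_apply, map_sub, map_smul, LinearMap.sub_apply, LinearMap.smul_apply, extD_reeb]
  simp

lemma extJ_coe (v : C.H x) : θ.extJ x (v : Tan m x) = (C.J x v : Tan m x) := by
  simp [extJ, projH_coe]

lemma projH_reeb : θ.projH x (θ.reeb x) = 0 := by
  ext1
  rw [projH_apply, form_reeb, one_smul, sub_self]; rfl

lemma extJ_reeb : θ.extJ x (θ.reeb x) = 0 := by
  simp [extJ, projH_reeb]

lemma form_extJ (v : Tan m x) : θ.form x (θ.extJ x v) = 0 := θ.vanish x _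

lemma extJ_extJ (v : Tan m x) : θ.extJ x (θ.extJ x v) = θ.form x v • θ.reeb x - v := by
  have h : θ.extJ x (θ.extJ x v) = (C.J x (C.J x (θ.projH x v)) : Tan m x) := θ.extJ_coe _
  rw [h, C.J_sq, Submodule.coe_neg, projH_apply]
  abel

lemma levi_eq (u v : Tan m x) : θ.levi x u v = extD θ.form x u (θ.extJ x v) := by
  have h1 : θ.extJ x v = (C.J x (θ.projH x v) : Tan m x) := rfl
  have h2 : θ.extJ x u = (C.J x (θ.projH x u) : Tan m x) := rfl
  have h3 := θ.extD_J_J (C.J x (θ.projH x u)) (θ.projH x v)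
  rw [C.J_sq, Submodule.coe_neg, map_neg, LinearMap.neg_apply] at h3
  have h4 : θ.levi x u v = (extD θ.form x (θ.projH x u : Tan m x) (θ.extJ x v)
        + extD θ.form x (θ.projH x v : Tan m x) (θ.extJ x u)) / 2 := rfl
  have h5 := extD_antisymm θ.form x (C.J x (θ.projH x u) : Tan m x) (θ.projH x v : Tan m x)
  rw [h4, ← θ.extD_projH u, h1, h2]
  linarith

lemma levi_reeb (v : Tan m x) : θ.levi x (θ.reeb x) v = 0 := by rw [levi_eq, extD_reeb]

lemma levi_reeb_right (v : Tan m x) : θ.levi x v (θ.reeb x) = 0 := by rw [levi_symm, levi_reeb]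

lemma levi_projH_right (u v : Tan m x) :
    θ.levi x u (θ.projH x v : Tan m x) = θ.levi x u v := by
  rw [levi_symm, levi_projH, levi_symm]

lemma levi_extJ (u v : Tan m x) : θ.levi x (θ.extJ x u) v = - θ.levi x u (θ.extJ x v) := by
  rw [← θ.levi_projH x u, ← θ.levi_projH_right _ v]
  exact θ.levi_J x (θ.projH x u) (θ.projH x v)

lemma levi_extJ_extJ (u v : Tan m x) : θ.levi x (θ.extJ x u) (θ.extJ x v) = θ.levi x u v := by
  rw [levi_extJ, extJ_extJ, map_sub, map_smul, levi_reeb_right]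
  simp

lemma extD_eq (u v : Tan m x) : extD θ.form x u v = θ.levi x (θ.extJ x u) v := by
  rw [levi_extJ, levi_eq, extJ_extJ, map_sub, map_smul, extD_antisymm θ.form x u (θ.reeb x),
    extD_reeb]
  simp

lemma eq_zero_of_levi {u : Tan m x} (hu : θ.form x u = 0)
    (h : ∀ v : C.H x, θ.levi x u (v : Tan m x) = 0) : u = 0 := by
  by_contra hne
  exact (θ.levi_pos x ⟨u, θ.mem_H.2 hu⟩ (fun h ↦ hne (congrArg Subtype.val h))).ne'
    (h ⟨u, θ.mem_H.2 hu⟩)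

lemma eq_zero_of_levi_hvec (f : CRFrame C.toCRData) (hx : x ∈ f.U) {u : Tan m x}
    (hu : θ.form x u = 0) (h : ∀ i, θ.levi x u (f.hvec i x : Tan m x) = 0) : u = 0 := by
  refine θ.eq_zero_of_levi hu fun v ↦ ?_
  rw [← f.sum_hvec hx v, AddSubmonoidClass.coe_finsetSum, map_sum]
  refine Finset.sum_eq_zero fun i _ ↦ ?_
  rw [Submodule.coe_smul, map_smul, h, smul_zero]

lemma smooth_extD {X Y : ∀ y : M, Tan m y} (hX : SmoothNear X x) (hY : SmoothNear Y x) :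
    SmoothAt m (fun y ↦ extD θ.form y (X y) (Y y)) x := by
  set f := C.frameAt x
  have hx : x ∈ f.U := C.mem_frameAt x
  have h1 := f.smooth_der_real hx (θ.smooth.apply hY.self) hX.self
  have h2 := f.smooth_der_real hx (θ.smooth.apply hX.self) hY.self
  have h3 := θ.smooth.apply (hX.self.bracket hY.self)
  refine ((h1.sub h2).sub h3).congr_of_eventuallyEq ?_
  filter_upwards [hX, hY] with y h1 h2 using extD_apply θ.smooth h1 h2

lemma smooth_gram (f : CRFrame C.toCRData) (hx : x ∈ f.U) (i j) :
    SmoothAt m (fun y ↦ θ.levi y (f.hvec i y : Tan m y) (f.hvec j y : Tan m y)) x := by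
  have h := θ.smooth_extD (f.smoothNear_hvec hx i) (C.smoothNear_Jf (f.smoothNear_hvec hx j))
  refine h.congr_of_eventuallyEq (Filter.Eventually.of_forall fun y ↦ ?_)
  simp only [levi_eq, extJ_coe]

/-- A section `V` of `H` is smooth if the functions `L(V, e_i)` are. -/
lemma smooth_of_levi (f : CRFrame C.toCRData) (hx : x ∈ f.U) {V : ∀ y, C.H y}
    (hV : ∀ i, SmoothAt m (fun y ↦ θ.levi y (V y : Tan m y) (f.hvec i y : Tan m y)) x) :
    SmoothVFAt (C.vf V) x := by
  classical
  let G : M → (((Fin m ⊕ Fin m) → ℝ) →L[ℝ] ((Fin m ⊕ Fin m) → ℝ)) := fun y ↦ ∑ i, ∑ j,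
    θ.levi y (f.hvec j y : Tan m y) (f.hvec i y : Tan m y) •
      (ContinuousLinearMap.proj (R := ℝ) (φ := fun _ : (Fin m ⊕ Fin m) ↦ ℝ) j).smulRight (Pi.single i (1 : ℝ))
  have hG : ∀ y (c : (Fin m ⊕ Fin m) → ℝ) i, G y c i =
      θ.levi y ((∑ j, c j • f.hvec j y : C.H y) : Tan m y) (f.hvec i y : Tan m y) := by
    intro y c i
    have : ((∑ j, c j • f.hvec j y : C.H y) : Tan m y) = ∑ j, c j • (f.hvec j y : Tan m y) := by
      rw [AddSubmonoidClass.coe_finsetSum]; rfl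
    rw [this, map_sum, LinearMap.sum_apply]
    simp only [G, sum_apply, Finset.sum_apply, smul_apply,
      ContinuousLinearMap.smulRight_apply, ContinuousLinearMap.proj_apply, Pi.smul_apply,
      map_smul, LinearMap.smul_apply, smul_eq_mul, Pi.single_apply, mul_ite, mul_one, mul_zero]
    rw [Finset.sum_comm]
    refine Finset.sum_congr rfl fun j _ ↦ ?_
    simp [mul_comm]
  have hGs : ContMDiffAt 𝓘(ℝ, CRModel m) 𝓘(ℝ, ((Fin m ⊕ Fin m) → ℝ) →L[ℝ] ((Fin m ⊕ Fin m) → ℝ)) ∞ G x :=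
    ContMDiffAt.sum fun i _ ↦ ContMDiffAt.sum fun j _ ↦
      (θ.smooth_gram f hx j i).smul contMDiffAt_const
  have hinj : ∀ y ∈ f.U, Function.Injective (G y) := by
    intro y hy
    rw [injective_iff_map_eq_zero]
    intro c hc
    have h1 : (∑ j, c j • f.hvec j y : C.H y) = 0 := by
      ext1
      refine θ.eq_zero_of_levi_hvec f hy (θ.vanish _ _) fun i ↦ ?_
      rw [← hG, hc]
      rfl
    have h2 : ∀ i, f.coord y ((∑ j, c j • f.hvec j y : C.H y) : Tan m y) (some i) = c i := by
      intro i
      rw [AddSubmonoidClass.coe_finsetSum, map_sum, Finset.sum_apply]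
      simp [f.coord_hvec hy]
    ext i
    rw [← h2 i, h1]
    simp
  let Φ : ∀ y, y ∈ f.U → (((Fin m ⊕ Fin m) → ℝ) ≃L[ℝ] ((Fin m ⊕ Fin m) → ℝ)) := fun y hy ↦
    (LinearEquiv.ofInjectiveEndo (G y).toLinearMap (hinj y hy)).toContinuousLinearEquiv
  have hΦ : ∀ y hy, G y = (Φ y hy : ((Fin m ⊕ Fin m) → ℝ) →L[ℝ] ((Fin m ⊕ Fin m) → ℝ)) := fun y hy ↦ by ext1 c; rfl
  have hinv : ContMDiffAt 𝓘(ℝ, CRModel m) 𝓘(ℝ, ((Fin m ⊕ Fin m) → ℝ) →L[ℝ] ((Fin m ⊕ Fin m) → ℝ)) ∞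
      (fun y ↦ (G y).inverse) x := by
    have := contDiffAt_map_inverse (𝕜 := ℝ) (n := ∞) (Φ x hx)
    rw [← hΦ x hx] at this
    exact this.contMDiffAt.comp x hGs
  have hb : ContMDiffAt 𝓘(ℝ, CRModel m) 𝓘(ℝ, (Fin m ⊕ Fin m) → ℝ) ∞
      (fun y i ↦ θ.levi y (V y : Tan m y) (f.hvec i y : Tan m y)) x := contMDiffAt_pi_space.2 hV
  have hc := contMDiffAt_pi_space.1 (hinv.clm_apply hb)
  refine (SmoothVFAt.sum (s := Finset.univ) fun i _ ↦ (f.smooth_hvec hx i).smul (hc i)).congr ?_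
  filter_upwards [f.eventually_mem hx] with y hy
  have h1 : (fun i ↦ θ.levi y (V y : Tan m y) (f.hvec i y : Tan m y)) =
      G y (fun j ↦ f.coord y (V y : Tan m y) (some j)) := by
    ext i
    rw [hG, f.sum_hvec hy]
  have h2 : (G y).inverse (fun i ↦ θ.levi y (V y : Tan m y) (f.hvec i y : Tan m y)) =
      (fun j ↦ f.coord y (V y : Tan m y) (some j)) := by
    rw [h1, hΦ y hy, ContinuousLinearMap.inverse_equiv]
    exact (Φ y hy).symm_apply_apply _
  change (V y : Tan m y) = ∑ i, (G y).inverse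
    (fun i ↦ θ.levi y (V y : Tan m y) (f.hvec i y : Tan m y)) i • (f.hvec i y : Tan m y)
  rw [h2]
  conv_lhs => rw [← f.sum_hvec hy (V y)]
  rw [AddSubmonoidClass.coe_finsetSum]
  rfl

lemma smooth_reeb (x : M) : SmoothVFAt θ.reeb x := by
  set f := C.frameAt x
  have hx : x ∈ f.U := C.mem_frameAt x
  have hN : SmoothNear f.N x := by
    filter_upwards [f.eventually_mem hx] with y hy using f.smooth_N y hy
  have h1 : SmoothVFAt (C.vf fun y ↦ θ.projH y (f.N y)) x := by
    refine θ.smooth_of_levi f hx fun i ↦ ?_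
    have h := θ.smooth_extD hN (C.smoothNear_Jf (f.smoothNear_hvec hx i))
    refine h.congr_of_eventuallyEq (Filter.Eventually.of_forall fun y ↦ ?_)
    simp only [θ.levi_projH, levi_eq, extJ_coe, CRData.vf]
  have hne : ∀ y ∈ f.U, θ.form y (f.N y) ≠ 0 := by
    intro y hy h
    have h2 := f.coord_none_coe hy ⟨f.N y, θ.mem_H.2 h⟩
    have h3 : f.coord y (f.vec y none) none = 1 := by rw [f.coord_vec hy]; simp
    exact one_ne_zero (h3.symm.trans h2)
  have h2 := (θ.smooth.apply hN.self).inv₀ (hne x hx)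
  refine ((hN.self.sub h1).smul h2).congr ?_
  filter_upwards [f.eventually_mem hx] with y hy
  change _ = (θ.form y (f.N y))⁻¹ • (f.N y - (θ.projH y (f.N y) : Tan m y))
  rw [projH_apply, sub_sub_cancel, smul_smul, inv_mul_cancel₀ (hne y hy), one_smul]

lemma smoothNear_reeb (x : M) : SmoothNear θ.reeb x := Filter.Eventually.of_forall θ.smooth_reeb

lemma smooth_projH {X : ∀ y : M, Tan m y} (hX : SmoothVFAt X x) :
    SmoothVFAt (C.vf fun y ↦ θ.projH y (X y)) x :=
  (hX.sub ((θ.smooth_reeb x).smul (θ.smooth.apply hX))).congr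
    (Filter.Eventually.of_forall fun _ ↦ rfl)

lemma smooth_extJ {X : ∀ y : M, Tan m y} (hX : SmoothVFAt X x) :
    SmoothVFAt (fun y ↦ θ.extJ y (X y)) x :=
  C.smooth_Jf (θ.smooth_projH hX)

lemma smooth_levi {X Y : ∀ y : M, Tan m y} (hX : SmoothVFAt X x) (hY : SmoothVFAt Y x) :
    SmoothAt m (fun y ↦ θ.levi y (X y) (Y y)) x := by
  set f := C.frameAt x
  have hx : x ∈ f.U := C.mem_frameAt x
  have h1 := f.smoothAt_coord hx (θ.smooth_projH hX)
  have h2 := f.smoothAt_coord hx (θ.smooth_projH hY)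
  have h := SmoothAt.sum (s := Finset.univ) fun i (_ : i ∈ Finset.univ) ↦
    SmoothAt.sum (s := Finset.univ) fun j (_ : j ∈ Finset.univ) ↦
    ((h1 (some i)).mul (h2 (some j))).mul (θ.smooth_gram f hx i j)
  refine h.congr_of_eventuallyEq ?_
  filter_upwards [f.eventually_mem hx] with y hy
  rw [← θ.levi_projH, ← θ.levi_projH_right]
  conv_lhs => rw [← f.sum_hvec hy (θ.projH y (X y)), ← f.sum_hvec hy (θ.projH y (Y y))]
  simp only [AddSubmonoidClass.coe_finsetSum, map_sum, LinearMap.sum_apply, Submodule.coe_smul,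
    map_smul, LinearMap.smul_apply, smul_eq_mul, Finset.mul_sum]
  rw [Finset.sum_comm]
  refine Finset.sum_congr rfl fun i _ ↦ Finset.sum_congr rfl fun j _ ↦ ?_
  ring

end PseudoHermitian

/-! ## The Koszul formula of the Tanaka-Webster connection -/

namespace PseudoHermitian

variable {C : CRStructure m M} (θ : PseudoHermitian C) {x : M} {X Y Z : ∀ y, C.H y}

/-- The derivative of a section of `H` has the expected `dθ` by `d(dθ) = 0`. -/
lemma extD_closed (hX : SmoothNear (C.vf X) x) (hY : SmoothNear (C.vf Y) x)
    (hZ : SmoothNear (C.vf Z) x) {a b c : M → ℝ}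
    (ha : ∀ y, a y = extD θ.form y (Y y : Tan m y) (Z y : Tan m y))
    (hb : ∀ y, b y = extD θ.form y (Z y : Tan m y) (X y : Tan m y))
    (hc : ∀ y, c y = extD θ.form y (X y : Tan m y) (Y y : Tan m y)) :
    der m a x (X x : Tan m x) + der m b x (Y x : Tan m x) + der m c x (Z x : Tan m x)
      + θ.levi x (bracket (C.vf Y) (C.vf Z) x) (C.J x (X x) : Tan m x)
      + θ.levi x (bracket (C.vf Z) (C.vf X) x) (C.J x (Y x) : Tan m x)
      + θ.levi x (bracket (C.vf X) (C.vf Y) x) (C.J x (Z x) : Tan m x) = 0 := by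
  have key : ∀ {X Y Z : ∀ y, C.H y} {a : M → ℝ}, SmoothNear (C.vf X) x → SmoothNear (C.vf Y) x →
      SmoothNear (C.vf Z) x → (∀ y, a y = extD θ.form y (Y y : Tan m y) (Z y : Tan m y)) →
      der m a x (X x : Tan m x) +
        θ.levi x (bracket (C.vf Y) (C.vf Z) x) (C.J x (X x) : Tan m x) =
      - θ.form x (bracket (C.vf X) (bracket (C.vf Y) (C.vf Z)) x) := by
    intro X Y Z a hX hY hZ ha
    have h1 := extD_apply θ.smooth hX.self (hY.bracket hZ).self
    have h2 : der m a x = der m (fun y ↦ - θ.form y (bracket (C.vf Y) (C.vf Z) y)) x := by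
      refine der_congr ?_
      filter_upwards [hY, hZ] with y hy hz
      rw [ha, θ.extD_eq_bracket hy hz]
    have h3 : der m (fun y ↦ θ.form y (X y : Tan m y)) x (bracket (C.vf Y) (C.vf Z) x) = 0 :=
      der_eq_zero 0 (Filter.Eventually.of_forall fun y ↦ θ.vanish y (X y)) _
    rw [h3, extD_eq, extJ_coe, levi_symm] at h1
    rw [h2, der_neg, h1]
    ring
  have j := jacobi hX.self hY.self hZ.self
  have j1 : bracket (C.vf Z) (bracket (C.vf X) (C.vf Y)) x =
      - bracket (bracket (C.vf X) (C.vf Y)) (C.vf Z) x := bracket_swap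
  have j2 : bracket (C.vf Y) (bracket (C.vf Z) (C.vf X)) x =
      - bracket (C.vf Y) (bracket (C.vf X) (C.vf Z)) x := by
    rw [← bracket_neg_right (hX.bracket hZ).self]
    exact bracket_congr (Filter.Eventually.of_forall fun _ ↦ rfl)
      (Filter.Eventually.of_forall fun _ ↦ bracket_swap)
  have k1 := key hX hY hZ ha
  have k2 := key hY hZ hX hb
  have k3 := key hZ hX hY hc
  rw [j, map_add] at k1
  rw [j2, map_neg] at k2
  rw [j1, map_neg] at k3
  linarith

lemma form_bracket_reeb (hY : SmoothVFAt (C.vf Y) x) :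
    θ.form x (bracket θ.reeb (C.vf Y) x) = 0 := by
  have h1 := extD_apply θ.smooth (θ.smooth_reeb x) hY
  have h2 : der m (fun y ↦ θ.form y (Y y : Tan m y)) x (θ.reeb x) = 0 :=
    der_eq_zero 0 (Filter.Eventually.of_forall fun y ↦ θ.vanish y (Y y)) _
  have h3 : der m (fun y ↦ θ.form y (θ.reeb y)) x (Y x : Tan m x) = 0 :=
    der_eq_zero 1 (Filter.Eventually.of_forall fun y ↦ θ.form_reeb y) _
  rw [extD_reeb] at h1
  have h4 : (0 : ℝ) = 0 - 0 - θ.form x (bracket θ.reeb (C.vf Y) x) :=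
    h1.trans (congrArg₂ (fun a b ↦ a - b - θ.form x (bracket θ.reeb (C.vf Y) x)) h2 h3)
  linarith

lemma der_extD_reeb (hY : SmoothNear (C.vf Y) x) (hZ : SmoothNear (C.vf Z) x) {a : M → ℝ}
    (ha : ∀ y, a y = extD θ.form y (Y y : Tan m y) (Z y : Tan m y)) :
    der m a x (θ.reeb x) = extD θ.form x (bracket θ.reeb (C.vf Y) x) (Z x : Tan m x)
      + extD θ.form x (Y x : Tan m x) (bracket θ.reeb (C.vf Z) x) := by
  have hT := θ.smoothNear_reeb x
  have h0 : ∀ {Y : ∀ y, C.H y}, SmoothNear (C.vf Y) x → ∀ v,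
      der m (fun y ↦ θ.form y (bracket θ.reeb (C.vf Y) y)) x v = 0 := fun hY v ↦
    der_eq_zero 0 (hY.mono fun y hy ↦ θ.form_bracket_reeb hy) v
  have h0' : ∀ (Y : ∀ y, C.H y) v, der m (fun y ↦ θ.form y (C.vf Y y)) x v = 0 := fun Y v ↦
    der_eq_zero 0 (Filter.Eventually.of_forall fun y ↦ θ.vanish y (Y y)) v
  have h1 := extD_apply θ.smooth (hT.bracket hY).self hZ.self
  have h2 := extD_apply θ.smooth hY.self (hT.bracket hZ).self
  have h3 := extD_apply θ.smooth hT.self (hY.bracket hZ).self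
  have h4 : der m a x = der m (fun y ↦ - θ.form y (bracket (C.vf Y) (C.vf Z) y)) x := by
    refine der_congr ?_
    filter_upwards [hY, hZ] with y hy hz
    rw [ha, θ.extD_eq_bracket hy hz]
  have h5 : der m (fun y ↦ θ.form y (θ.reeb y)) x (bracket (C.vf Y) (C.vf Z) x) = 0 :=
    der_eq_zero 1 (Filter.Eventually.of_forall fun y ↦ θ.form_reeb y) _
  have j := congrArg (θ.form x) (jacobi hT.self hY.self hZ.self)
  rw [map_add] at j
  rw [h0 hY, h0'] at h1
  rw [h0 hZ, h0'] at h2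
  rw [extD_reeb, h5] at h3
  change extD θ.form x (bracket θ.reeb (C.vf Y) x) (Z x : Tan m x) = _ at h1
  change extD θ.form x (Y x : Tan m x) (bracket θ.reeb (C.vf Z) x) = _ at h2
  rw [h4, der_neg, h1, h2]
  linarith

/-- The section `([X, Y] + [JX, JY] + J([JX, Y] - [X, JY])) / 2`, the real form of the
`T_{10}`-component of `[X + iJX, Y - iJY]`. -/
def mixedBracket (X Y : ∀ y, C.H y) (x : M) : Tan m x :=
  (1 / 2 : ℝ) • (bracket (C.vf X) (C.vf Y) x + bracket (C.vf (C.Jf X)) (C.vf (C.Jf Y)) x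
    + θ.extJ x (bracket (C.vf (C.Jf X)) (C.vf Y) x - bracket (C.vf X) (C.vf (C.Jf Y)) x))

/-- The expression that computes `2 L(∇_X Y, Z)` for the Tanaka-Webster connection. -/
def koszul (X Y Z : ∀ y, C.H y) (x : M) : ℝ :=
  θ.levi x (θ.mixedBracket X Y x) (Z x : Tan m x)
    + der m (fun y ↦ θ.levi y (Y y : Tan m y) (Z y : Tan m y)) x (X x : Tan m x)
    + der m (fun y ↦ θ.levi y (Y y : Tan m y) (C.J y (Z y) : Tan m y)) x (C.J x (X x) : Tan m x)
    - θ.levi x (θ.mixedBracket X Z x) (Y x : Tan m x)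

lemma levi_J_right (v w : C.H x) : θ.levi x (v : Tan m x) (C.J x w : Tan m x) =
    - θ.levi x (w : Tan m x) (C.J x v : Tan m x) := by
  rw [levi_symm, levi_J]

lemma levi_J_J (v w : C.H x) : θ.levi x (C.J x v : Tan m x) (C.J x w : Tan m x) =
    θ.levi x (v : Tan m x) (w : Tan m x) := by
  rw [levi_J, C.J_sq, Submodule.coe_neg, map_neg, neg_neg]

lemma extD_coe (v w : C.H x) : extD θ.form x (v : Tan m x) (w : Tan m x) =
    - θ.levi x (v : Tan m x) (C.J x w : Tan m x) := by
  rw [extD_eq, extJ_coe, levi_J]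

lemma koszul_skew (X Y Z : ∀ y, C.H y) (x : M) : θ.koszul X Y Z x + θ.koszul X Z Y x =
    2 * der m (fun y ↦ θ.levi y (Y y : Tan m y) (Z y : Tan m y)) x (X x : Tan m x) := by
  have h1 : (fun y ↦ θ.levi y (Z y : Tan m y) (Y y : Tan m y)) =
      fun y ↦ θ.levi y (Y y : Tan m y) (Z y : Tan m y) := funext fun y ↦ θ.levi_symm y _ _
  have h2 : (fun y ↦ θ.levi y (Z y : Tan m y) (C.J y (Y y) : Tan m y)) =
      fun y ↦ - θ.levi y (Y y : Tan m y) (C.J y (Z y) : Tan m y) :=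
    funext fun y ↦ θ.levi_J_right _ _
  rw [koszul, koszul, h1, h2, der_neg]
  ring

lemma bracket_Jf_Jf_right (X : ∀ y : M, Tan m y) (hY : SmoothVFAt (C.vf Y) x) :
    bracket X (C.vf (C.Jf (C.Jf Y))) x = - bracket X (C.vf Y) x := by
  rw [← bracket_neg_right hY]
  refine bracket_congr (Filter.Eventually.of_forall fun _ ↦ rfl)
    (Filter.Eventually.of_forall fun y ↦ ?_)
  exact congrArg Subtype.val (C.J_sq y (Y y))

lemma levi_mixedBracket_J (hY : SmoothVFAt (C.vf Y) x) (v : Tan m x) :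
    θ.levi x (θ.mixedBracket X (C.Jf Y) x) v = - θ.levi x (θ.mixedBracket X Y x) (θ.extJ x v) := by
  rw [mixedBracket, mixedBracket, bracket_Jf_Jf_right _ hY, bracket_Jf_Jf_right _ hY]
  simp only [map_smul, map_add, map_sub, map_neg, LinearMap.smul_apply, LinearMap.add_apply,
    LinearMap.sub_apply, LinearMap.neg_apply, levi_extJ, smul_eq_mul, extJ_extJ,
    levi_reeb_right]
  ring

lemma koszul_J (hY : SmoothVFAt (C.vf Y) x) (hZ : SmoothVFAt (C.vf Z) x) :
    θ.koszul X (C.Jf Y) Z x = - θ.koszul X Y (C.Jf Z) x := by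
  have h1 : (fun y ↦ θ.levi y (C.Jf Y y : Tan m y) (Z y : Tan m y)) =
      fun y ↦ - θ.levi y (Y y : Tan m y) (C.Jf Z y : Tan m y) := funext fun y ↦ θ.levi_J _ _ _
  have h2 : (fun y ↦ θ.levi y (C.Jf Y y : Tan m y) (C.J y (Z y) : Tan m y)) =
      fun y ↦ - θ.levi y (Y y : Tan m y) (C.J y (C.Jf Z y) : Tan m y) :=
    funext fun y ↦ θ.levi_J _ _ _
  have h3 : ∀ W : ∀ y, C.H y, (C.Jf W x : Tan m x) = θ.extJ x (W x : Tan m x) := fun W ↦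
    (θ.extJ_coe _).symm
  rw [koszul, koszul, h1, h2, der_neg, der_neg, levi_mixedBracket_J θ hY,
    levi_mixedBracket_J θ hZ, h3 Y, h3 Z]
  ring

lemma koszul_torsion (hX : SmoothNear (C.vf X) x) (hY : SmoothNear (C.vf Y) x)
    (hZ : SmoothNear (C.vf Z) x) : θ.koszul X Y Z x - θ.koszul Y X Z x =
      2 * θ.levi x (bracket (C.vf X) (C.vf Y) x) (Z x : Tan m x)
        - (1 / 2) * θ.levi x (θ.nijenhuis X Y x) (Z x : Tan m x) := by
  have hJX := C.smoothNear_Jf hX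
  have hJY := C.smoothNear_Jf hY
  have hJZ := C.smoothNear_Jf hZ
  have c1 := θ.extD_closed hX hY hJZ
    (a := fun y ↦ θ.levi y (Y y : Tan m y) (Z y : Tan m y))
    (b := fun y ↦ - θ.levi y (X y : Tan m y) (Z y : Tan m y))
    (c := fun y ↦ - θ.levi y (X y : Tan m y) (C.J y (Y y) : Tan m y))
    (fun y ↦ by simp [extD_coe, C.J_sq])
    (fun y ↦ by simp [extD_coe, levi_J_J, θ.levi_symm y (X y : Tan m y)])
    (fun y ↦ by simp [extD_coe])
  have c2 := θ.extD_closed hJX hY hZ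
    (a := fun y ↦ - θ.levi y (Y y : Tan m y) (C.J y (Z y) : Tan m y))
    (b := fun y ↦ θ.levi y (X y : Tan m y) (Z y : Tan m y))
    (c := fun y ↦ - θ.levi y (X y : Tan m y) (Y y : Tan m y))
    (fun y ↦ by simp [extD_coe])
    (fun y ↦ by simp [extD_coe, C.J_sq, θ.levi_symm y (X y : Tan m y)])
    (fun y ↦ by simp [extD_coe, levi_J_J])
  have c3 := θ.extD_closed hX hJY hZ
    (a := fun y ↦ - θ.levi y (Y y : Tan m y) (Z y : Tan m y))
    (b := fun y ↦ θ.levi y (X y : Tan m y) (C.J y (Z y) : Tan m y))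
    (c := fun y ↦ θ.levi y (X y : Tan m y) (Y y : Tan m y))
    (fun y ↦ by simp [extD_coe, levi_J_J])
    (fun y ↦ by rw [extD_coe, levi_J_right])
    (fun y ↦ by simp [extD_coe, C.J_sq])
  have c4 := θ.extD_closed hJX hJY hJZ
    (a := fun y ↦ - θ.levi y (Y y : Tan m y) (C.J y (Z y) : Tan m y))
    (b := fun y ↦ θ.levi y (X y : Tan m y) (C.J y (Z y) : Tan m y))
    (c := fun y ↦ - θ.levi y (X y : Tan m y) (C.J y (Y y) : Tan m y))
    (fun y ↦ by rw [extD_coe, levi_J_J])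
    (fun y ↦ by rw [extD_coe, levi_J_J, levi_J_right])
    (fun y ↦ by rw [extD_coe, levi_J_J])
  have s : ∀ V W : ∀ y : M, Tan m y, bracket V W x = - bracket W V x := fun V W ↦ bracket_swap
  rw [koszul, koszul, mixedBracket, mixedBracket, mixedBracket, mixedBracket, nijenhuis]
  simp only [der_neg, C.J_sq, Submodule.coe_neg, map_neg, s (C.vf Y) (C.vf X),
    s (C.vf (C.Jf Y)) (C.vf X), s (C.vf Y) (C.vf (C.Jf X)), s (C.vf (C.Jf Y)) (C.vf (C.Jf X)),
    s (C.vf Z) (C.vf X), s (C.vf (C.Jf Z)) (C.vf X), s (C.vf Z) (C.vf (C.Jf X)),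
    s (C.vf (C.Jf Z)) (C.vf (C.Jf X)), map_smul, map_add, map_sub, LinearMap.smul_apply,
    LinearMap.add_apply, LinearMap.sub_apply, LinearMap.neg_apply, levi_extJ, extJ_coe,
    smul_eq_mul] at c1 c2 c3 c4 ⊢
  linear_combination (1 / 2) * c1 - (1 / 2) * c2 - (1 / 2) * c3 - (1 / 2) * c4

/-- The section `([T, Y] - J[T, JY]) / 2`, which is `∇_T Y` for the Tanaka-Webster connection. -/
def reebBracket (Y : ∀ y, C.H y) (x : M) : Tan m x :=
  (1 / 2 : ℝ) • (bracket θ.reeb (C.vf Y) x - θ.extJ x (bracket θ.reeb (C.vf (C.Jf Y)) x))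

lemma form_reebBracket (hY : SmoothVFAt (C.vf Y) x) : θ.form x (θ.reebBracket Y x) = 0 := by
  rw [reebBracket, map_smul, map_sub, form_bracket_reeb θ hY, form_extJ]
  simp

lemma reebBracket_J (hY : SmoothVFAt (C.vf Y) x) :
    θ.reebBracket (C.Jf Y) x = θ.extJ x (θ.reebBracket Y x) := by
  rw [reebBracket, reebBracket, bracket_Jf_Jf_right _ hY, map_smul, map_sub, extJ_extJ,
    form_bracket_reeb θ (C.smooth_Jf hY)]
  simp only [map_neg]
  module

lemma reebBracket_skew (hY : SmoothNear (C.vf Y) x) (hZ : SmoothNear (C.vf Z) x) :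
    θ.levi x (θ.reebBracket Y x) (Z x : Tan m x) + θ.levi x (Y x : Tan m x) (θ.reebBracket Z x) =
      der m (fun y ↦ θ.levi y (Y y : Tan m y) (Z y : Tan m y)) x (θ.reeb x) := by
  have h1 := θ.der_extD_reeb hY (C.smoothNear_Jf hZ)
    (a := fun y ↦ θ.levi y (Y y : Tan m y) (Z y : Tan m y)) (fun y ↦ by simp [extD_coe, C.J_sq])
  have h2 := θ.der_extD_reeb (C.smoothNear_Jf hY) hZ
    (a := fun y ↦ - θ.levi y (Y y : Tan m y) (Z y : Tan m y)) (fun y ↦ by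
      simp [extD_coe, levi_J_J])
  rw [der_neg] at h2
  rw [reebBracket, reebBracket]
  simp only [extD_eq, map_smul, map_sub, LinearMap.smul_apply, LinearMap.sub_apply, levi_extJ,
    extJ_coe, C.J_sq, Submodule.coe_neg, map_neg, smul_eq_mul, LinearMap.neg_apply, CRData.Jf]
    at h1 h2 ⊢
  have h3 : ∀ v, θ.levi x (Y x : Tan m x) (θ.extJ x v) = - θ.levi x (C.J x (Y x) : Tan m x) v :=
    fun v ↦ by rw [← extJ_coe θ, levi_extJ, neg_neg]
  simp only [h3] at h1 h2 ⊢
  linear_combination (- 1 / 2) * h1 + (1 / 2) * h2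

end PseudoHermitian

/-! ## Connections and frames -/

section Connections

/-- The flat connection at each point `x` of the preferred trivialization at `x`. -/
def baseDerivative (Y : ∀ x : M, Tan m x) (x : M) : Tan m x →L[ℝ] Tan m x :=
  let e := trivializationAt (CRModel m) (TangentSpace 𝓘(ℝ, CRModel m) : M → Type) x
  ((e.continuousLinearEquivAt ℝ x (FiberBundle.mem_baseSet_trivializationAt' x)).symm :
    CRModel m →L[ℝ] Tan m x).comp (der m (fun y ↦ (e ⟨y, Y y⟩).2) x)

lemma isCovariantDerivativeOn_baseDerivative :
    IsCovariantDerivativeOn (I := 𝓘(ℝ, CRModel m)) (CRModel m)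
      (V := (TangentSpace 𝓘(ℝ, CRModel m) : M → Type)) baseDerivative Set.univ where
  add {σ σ' x} hσ hσ' _ := by
    set e := trivializationAt (CRModel m) (TangentSpace 𝓘(ℝ, CRModel m) : M → Type) x with he
    have hx : x ∈ e.baseSet := FiberBundle.mem_baseSet_trivializationAt' x
    have h1 := (mdifferentiableAt_section _ _).1 hσ
    have h2 := (mdifferentiableAt_section _ _).1 hσ'
    have h3 : der m (fun y ↦ (e ⟨y, (σ + σ') y⟩).2) x =
        der m (fun y ↦ (e ⟨y, σ y⟩).2) x + der m (fun y ↦ (e ⟨y, σ' y⟩).2) x := by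
      rw [← mvfderiv_add h1 h2]
      refine der_congr ?_
      filter_upwards [e.open_baseSet.mem_nhds hx] with y hy
      exact (e.linear ℝ hy).map_add _ _
    change ContinuousLinearMap.comp _ (der m (fun y ↦ (e ⟨y, (σ + σ') y⟩).2) x) = _
    rw [h3, ContinuousLinearMap.comp_add]
    rfl
  leibniz {σ g x} hσ hg _ := by
    set e := trivializationAt (CRModel m) (TangentSpace 𝓘(ℝ, CRModel m) : M → Type) x with he
    have hx : x ∈ e.baseSet := FiberBundle.mem_baseSet_trivializationAt' x
    have h1 := (mdifferentiableAt_section _ _).1 hσ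
    have h3 : der m (fun y ↦ (e ⟨y, (g • σ) y⟩).2) x =
        der m (g • fun y ↦ (e ⟨y, σ y⟩).2) x := by
      refine der_congr ?_
      filter_upwards [e.open_baseSet.mem_nhds hx] with y hy
      exact (e.linear ℝ hy).map_smul _ _
    have h4 : ∀ v, der m (g • fun y ↦ (e ⟨y, σ y⟩).2) x v =
        g x • der m (fun y ↦ (e ⟨y, σ y⟩).2) x v + der m g x v • (e ⟨x, σ x⟩).2 :=
      fun v ↦ congr($(mvfderiv_smul hg h1) v)
    ext1 v
    change (e.continuousLinearEquivAt ℝ x hx).symm (der m (fun y ↦ (e ⟨y, (g • σ) y⟩).2) x v) = _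
    rw [h3, h4, map_add, map_smul, map_smul]
    have h5 : (e.continuousLinearEquivAt ℝ x hx).symm (e ⟨x, σ x⟩).2 = σ x :=
      (e.continuousLinearEquivAt ℝ x hx).symm_apply_apply (σ x)
    rw [h5]
    rfl

instance (x : M) : T2Space (Tan m x) := inferInstanceAs (T2Space (CRModel m))

/-- There are connections with prescribed derivatives of a frame at each point. -/
lemma exists_connection {D : CRData m M} (f : M → CRFrame D) (hf : ∀ x, x ∈ (f x).U)
    (Γ : ∀ x, Option (Fin m ⊕ Fin m) → Tan m x →ₗ[ℝ] Tan m x) :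
    ∃ cov : Connection m M, ∀ x i v, cov.toFun (fun y ↦ (f x).vec y i) x v = Γ x i v := by
  let A : ∀ x : M, Tan m x →L[ℝ] Tan m x →L[ℝ] Tan m x := fun x ↦
    LinearMap.toContinuousLinearMap (((f x).basis (hf x)).constr ℝ fun i ↦
      LinearMap.toContinuousLinearMap (Γ x i) - baseDerivative (fun y ↦ (f x).vec y i) x)
  refine ⟨⟨_, isCovariantDerivativeOn_baseDerivative.add_one_form A⟩, fun x i v ↦ ?_⟩
  have h : A x ((f x).vec x i) =
      LinearMap.toContinuousLinearMap (Γ x i) - baseDerivative (fun y ↦ (f x).vec y i) x := by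
    rw [← (f x).basis_apply (hf x) i]
    exact ((f x).basis (hf x)).constr_basis ℝ _ i
  change baseDerivative (fun y ↦ (f x).vec y i) x v + A x ((f x).vec x i) v = Γ x i v
  rw [h]
  exact add_sub_cancel _ _

variable (cov : Connection m M) {x : M} {X Y : ∀ x : M, Tan m x}

lemma cov_congr (hX : SmoothVFAt X x) (hY : SmoothVFAt Y x) (h : ∀ᶠ y in 𝓝 x, X y = Y y) :
    cov.toFun X x = cov.toFun Y x :=
  cov.isCovariantDerivativeOnUniv.congr_of_eventuallyEq hX.mdiff hY.mdiff Filter.univ_mem h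

lemma cov_add (hX : SmoothVFAt X x) (hY : SmoothVFAt Y x) (v : Tan m x) :
    cov.toFun (X + Y) x v = cov.toFun X x v + cov.toFun Y x v :=
  congr($(cov.isCovariantDerivativeOnUniv.add hX.mdiff hY.mdiff) v)

lemma cov_sum_of_mdiff {ι : Type*} (s : Finset ι) {h : ι → M → ℝ} {X : ι → ∀ x : M, Tan m x}
    (hh : ∀ i, MDifferentiableAt 𝓘(ℝ, CRModel m) 𝓘(ℝ) (h i) x)
    (hX : ∀ i, SmoothVFAt (X i) x) (v : Tan m x) :
    cov.toFun (∑ i ∈ s, h i • X i) x v =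
      ∑ i ∈ s, (h i x • cov.toFun (X i) x v + der m (h i) x v • X i x) := by
  classical
  have hs : ∀ i, MDifferentiableAt 𝓘(ℝ, CRModel m) (𝓘(ℝ, CRModel m).prod 𝓘(ℝ, CRModel m))
      (vfSection (h i • X i)) x := fun i ↦ (hh i).smul_section (hX i).mdiff
  have hsum : ∀ s : Finset ι, MDifferentiableAt 𝓘(ℝ, CRModel m)
      (𝓘(ℝ, CRModel m).prod 𝓘(ℝ, CRModel m)) (vfSection (∑ i ∈ s, h i • X i)) x := by
    intro s
    induction s using Finset.induction_on with
    | empty => exact mdifferentiableAt_zeroSection ..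
    | insert i s hi ih =>
      rw [Finset.sum_insert hi]
      exact mdifferentiableAt_add_section (hs i) ih
  induction s using Finset.induction_on with
  | empty => exact congr($(cov.isCovariantDerivativeOnUniv.zero) v)
  | insert i s hi ih =>
    rw [Finset.sum_insert hi, Finset.sum_insert hi, ← ih]
    refine (congr($(cov.isCovariantDerivativeOnUniv.add (hs i) (hsum s)) v)).trans ?_
    exact congrArg (· + _) congr($(cov.isCovariantDerivativeOnUniv.leibniz (hX i).mdiff (hh i)) v)

/-- The covariant derivative of a vector field in terms of a frame. -/
lemma cov_expand_of_mdiff {D : CRData m M} (f : CRFrame D) (hx : x ∈ f.U)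
    (hY : MDifferentiableAt 𝓘(ℝ, CRModel m) (𝓘(ℝ, CRModel m).prod 𝓘(ℝ, CRModel m))
      (vfSection Y) x)
    (hc : ∀ i, MDifferentiableAt 𝓘(ℝ, CRModel m) 𝓘(ℝ) (fun y ↦ f.coord y (Y y) i) x)
    (v : Tan m x) :
    cov.toFun Y x v = ∑ i, (f.coord x (Y x) i • cov.toFun (fun y ↦ f.vec y i) x v
      + der m (fun y ↦ f.coord y (Y y) i) x v • f.vec x i) := by
  rw [← cov_sum_of_mdiff cov Finset.univ hc (fun i ↦ f.smooth_vec i hx)]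
  have h : ∀ᶠ y in 𝓝 x, (∑ i, (fun y ↦ f.coord y (Y y) i) • fun y ↦ f.vec y i) y = Y y := by
    filter_upwards [f.eventually_mem hx] with y hy
    rw [Finset.sum_apply]
    exact f.sum_coord hy (Y y)
  have h' : MDifferentiableAt 𝓘(ℝ, CRModel m) (𝓘(ℝ, CRModel m).prod 𝓘(ℝ, CRModel m))
      (vfSection (∑ i, (fun y ↦ f.coord y (Y y) i) • fun y ↦ f.vec y i)) x := by
    refine hY.congr_of_eventuallyEq ?_
    filter_upwards [h] with y hy
    simp [vfSection, hy]
  exact congr($(cov.isCovariantDerivativeOnUniv.congr_of_eventuallyEq hY h' Filter.univ_mem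
    (h.mono fun y hy ↦ hy.symm)) v)

lemma cov_expand {D : CRData m M} (f : CRFrame D) (hx : x ∈ f.U) (hY : SmoothVFAt Y x)
    (v : Tan m x) :
    cov.toFun Y x v = ∑ i, (f.coord x (Y x) i • cov.toFun (fun y ↦ f.vec y i) x v
      + der m (fun y ↦ f.coord y (Y y) i) x v • f.vec x i) :=
  cov_expand_of_mdiff cov f hx hY.mdiff (fun i ↦ (f.smoothAt_coord hx hY i).mdiff) v

lemma torsion_eq (hX : SmoothVFAt X x) (hY : SmoothVFAt Y x) :
    cov.torsion x (X x) (Y x) = cov.toFun Y x (X x) - cov.toFun X x (Y x) - bracket X Y x :=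
  cov.torsion_apply hX.mdiff hY.mdiff

end Connections

/-- Function-linear expressions in sections of `H` are determined by their values on a frame. -/
lemma tensorial_expand {D : CRData m M} {V : Type*} [AddCommGroup V] [Module ℝ V] {x : M}
    (Φ : (∀ y, D.H y) → V) (f : CRFrame D) (hx : x ∈ f.U)
    (hadd : ∀ X Y : ∀ y, D.H y, SmoothVFAt (D.vf X) x → SmoothVFAt (D.vf Y) x →
      Φ (X + Y) = Φ X + Φ Y)
    (hsmul : ∀ (h : M → ℝ) (X : ∀ y, D.H y), SmoothAt m h x → SmoothVFAt (D.vf X) x →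
      Φ (h • X) = h x • Φ X) {X : ∀ y, D.H y} (hX : SmoothVFAt (D.vf X) x) :
    Φ X = ∑ i, f.coord x (X x : Tan m x) (some i) • Φ (f.hvec i) := by
  classical
  let c : Fin m ⊕ Fin m → M → ℝ := fun i y ↦ f.coord y (X y : Tan m y) (some i)
  have hc : ∀ i, SmoothAt m (c i) x := fun i ↦ f.smoothAt_coord hx hX (some i)
  have hvf : ∀ s : Finset (Fin m ⊕ Fin m), SmoothVFAt (D.vf (∑ i ∈ s, c i • f.hvec i)) x := by
    intro s
    refine (SmoothVFAt.sum (s := s) fun i _ ↦ (f.smooth_hvec hx i).smul (hc i)).congr ?_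
    refine Filter.Eventually.of_forall fun y ↦ ?_
    rw [CRData.vf, Finset.sum_apply, AddSubmonoidClass.coe_finsetSum]
    rfl
  have h1 : ∀ s : Finset (Fin m ⊕ Fin m),
      Φ (∑ i ∈ s, c i • f.hvec i) = ∑ i ∈ s, c i x • Φ (f.hvec i) := by
    intro s
    induction s using Finset.induction_on with
    | empty =>
      have h0 : SmoothVFAt (D.vf (0 : ∀ y, D.H y)) x := by simpa using hvf ∅
      have := hsmul 0 0 contMDiffAt_const h0
      rw [smul_zero] at this
      simpa using this
    | insert i s hi ih =>
      rw [Finset.sum_insert hi, Finset.sum_insert hi, ← ih, ← hsmul _ _ (hc i) (f.smooth_hvec hx i)]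
      exact hadd _ _ ((f.smooth_hvec hx i).smul (hc i)) (hvf s)
  let ψ : M → ℝ := f.U.indicator 1
  have hψ : SmoothAt m ψ x := by
    refine (contMDiffAt_const (c := (1 : ℝ))).congr_of_eventuallyEq ?_
    filter_upwards [f.eventually_mem hx] with y hy
    simp [ψ, hy]
  have hψx : ψ x = 1 := by simp [ψ, hx]
  have h2 : ψ • X = ψ • ∑ i, c i • f.hvec i := by
    funext y
    by_cases hy : y ∈ f.U
    · have := f.sum_hvec hy (X y)
      simp only [Pi.smul_apply', Finset.sum_apply, c]
      rw [this]
    · simp [ψ, hy]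
  have h3 := hsmul ψ X hψ hX
  rw [h2, hsmul _ _ hψ (hvf _), hψx, one_smul, one_smul, h1] at h3
  exact h3.symm

/-- The frame with the Reeb field as first vector field. -/
def PseudoHermitian.reebFrame {C : CRStructure m M} (θ : PseudoHermitian C)
    (f : CRFrame C.toCRData) : CRFrame C.toCRData where
  U := f.U
  isOpen_U := f.isOpen_U
  N := θ.reeb
  e := f.e
  smooth_N x _ := θ.smooth_reeb x
  smooth_e := f.smooth_e
  smooth_Je := f.smooth_Je
  linearIndependent x hx := by
    have h1 : LinearIndependent ℝ (fun i ↦ (f.hvec i x : Tan m x)) := by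
      have := (f.linearIndependent x hx).comp _ (Option.some_injective _)
      convert this using 1
      ext i
      rcases i with α | α <;> rfl
    have h2 : θ.reeb x ∉ Submodule.span ℝ (Set.range fun i ↦ (f.hvec i x : Tan m x)) := by
      intro h
      have h3 : Submodule.span ℝ (Set.range fun i ↦ (f.hvec i x : Tan m x)) ≤ C.H x := by
        rw [Submodule.span_le]
        rintro _ ⟨i, rfl⟩
        exact (f.hvec i x).2
      have := θ.mem_H.1 (h3 h)
      rw [form_reeb] at this
      exact one_ne_zero this
    have h3 : (fun i ↦ (f.hvec i x : Tan m x)) = (fun i : Option (Fin m ⊕ Fin m) ↦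
        (i.elim (θ.reeb x) (Sum.elim (fun α ↦ (f.e α x : Tan m x))
          (fun α ↦ (C.J x (f.e α x) : Tan m x))) : Tan m x)) ∘ some := by
      funext i
      rcases i with α | α <;> rfl
    rw [h3] at h1 h2
    exact linearIndependent_option.2 ⟨h1, h2⟩

namespace PseudoHermitian

variable {C : CRStructure m M} (θ : PseudoHermitian C) {x : M}

lemma reebFrame_vec_none (f : CRFrame C.toCRData) (y : M) :
    (θ.reebFrame f).vec y none = θ.reeb y := rfl

lemma reebFrame_coord_none (f : CRFrame C.toCRData) (hx : x ∈ f.U) (v : Tan m x) :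
    (θ.reebFrame f).coord x v none = θ.form x v := by
  have h := (θ.reebFrame f).sum_coord hx v
  conv_rhs => rw [← h, Fintype.sum_option, map_add, map_sum, map_smul, reebFrame_vec_none,
    form_reeb]
  rw [Finset.sum_eq_zero]
  · simp
  · intro i _
    rw [map_smul, CRFrame.vec_some, θ.vanish, smul_zero]

lemma reebFrame_sum (f : CRFrame C.toCRData) (hx : x ∈ f.U) (v : Tan m x) :
    v = θ.form x v • θ.reeb x +
      ∑ i, (θ.reebFrame f).coord x v (some i) • ((θ.reebFrame f).hvec i x : Tan m x) := by
  have h := (θ.reebFrame f).sum_coord hx v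
  conv_lhs => rw [← h, Fintype.sum_option, reebFrame_coord_none θ f hx]
  simp only [CRFrame.vec_some]
  rfl

lemma exists_levi_eq (f : CRFrame C.toCRData) (hx : x ∈ f.U) (c : Fin m ⊕ Fin m → ℝ) :
    ∃ u : Tan m x, θ.form x u = 0 ∧ ∀ i, θ.levi x u (f.hvec i x : Tan m x) = c i := by
  let Φ : C.H x →ₗ[ℝ] (Fin m ⊕ Fin m → ℝ) := LinearMap.pi fun i ↦
    (θ.levi x).flip (f.hvec i x : Tan m x) ∘ₗ (C.H x).subtype
  have hΦ : Function.Injective Φ := by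
    rw [injective_iff_map_eq_zero]
    intro v hv
    ext1
    exact θ.eq_zero_of_levi_hvec f hx (θ.vanish x v) fun i ↦ congrFun hv i
  obtain ⟨u, hu⟩ := (LinearMap.injective_iff_surjective_of_finrank_eq_finrank (by
    rw [C.finrank_H]; simp [two_mul])).1 hΦ c
  exact ⟨u, θ.vanish x u, fun i ↦ congrFun hu i⟩

end PseudoHermitian

/-! ## Existence of the Tanaka-Webster connection -/

namespace PseudoHermitian

variable {C : CRStructure m M} (θ : PseudoHermitian C) {x : M} {X Y Z : ∀ y, C.H y}

lemma nijenhuis_add_left (hX : SmoothVFAt (C.vf X) x) (hY : SmoothVFAt (C.vf Y) x) :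
    θ.nijenhuis (X + Y) Z x = θ.nijenhuis X Z x + θ.nijenhuis Y Z x := by
  have h1 : C.vf (X + Y) = C.vf X + C.vf Y := rfl
  have h2 : C.vf (C.Jf (X + Y)) = C.vf (C.Jf X) + C.vf (C.Jf Y) :=
    funext fun y ↦ congrArg Subtype.val ((C.J y).map_add (X y) (Y y))
  have h3 := C.smooth_Jf hX
  have h4 := C.smooth_Jf hY
  simp only [nijenhuis, h1, h2, bracket_add_left hX hY, bracket_add_left h3 h4, map_add]
  abel

lemma nijenhuis_smul_left {h : M → ℝ} (hh : SmoothAt m h x) (hX : SmoothVFAt (C.vf X) x) :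
    θ.nijenhuis (h • X) Z x = h x • θ.nijenhuis X Z x := by
  have h1 : C.vf (h • X) = h • C.vf X := rfl
  have h2 : C.vf (C.Jf (h • X)) = h • C.vf (C.Jf X) :=
    funext fun y ↦ congrArg Subtype.val ((C.J y).map_smul (h y) (X y))
  have h3 := C.smooth_Jf hX
  simp only [nijenhuis, h1, h2, bracket_smul_left hh hX, bracket_smul_left hh h3, map_add, map_smul,
    extJ_coe, C.J_sq, Submodule.coe_neg]
  module

lemma nijenhuis_swap : θ.nijenhuis X Y x = - θ.nijenhuis Y X x := by
  have s : ∀ V W : ∀ y : M, Tan m y, bracket V W x = - bracket W V x := fun V W ↦ bracket_swap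
  rw [nijenhuis, nijenhuis, s (C.vf X) (C.vf Y), s (C.vf (C.Jf X)) (C.vf (C.Jf Y)),
    s (C.vf (C.Jf X)) (C.vf Y), s (C.vf X) (C.vf (C.Jf Y))]
  simp only [map_add, map_neg]
  abel

lemma nijenhuis_expand (f : CRFrame C.toCRData) (hx : x ∈ f.U) (hX : SmoothVFAt (C.vf X) x)
    (hY : SmoothVFAt (C.vf Y) x) :
    θ.nijenhuis X Y x = ∑ i, ∑ j, f.coord x (X x : Tan m x) (some i) •
      f.coord x (Y x : Tan m x) (some j) • θ.nijenhuis (f.hvec i) (f.hvec j) x := by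
  have key : ∀ {X : ∀ y, C.H y} (Z : ∀ y, C.H y), SmoothVFAt (C.vf X) x →
      θ.nijenhuis X Z x = ∑ i, f.coord x (X x : Tan m x) (some i) • θ.nijenhuis (f.hvec i) Z x :=
    fun Z hX ↦ tensorial_expand (fun X ↦ θ.nijenhuis X Z x) f hx
      (fun _ _ h h' ↦ θ.nijenhuis_add_left h h') (fun _ _ h h' ↦ θ.nijenhuis_smul_left h h') hX
  rw [key Y hX]
  refine Finset.sum_congr rfl fun i _ ↦ ?_
  rw [nijenhuis_swap, key _ hY, ← Finset.smul_sum, ← Finset.sum_neg_distrib]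
  refine congrArg _ (Finset.sum_congr rfl fun j _ ↦ ?_)
  rw [← smul_neg, ← nijenhuis_swap]

lemma form_nijenhuis (hX : SmoothVFAt (C.vf X) x) (hY : SmoothVFAt (C.vf Y) x) :
    θ.form x (θ.nijenhuis X Y x) = 0 := by
  rw [nijenhuis, map_add, form_extJ, add_zero]
  exact θ.mem_H.1 (C.partiallyIntegrable X Y x hX hY)

lemma levi_sum {ι : Type*} (s : Finset ι) (u w : ι → Tan m x) :
    θ.levi x (∑ i ∈ s, u i) (∑ j ∈ s, w j) = ∑ i ∈ s, ∑ j ∈ s, θ.levi x (u i) (w j) := by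
  rw [LinearMap.map_sum₂]
  exact Finset.sum_congr rfl fun i _ ↦ map_sum _ _ _

lemma torsion_vf (D : Connection m M) (hX : SmoothVFAt (C.vf X) x) (hY : SmoothVFAt (C.vf Y) x) :
    D.torsion x (X x : Tan m x) (Y x : Tan m x) = D.toFun (C.vf Y) x (X x : Tan m x)
      - D.toFun (C.vf X) x (Y x : Tan m x) - bracket (C.vf X) (C.vf Y) x :=
  torsion_eq (X := C.vf X) (Y := C.vf Y) D hX hY

lemma torsion_reeb_vf (D : Connection m M) (hX : SmoothVFAt (C.vf X) x) :
    D.torsion x (θ.reeb x) (X x : Tan m x) = D.toFun (C.vf X) x (θ.reeb x)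
      - D.toFun θ.reeb x (X x : Tan m x) - bracket θ.reeb (C.vf X) x :=
  torsion_eq (X := θ.reeb) (Y := C.vf X) D (θ.smooth_reeb x) hX

/-- The characterization of the Tanaka-Webster connection at a point in terms of a frame. -/
structure IsKoszulAt (D : Connection m M) (f : CRFrame C.toCRData) (x : M) : Prop where
  mem : x ∈ f.U
  reeb : ∀ v, D.toFun θ.reeb x v = 0
  form_hvec : ∀ j v, θ.form x (D.toFun (C.vf (f.hvec j)) x v) = 0
  along_reeb : ∀ j, D.toFun (C.vf (f.hvec j)) x (θ.reeb x) = θ.reebBracket (f.hvec j) x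
  along_hvec : ∀ k j i, 2 * θ.levi x (D.toFun (C.vf (f.hvec j)) x (f.hvec k x : Tan m x))
    (f.hvec i x : Tan m x) = θ.koszul (f.hvec k) (f.hvec j) (f.hvec i) x

lemma exists_isKoszulAt : ∃ D : Connection m M, ∀ x, θ.IsKoszulAt D (C.frameAt x) x := by
  classical
  let F : M → CRFrame C.toCRData := fun x ↦ θ.reebFrame (C.frameAt x)
  have hF : ∀ x, x ∈ (F x).U := C.mem_frameAt
  choose K hK0 hK using fun (x : M) (k j : Fin m ⊕ Fin m) ↦ θ.exists_levi_eq (F x) (hF x)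
    fun i ↦ θ.koszul ((F x).hvec k) ((F x).hvec j) ((F x).hvec i) x / 2
  let Γ : ∀ x, Option (Fin m ⊕ Fin m) → Tan m x →ₗ[ℝ] Tan m x := fun x i ↦
    i.elim 0 fun j ↦ (θ.form x).toLinearMap.smulRight (θ.reebBracket ((F x).hvec j) x) +
      ∑ k, (LinearMap.proj (some k) ∘ₗ (F x).coord x).smulRight (K x k j)
  obtain ⟨D, hD⟩ := exists_connection F hF Γ
  have h : ∀ x j v, D.toFun (C.vf ((F x).hvec j)) x v = θ.form x v •
      θ.reebBracket ((F x).hvec j) x + ∑ k, (F x).coord x v (some k) • K x k j := by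
    intro x j v
    have h1 := hD x (some j) v
    simp only [CRFrame.vec_some] at h1
    refine h1.trans ?_
    simp [Γ]
  refine ⟨D, fun x ↦ ⟨C.mem_frameAt x, fun v ↦ hD x none v, fun j v ↦ ?_, fun j ↦ ?_,
    fun k j i ↦ ?_⟩⟩
  · refine (congrArg (θ.form x) (h x j v)).trans ?_
    rw [map_add, map_smul, map_sum, form_reebBracket θ ((F x).smooth_hvec (hF x) j)]
    simp [hK0]
  · refine (h x j (θ.reeb x)).trans ?_
    have h2 : (F x).coord x (θ.reeb x) = _ := (F x).coord_vec (hF x) none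
    rw [form_reeb, one_smul, h2, Finset.sum_eq_zero, add_zero]
    · rfl
    · intro k _
      simp
  · have h2 := h x j ((F x).hvec k x : Tan m x)
    simp only [θ.vanish, zero_smul, zero_add, (F x).coord_hvec (hF x), ite_smul, one_smul,
      Finset.sum_ite_eq', Finset.mem_univ, if_true] at h2
    refine (congrArg (fun u ↦ 2 * θ.levi x u ((F x).hvec i x : Tan m x)) h2).trans ?_
    rw [hK]
    change 2 * (θ.koszul ((F x).hvec k) ((F x).hvec j) ((F x).hvec i) x / 2) =
      θ.koszul ((F x).hvec k) ((F x).hvec j) ((F x).hvec i) x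
    ring

namespace IsKoszulAt

variable {θ} {D : Connection m M} {f : CRFrame C.toCRData} (h : θ.IsKoszulAt D f x)

include h

lemma form_parallel {Y : ∀ y : M, Tan m y} (hY : SmoothVFAt Y x) (v : Tan m x) :
    der m (fun y ↦ θ.form y (Y y)) x v = θ.form x (D.toFun Y x v) := by
  have hx : x ∈ (θ.reebFrame f).U := h.mem
  have h1 : der m (fun y ↦ θ.form y (Y y)) x =
      der m (fun y ↦ (θ.reebFrame f).coord y (Y y) none) x := by
    refine der_congr ?_
    filter_upwards [f.eventually_mem h.mem] with y hy
    rw [reebFrame_coord_none θ f hy]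
  have h2 : ∀ i, θ.form x (D.toFun (C.vf ((θ.reebFrame f).hvec i)) x v) = 0 := fun i ↦
    h.form_hvec i v
  rw [cov_expand D (θ.reebFrame f) hx hY, Fintype.sum_option, map_add, map_sum, h1,
    Finset.sum_eq_zero]
  · simp only [CRFrame.vec, Option.elim_none]
    change _ = θ.form x ((θ.reebFrame f).coord x (Y x) none • D.toFun θ.reeb x v + _ • θ.reeb x) + 0
    rw [h.reeb, smul_zero, zero_add, map_smul, form_reeb]
    simp
  · intro i _
    simp only [CRFrame.vec_some, map_add, map_smul, θ.vanish, smul_zero, add_zero]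
    rw [h2 i, smul_zero]

lemma levi_hvec (i j : Fin m ⊕ Fin m) (v : Tan m x) :
    der m (fun y ↦ θ.levi y (f.hvec i y : Tan m y) (f.hvec j y : Tan m y)) x v =
      θ.levi x (D.toFun (C.vf (f.hvec i)) x v) (f.hvec j x : Tan m x) +
      θ.levi x (f.hvec i x : Tan m x) (D.toFun (C.vf (f.hvec j)) x v) := by
  have h1 : ∀ k, der m (fun y ↦ θ.levi y (f.hvec i y : Tan m y) (f.hvec j y : Tan m y)) x
      (f.hvec k x : Tan m x) =
      θ.levi x (D.toFun (C.vf (f.hvec i)) x (f.hvec k x : Tan m x)) (f.hvec j x : Tan m x) +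
      θ.levi x (f.hvec i x : Tan m x) (D.toFun (C.vf (f.hvec j)) x (f.hvec k x : Tan m x)) := by
    intro k
    have h2 := θ.koszul_skew (f.hvec k) (f.hvec i) (f.hvec j) x
    rw [← h.along_hvec, ← h.along_hvec,
      θ.levi_symm x (D.toFun (C.vf (f.hvec j)) x (f.hvec k x : Tan m x))] at h2
    linarith
  have h2 := θ.reebBracket_skew (f.smoothNear_hvec h.mem i) (f.smoothNear_hvec h.mem j)
  rw [← h.along_reeb, ← h.along_reeb] at h2
  conv_lhs => rw [θ.reebFrame_sum f h.mem v]
  conv_rhs => rw [θ.reebFrame_sum f h.mem v]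
  simp only [map_add, map_sum, map_smul, LinearMap.add_apply, LinearMap.sum_apply,
    LinearMap.smul_apply, smul_eq_mul]
  rw [← h2, mul_add, add_add_add_comm, ← Finset.sum_add_distrib]
  refine congrArg _ (Finset.sum_congr rfl fun k _ ↦ ?_)
  rw [← mul_add]
  exact congrArg _ (h1 k)

lemma levi_vec (i j : Option (Fin m ⊕ Fin m)) (v : Tan m x) :
    der m (fun y ↦ θ.levi y ((θ.reebFrame f).vec y i) ((θ.reebFrame f).vec y j)) x v =
      θ.levi x (D.toFun (fun y ↦ (θ.reebFrame f).vec y i) x v) ((θ.reebFrame f).vec x j) +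
      θ.levi x ((θ.reebFrame f).vec x i) (D.toFun (fun y ↦ (θ.reebFrame f).vec y j) x v) := by
  rcases i with _ | i <;> rcases j with _ | j
  · simp only [reebFrame_vec_none, levi_reeb, levi_reeb_right, add_zero]
    exact der_const 0 v
  · simp only [reebFrame_vec_none, levi_reeb]
    change _ = θ.levi x (D.toFun θ.reeb x v) _ + _
    rw [h.reeb, map_zero, LinearMap.zero_apply, add_zero]
    exact der_const 0 v
  · simp only [reebFrame_vec_none, levi_reeb_right]
    change _ = 0 + θ.levi x _ (D.toFun θ.reeb x v)
    rw [h.reeb, map_zero, add_zero]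
    exact der_const 0 v
  · simp only [CRFrame.vec_some]
    exact h.levi_hvec i j v

lemma levi_parallel {Y Z : ∀ y : M, Tan m y} (hY : SmoothVFAt Y x) (hZ : SmoothVFAt Z x)
    (v : Tan m x) : der m (fun y ↦ θ.levi y (Y y) (Z y)) x v =
      θ.levi x (D.toFun Y x v) (Z x) + θ.levi x (Y x) (D.toFun Z x v) := by
  let F := θ.reebFrame f
  have hx : x ∈ F.U := h.mem
  have hc := F.smoothAt_coord hx hY
  have hd := F.smoothAt_coord hx hZ
  have hg : ∀ i j, SmoothAt m (fun y ↦ θ.levi y (F.vec y i) (F.vec y j)) x := fun i j ↦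
    θ.smooth_levi (F.smooth_vec i hx) (F.smooth_vec j hx)
  have h1 : der m (fun y ↦ θ.levi y (Y y) (Z y)) x = der m (fun y ↦ ∑ i, ∑ j,
      (F.coord y (Y y) i * F.coord y (Z y) j) * θ.levi y (F.vec y i) (F.vec y j)) x := by
    refine der_congr ?_
    filter_upwards [F.eventually_mem hx] with y hy
    conv_lhs => rw [← F.sum_coord hy (Y y), ← F.sum_coord hy (Z y), levi_sum]
    simp only [map_smul, LinearMap.smul_apply, smul_eq_mul]
    exact Finset.sum_congr rfl fun i _ ↦ Finset.sum_congr rfl fun j _ ↦ by ring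
  rw [h1, der_sum fun i _ ↦ SmoothAt.sum fun j _ ↦ ((hc i).mul (hd j)).mul (hg i j),
    cov_expand D F hx hY, cov_expand D F hx hZ]
  conv_rhs => rw [← F.sum_coord hx (Y x), ← F.sum_coord hx (Z x), levi_sum, levi_sum,
    F.sum_coord hx (Y x), F.sum_coord hx (Z x), ← Finset.sum_add_distrib]
  refine Finset.sum_congr rfl fun i _ ↦ ?_
  rw [der_sum fun j _ ↦ ((hc i).mul (hd j)).mul (hg i j), ← Finset.sum_add_distrib]
  refine Finset.sum_congr rfl fun j _ ↦ ?_
  rw [der_mul ((hc i).mul (hd j)) (hg i j), der_mul (hc i) (hd j), h.levi_vec i j]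
  simp only [map_add, map_smul, LinearMap.add_apply, LinearMap.smul_apply, smul_eq_mul, F]
  ring

lemma torsion_hvec (i j : Fin m ⊕ Fin m) :
    D.torsion x (f.hvec i x : Tan m x) (f.hvec j x : Tan m x) =
      θ.levi x (C.J x (f.hvec i x) : Tan m x) (f.hvec j x : Tan m x) • θ.reeb x
        - (1 / 4 : ℝ) • θ.nijenhuis (f.hvec i) (f.hvec j) x := by
  have hi := f.smoothNear_hvec h.mem i
  have hj := f.smoothNear_hvec h.mem j
  have h1 := torsion_vf D hi.self hj.self
  have h2 := θ.extD_eq_bracket hi.self hj.self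
  rw [extD_eq, extJ_coe] at h2
  rw [h1, ← sub_eq_zero]
  refine θ.eq_zero_of_levi_hvec f h.mem ?_ fun k ↦ ?_
  · simp only [map_sub, map_smul, form_reeb, form_nijenhuis θ hi.self hj.self]
    rw [h.form_hvec, h.form_hvec, h2]
    simp
  · have h3 := θ.koszul_torsion hi hj (f.smoothNear_hvec h.mem k)
    rw [← h.along_hvec, ← h.along_hvec] at h3
    simp only [map_sub, map_smul, LinearMap.sub_apply, LinearMap.smul_apply, levi_reeb, smul_eq_mul]
    linarith

lemma torsion_H (hX : SmoothVFAt (C.vf X) x) (hY : SmoothVFAt (C.vf Y) x) :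
    D.torsion x (X x : Tan m x) (Y x : Tan m x) =
      θ.levi x (C.J x (X x) : Tan m x) (Y x : Tan m x) • θ.reeb x
        - (1 / 4 : ℝ) • θ.nijenhuis X Y x := by
  rw [θ.nijenhuis_expand f h.mem hX hY]
  have hs : ∀ v : C.H x, (v : Tan m x) = ∑ i, f.coord x (v : Tan m x) (some i) •
      (f.hvec i x : Tan m x) := fun v ↦ by
    conv_lhs => rw [← f.sum_hvec h.mem v, AddSubmonoidClass.coe_finsetSum]
    rfl
  have hl : θ.levi x (C.J x (X x) : Tan m x) (Y x : Tan m x) =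
      ∑ i, ∑ j, f.coord x (X x : Tan m x) (some i) * (f.coord x (Y x : Tan m x) (some j) *
        θ.levi x (C.J x (f.hvec i x) : Tan m x) (f.hvec j x : Tan m x)) := by
    rw [← extJ_coe θ]
    conv_lhs => rw [hs (X x), hs (Y x), map_sum (θ.extJ x), levi_sum]
    simp only [map_smul, LinearMap.smul_apply, smul_eq_mul, extJ_coe]
    exact Finset.sum_congr rfl fun i _ ↦ Finset.sum_congr rfl fun j _ ↦ by ring
  have ht : D.torsion x (X x : Tan m x) (Y x : Tan m x) =
      ∑ i, ∑ j, f.coord x (X x : Tan m x) (some i) • f.coord x (Y x : Tan m x) (some j) •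
        D.torsion x (f.hvec i x : Tan m x) (f.hvec j x : Tan m x) := by
    let B : Tan m x →ₗ[ℝ] Tan m x →ₗ[ℝ] Tan m x :=
      ContinuousLinearMap.coeLM ℝ ∘ₗ (D.torsion x).toLinearMap
    change B (X x : Tan m x) (Y x : Tan m x) = ∑ i, ∑ j, f.coord x (X x : Tan m x) (some i) •
      f.coord x (Y x : Tan m x) (some j) • B (f.hvec i x : Tan m x) (f.hvec j x : Tan m x)
    conv_lhs => rw [hs (X x), hs (Y x), LinearMap.map_sum₂]
    simp only [map_sum, map_smul, LinearMap.smul_apply]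
    exact Finset.sum_congr rfl fun i _ ↦ Finset.sum_congr rfl fun j _ ↦ smul_comm _ _ _
  rw [hl, ht, Finset.sum_smul, Finset.smul_sum, ← Finset.sum_sub_distrib]
  refine Finset.sum_congr rfl fun i _ ↦ ?_
  rw [Finset.sum_smul, Finset.smul_sum, ← Finset.sum_sub_distrib]
  refine Finset.sum_congr rfl fun j _ ↦ ?_
  rw [h.torsion_hvec]
  module

lemma torsion_reeb (hX : SmoothVFAt (C.vf X) x) :
    D.torsion x (θ.reeb x) (X x : Tan m x) =
      - (1 / 2 : ℝ) • (bracket θ.reeb (C.vf X) x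
        + θ.extJ x (bracket θ.reeb (C.vf (C.Jf X)) x)) := by
  let Φ : (∀ y, C.H y) → Tan m x := fun X ↦ bracket θ.reeb (C.vf X) x
        + θ.extJ x (bracket θ.reeb (C.vf (C.Jf X)) x)
  have hΦ : Φ X = ∑ i, f.coord x (X x : Tan m x) (some i) • Φ (f.hvec i) := by
    refine tensorial_expand Φ f h.mem (fun X Y hX hY ↦ ?_) (fun g X hg hX ↦ ?_) hX
    · have h1 : C.vf (X + Y) = C.vf X + C.vf Y := rfl
      have h2 : C.vf (C.Jf (X + Y)) = C.vf (C.Jf X) + C.vf (C.Jf Y) :=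
        funext fun y ↦ congrArg Subtype.val ((C.J y).map_add (X y) (Y y))
      simp only [Φ, h1, h2, bracket_add_right hX hY,
        bracket_add_right (C.smooth_Jf hX) (C.smooth_Jf hY), map_add]
      abel
    · have h1 : C.vf (g • X) = g • C.vf X := rfl
      have h2 : C.vf (C.Jf (g • X)) = g • C.vf (C.Jf X) :=
        funext fun y ↦ congrArg Subtype.val ((C.J y).map_smul (g y) (X y))
      simp only [Φ, h1, h2, bracket_smul_right hg hX, bracket_smul_right hg (C.smooth_Jf hX),
        map_add, map_smul, extJ_coe, C.J_sq, Submodule.coe_neg]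
      module
  change _ = - (1 / 2 : ℝ) • Φ X
  rw [hΦ]
  conv_lhs => rw [← f.sum_hvec h.mem (X x), AddSubmonoidClass.coe_finsetSum]
  rw [map_sum, Finset.smul_sum]
  refine Finset.sum_congr rfl fun i _ ↦ ?_
  have h1 := θ.torsion_reeb_vf D (f.smooth_hvec h.mem i)
  rw [h.reeb, h.along_reeb, reebBracket] at h1
  rw [Submodule.coe_smul, map_smul, h1]
  simp only [Φ]
  module

end IsKoszulAt

theorem exists_isTanakaWebster : ∃ D : Connection m M, θ.IsTanakaWebster D := by
  obtain ⟨D, hD⟩ := θ.exists_isKoszulAt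
  exact ⟨D, ⟨fun _ x hY v ↦ (hD x).form_parallel hY v,
    fun _ _ x hY hZ v ↦ (hD x).levi_parallel hY hZ v,
    fun _ _ x hX _ hY _ ↦ (hD x).torsion_H hX hY, fun _ x hX _ ↦ (hD x).torsion_reeb hX⟩⟩

end PseudoHermitian

/-! ## Properties of the Tanaka-Webster connection -/

namespace PseudoHermitian

variable {C : CRStructure m M} (θ : PseudoHermitian C) {x : M} {X Y Z : ∀ y, C.H y}

/-- The Tanaka-Webster connection. -/
def webster : Connection m M := θ.exists_isTanakaWebster.choose

lemma isTanakaWebster : θ.IsTanakaWebster θ.webster := θ.exists_isTanakaWebster.choose_spec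

lemma tanakaWebster_eq (Y : ∀ y : M, Tan m y) (x : M) :
    θ.tanakaWebster Y x = θ.webster.toFun Y x := dif_pos θ.exists_isTanakaWebster

lemma form_webster (hY : SmoothVFAt (C.vf Y) x) (v : Tan m x) :
    θ.form x (θ.webster.toFun (C.vf Y) x v) = 0 := by
  rw [← θ.isTanakaWebster.form_parallel _ x hY v]
  exact der_eq_zero 0 (Filter.Eventually.of_forall fun y ↦ θ.vanish y (Y y)) v

lemma levi_webster {Y Z : ∀ y : M, Tan m y} (hY : SmoothVFAt Y x) (hZ : SmoothVFAt Z x)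
    (v : Tan m x) : der m (fun y ↦ θ.levi y (Y y) (Z y)) x v =
      θ.levi x (θ.webster.toFun Y x v) (Z x) + θ.levi x (Y x) (θ.webster.toFun Z x v) :=
  θ.isTanakaWebster.levi_parallel Y Z x hY hZ v

lemma webster_reeb (v : Tan m x) : θ.webster.toFun θ.reeb x v = 0 := by
  have hT := θ.smooth_reeb x
  refine θ.eq_zero_of_levi ?_ fun u ↦ ?_
  · rw [← θ.isTanakaWebster.form_parallel _ x hT v]
    exact der_eq_zero 1 (Filter.Eventually.of_forall fun y ↦ θ.form_reeb y) v
  · obtain ⟨X, rfl, hX⟩ := C.exists_extend u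
    have h := θ.levi_webster hT hX.self v
    rw [levi_reeb, add_zero] at h
    refine h.symm.trans (der_eq_zero 0 (Filter.Eventually.of_forall fun y ↦ θ.levi_reeb _) v)

lemma webster_torsion (hX : SmoothVFAt (C.vf X) x) (hY : SmoothVFAt (C.vf Y) x) :
    θ.webster.toFun (C.vf Y) x (X x : Tan m x) - θ.webster.toFun (C.vf X) x (Y x : Tan m x) =
      bracket (C.vf X) (C.vf Y) x + θ.levi x (C.J x (X x) : Tan m x) (Y x : Tan m x) • θ.reeb x
        - (1 / 4 : ℝ) • θ.nijenhuis X Y x := by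
  have h1 := torsion_vf θ.webster hX hY
  rw [θ.isTanakaWebster.torsion_H X Y x hX (C.smooth_Jf hX) hY (C.smooth_Jf hY)] at h1
  rw [add_sub_assoc, h1]
  abel

lemma webster_along_reeb (hY : SmoothVFAt (C.vf Y) x) :
    θ.webster.toFun (C.vf Y) x (θ.reeb x) = θ.reebBracket Y x := by
  have h1 := θ.torsion_reeb_vf θ.webster hY
  rw [θ.isTanakaWebster.torsion_reeb Y x hY (C.smooth_Jf hY), webster_reeb, sub_zero,
    eq_sub_iff_add_eq] at h1
  rw [← h1, reebBracket]
  module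

/-- The Koszul formula for the Tanaka-Webster connection. -/
lemma two_mul_levi_webster (hX : SmoothNear (C.vf X) x) (hY : SmoothNear (C.vf Y) x)
    (hZ : SmoothNear (C.vf Z) x) :
    2 * θ.levi x (θ.webster.toFun (C.vf Y) x (X x : Tan m x)) (Z x : Tan m x) =
      θ.koszul X Y Z x := by
  let s : (∀ y, C.H y) → (∀ y, C.H y) → (∀ y, C.H y) → ℝ := fun X Y Z ↦
    2 * θ.levi x (θ.webster.toFun (C.vf Y) x (X x : Tan m x)) (Z x : Tan m x) - θ.koszul X Y Z x
  have hsymm : ∀ {X Y Z : ∀ y, C.H y}, SmoothNear (C.vf X) x → SmoothNear (C.vf Y) x →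
      SmoothNear (C.vf Z) x → s X Y Z = s Y X Z := by
    intro X Y Z hX hY hZ
    have h1 := congrArg (fun u ↦ θ.levi x u (Z x : Tan m x)) (θ.webster_torsion hX.self hY.self)
    have h2 := θ.koszul_torsion hX hY hZ
    simp only [map_sub, map_add, map_smul, LinearMap.sub_apply, LinearMap.add_apply,
      LinearMap.smul_apply, levi_reeb, smul_eq_mul] at h1
    simp only [s]
    linarith
  have hskew : ∀ {X Y Z : ∀ y, C.H y}, SmoothNear (C.vf X) x → SmoothNear (C.vf Y) x →
      SmoothNear (C.vf Z) x → s X Y Z = - s X Z Y := by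
    intro X Y Z hX hY hZ
    have h1 := θ.levi_webster hY.self hZ.self (X x : Tan m x)
    have h2 := θ.koszul_skew X Y Z x
    rw [θ.levi_symm x (C.vf Y x)] at h1
    simp only [s]
    linarith
  have h1 := hskew hX hY hZ
  have h2 := hsymm hX hZ hY
  have h3 := hskew hZ hX hY
  have h4 := hsymm hZ hY hX
  have h5 := hskew hY hZ hX
  have h6 := hsymm hX hY hZ
  have h7 : s X Y Z = 0 := by linarith
  exact sub_eq_zero.1 h7

lemma webster_J (hY : SmoothNear (C.vf Y) x) (v : Tan m x) :
    θ.webster.toFun (C.vf (C.Jf Y)) x v = θ.extJ x (θ.webster.toFun (C.vf Y) x v) := by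
  have h1 : ∀ u : C.H x, θ.webster.toFun (C.vf (C.Jf Y)) x (u : Tan m x) =
      θ.extJ x (θ.webster.toFun (C.vf Y) x (u : Tan m x)) := by
    intro u
    obtain ⟨X, rfl, hX⟩ := C.exists_extend u
    rw [← sub_eq_zero]
    refine θ.eq_zero_of_levi ?_ fun w ↦ ?_
    · rw [map_sub, form_extJ, form_webster θ (C.smooth_Jf hY.self), sub_zero]
    · obtain ⟨Z, rfl, hZ⟩ := C.exists_extend w
      have h2 := θ.two_mul_levi_webster hX (C.smoothNear_Jf hY) hZ
      have h3 := θ.two_mul_levi_webster hX hY (C.smoothNear_Jf hZ)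
      rw [θ.koszul_J hY.self hZ.self] at h2
      rw [map_sub, LinearMap.sub_apply, levi_extJ, extJ_coe]
      linarith
  have h2 : v = (θ.projH x v : Tan m x) + θ.form x v • θ.reeb x := by rw [projH_apply]; abel
  rw [h2, map_add, map_smul, map_add, map_smul, map_add, map_smul, h1,
    webster_along_reeb θ (C.smooth_Jf hY.self), webster_along_reeb θ hY.self,
    reebBracket_J θ hY.self]

lemma smooth_mixedBracket (hX : SmoothVFAt (C.vf X) x) (hY : SmoothVFAt (C.vf Y) x) :
    SmoothVFAt (θ.mixedBracket X Y) x :=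
  (((hX.bracket hY).add ((C.smooth_Jf hX).bracket (C.smooth_Jf hY))).add
    (θ.smooth_extJ (((C.smooth_Jf hX).bracket hY).sub
      (hX.bracket (C.smooth_Jf hY))))).const_smul (1 / 2)

lemma smooth_reebBracket (hY : SmoothVFAt (C.vf Y) x) : SmoothVFAt (θ.reebBracket Y) x :=
  (((θ.smooth_reeb x).bracket hY).sub
    (θ.smooth_extJ ((θ.smooth_reeb x).bracket (C.smooth_Jf hY)))).const_smul (1 / 2)

lemma smooth_koszul (hX : SmoothVFAt (C.vf X) x) (hY : SmoothVFAt (C.vf Y) x)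
    (hZ : SmoothVFAt (C.vf Z) x) : SmoothAt m (θ.koszul X Y Z) x := by
  have h1 := θ.smooth_levi (θ.smooth_mixedBracket hX hY) hZ
  have h2 := θ.smooth_levi (θ.smooth_mixedBracket hX hZ) hY
  have h3 := (C.frameAt x).smooth_der_real (C.mem_frameAt x) (θ.smooth_levi hY hZ) hX
  have h4 := (C.frameAt x).smooth_der_real (C.mem_frameAt x)
    (θ.smooth_levi hY (C.smooth_Jf hZ)) (C.smooth_Jf hX)
  exact ((h1.add h3).add h4).sub h2

lemma smooth_webster_H (hX : SmoothNear (C.vf X) x) (hY : SmoothNear (C.vf Y) x) :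
    SmoothVFAt (fun y ↦ θ.webster.toFun (C.vf Y) y (X y : Tan m y)) x := by
  set f := C.frameAt x
  have hx : x ∈ f.U := C.mem_frameAt x
  have h1 : SmoothVFAt (C.vf fun y ↦ θ.projH y (θ.webster.toFun (C.vf Y) y (X y : Tan m y))) x := by
    refine θ.smooth_of_levi f hx fun i ↦ ?_
    have h2 := (θ.smooth_koszul hX.self hY.self (f.smooth_hvec hx i)).mul
      (contMDiffAt_const (c := (1 / 2 : ℝ)))
    refine h2.congr_of_eventuallyEq ?_
    filter_upwards [hX.nhds, hY.nhds, f.eventually_mem hx] with y h1 h2 h3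
    rw [← θ.two_mul_levi_webster h1 h2 (f.smoothNear_hvec h3 i), levi_projH]
    ring
  refine h1.congr ?_
  filter_upwards [hY] with y h2
  rw [CRData.vf, projH_apply, form_webster θ h2, zero_smul, sub_zero]

lemma smooth_webster {X : ∀ y : M, Tan m y} (hX : SmoothVFAt X x) (hY : SmoothNear (C.vf Y) x) :
    SmoothVFAt (fun y ↦ θ.webster.toFun (C.vf Y) y (X y)) x := by
  set f := θ.reebFrame (C.frameAt x) with hf
  have hx : x ∈ f.U := C.mem_frameAt x
  have h1 := SmoothVFAt.sum (s := Finset.univ) fun i _ ↦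
    (θ.smooth_webster_H (f.smoothNear_hvec hx i) hY).smul (f.smoothAt_coord hx hX (some i))
  have h2 := (θ.smooth_reebBracket hY.self).smul (θ.smooth.apply hX)
  refine (h2.add h1).congr ?_
  filter_upwards [hY, f.eventually_mem hx] with y h3 h4
  have h5 := congrArg (θ.webster.toFun (C.vf Y) y) (θ.reebFrame_sum (C.frameAt x) h4 (X y))
  refine h5.trans ?_
  rw [map_add, map_smul, map_sum, webster_along_reeb θ h3]
  simp only [map_smul]
  rfl

end PseudoHermitian

/-! ## Traces -/

lemma trace_eq_sum {V ι : Type*} [AddCommGroup V] [Module ℝ V] [Module.Finite ℝ V] [Fintype ι]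
    [DecidableEq ι] (b : ι → V) (c : ι → V →ₗ[ℝ] ℝ) (hbc : ∀ i j, c i (b j) = if i = j then 1 else 0)
    (hcard : Fintype.card ι = Module.finrank ℝ V) (T : V →ₗ[ℝ] V) :
    LinearMap.trace ℝ V T = ∑ i, c i (T (b i)) := by
  have hli : LinearIndependent ℝ b := by
    rw [Fintype.linearIndependent_iff]
    intro g hg i
    have := congrArg (c i) hg
    simpa [hbc] using this
  let B : Module.Basis ι ℝ V := basisOfLinearIndependentOfCardEqFinrank' b hli hcard
  have hB : ∀ i, B i = b i := fun i ↦ by simp [B]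
  have hc : ∀ i v, B.repr v i = c i v := by
    intro i v
    have : B.coord i = c i := B.ext fun j ↦ by
      rw [hB, hbc, ← hB j, Module.Basis.coord_apply, Module.Basis.repr_self, Finsupp.single_apply]
      simp [eq_comm]
    exact congr($this v)
  rw [LinearMap.trace_eq_matrix_trace ℝ B, Matrix.trace]
  refine Finset.sum_congr rfl fun i _ ↦ ?_
  rw [Matrix.diag_apply, LinearMap.toMatrix_apply, hc, hB]

namespace PseudoHermitian

variable {C : CRStructure m M} (θ : PseudoHermitian C) {x : M}

/-- The vectors `ε_1, …, ε_m` form a unitary basis of `H` at `x`. -/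
def IsUnitary (x : M) (ε : Fin m → C.H x) : Prop := ∀ α β,
  θ.levi x (ε α : Tan m x) (ε β : Tan m x) = (if α = β then 1 else 0) ∧
    θ.levi x (ε α : Tan m x) (C.J x (ε β) : Tan m x) = 0

lemma isUnitary_onb (x : M) : θ.IsUnitary x (θ.onb x) := (θ.exists_orthonormal x).choose_spec

variable {θ} {ε ε' : Fin m → C.H x}

lemma IsUnitary.trace_eq (hε : θ.IsUnitary x ε) (T : C.H x →ₗ[ℝ] C.H x) :
    LinearMap.trace ℝ (C.H x) T = ∑ α, (θ.levi x (T (ε α) : Tan m x) (ε α : Tan m x)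
      + θ.levi x (T (C.J x (ε α)) : Tan m x) (C.J x (ε α) : Tan m x)) := by
  let b : Fin m ⊕ Fin m → C.H x := Sum.elim ε fun α ↦ C.J x (ε α)
  have h := trace_eq_sum b (fun i ↦ (θ.levi x).flip (b i : Tan m x) ∘ₗ (C.H x).subtype) ?_ ?_ T
  · rw [h, Fintype.sum_sum_type, ← Finset.sum_add_distrib]
    rfl
  · rintro (α | α) (β | β)
    · simpa [b, eq_comm] using (hε β α).1
    · simpa [b, levi_J] using (hε β α).2
    · simpa [b] using (hε β α).2
    · simpa [b, levi_J_J, eq_comm] using (hε β α).1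
  · rw [C.finrank_H]; simp [two_mul]

lemma trace_frame (f : CRFrame C.toCRData) (hx : x ∈ f.U) (T : C.H x →ₗ[ℝ] C.H x) :
    LinearMap.trace ℝ (C.H x) T =
      ∑ i, f.coord x (T (f.hvec i x) : Tan m x) (some i) := by
  refine trace_eq_sum (fun i ↦ f.hvec i x)
    (fun i ↦ LinearMap.proj (some i) ∘ₗ f.coord x ∘ₗ (C.H x).subtype) ?_ ?_ T
  · intro i j
    exact f.coord_hvec hx j i
  · rw [C.finrank_H]; simp [two_mul]

lemma coord_J (f : CRFrame C.toCRData) (hx : x ∈ f.U) (v : C.H x) (α : Fin m) :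
    f.coord x (C.J x v : Tan m x) (some (Sum.inl α)) =
      - f.coord x (v : Tan m x) (some (Sum.inr α)) ∧
    f.coord x (C.J x v : Tan m x) (some (Sum.inr α)) =
      f.coord x (v : Tan m x) (some (Sum.inl α)) := by
  have h := congrFun (f.coframe_J hx v) α.succ
  rw [Pi.smul_apply, f.coframe_succ, f.coframe_succ] at h
  have h1 := congrArg Complex.re h
  have h2 := congrArg Complex.im h
  simp at h1 h2
  exact ⟨h1, h2⟩

/-- The imaginary part of the complex trace of a complex linear endomorphism of `H`. -/
lemma IsUnitary.sum_levi_J (hε : θ.IsUnitary x ε) (f : CRFrame C.toCRData) (hx : x ∈ f.U)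
    (Φ : C.H x →ₗ[ℝ] C.H x) (hΦ : ∀ u, Φ (C.J x u) = C.J x (Φ u)) :
    ∑ α, θ.levi x (Φ (ε α) : Tan m x) (C.J x (ε α) : Tan m x) =
      ∑ α, f.coord x (Φ (f.e α x) : Tan m x) (some (Sum.inr α)) := by
  have h1 := hε.trace_eq (C.J x ∘ₗ Φ)
  have h2 := trace_frame f hx (C.J x ∘ₗ Φ)
  have h3 : ∀ α, f.hvec (Sum.inl α) x = f.e α x := fun α ↦ rfl
  have h4 : ∀ α, f.hvec (Sum.inr α) x = C.J x (f.e α x) := fun α ↦ rfl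
  rw [h1, Fintype.sum_sum_type, ← Finset.sum_add_distrib] at h2
  simp only [LinearMap.comp_apply, hΦ, C.J_sq, h3, h4, (coord_J f hx _ _).1, Submodule.coe_neg,
    map_neg, LinearMap.neg_apply, levi_J, Pi.neg_apply, Finset.sum_neg_distrib,
    ← two_mul, ← Finset.mul_sum] at h2
  linarith

/-- The trace of a two-form with respect to the Levi form does not depend on the unitary basis. -/
lemma IsUnitary.sum_eq (hε : θ.IsUnitary x ε) (hε' : θ.IsUnitary x ε')
    (β : C.H x →ₗ[ℝ] C.H x →ₗ[ℝ] ℝ) (hβ : ∀ u v, β u v = - β v u) :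
    ∑ α, β (ε α) (C.J x (ε α)) = ∑ α, β (ε' α) (C.J x (ε' α)) := by
  let Λ : C.H x ≃ₗ[ℝ] Module.Dual ℝ (C.H x) :=
    LinearMap.linearEquivOfInjective ((θ.levi x).domRestrict₁₂ (C.H x) (C.H x))
      ((injective_iff_map_eq_zero _).2 fun v hv ↦ by
        ext1
        exact θ.eq_zero_of_levi (θ.vanish x v) fun w ↦ congr($hv w))
      (Subspace.dual_finrank_eq (K := ℝ) (V := C.H x)).symm
  let T : C.H x →ₗ[ℝ] C.H x := Λ.symm.toLinearMap ∘ₗ β.compl₂ (C.J x)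
  have hT : ∀ u v : C.H x, θ.levi x (T u : Tan m x) (v : Tan m x) = β u (C.J x v) := fun u v ↦
    congr($(Λ.apply_symm_apply (β.compl₂ (C.J x) u)) v)
  have h : ∀ {ε : Fin m → C.H x}, θ.IsUnitary x ε →
      LinearMap.trace ℝ (C.H x) T = 2 * ∑ α, β (ε α) (C.J x (ε α)) := by
    intro ε hε
    rw [hε.trace_eq, Finset.mul_sum]
    refine Finset.sum_congr rfl fun α _ ↦ ?_
    rw [hT, hT, C.J_sq, map_neg, hβ (C.J x (ε α))]
    ring
  linarith [h hε, h hε']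

end PseudoHermitian

/-! ## Exterior derivatives of one-forms without a smoothness structure -/

lemma smoothNear_bundleExtend {x : M} (v : Tan m x) :
    SmoothNear (FiberBundle.extend (E := (TangentSpace 𝓘(ℝ, CRModel m) : M → Type)) (CRModel m) v)
      x := by
  obtain ⟨s, hs, h⟩ := FiberBundle.exists_contMDiffOn_extend (k := ∞) 𝓘(ℝ, CRModel m)
    (V := (TangentSpace 𝓘(ℝ, CRModel m) : M → Type)) (CRModel m) v
  filter_upwards [eventually_mem_nhds_iff.2 hs] with y hy
  exact h.contMDiffAt hy

lemma tensorial_expand_vf {D : CRData m M} {V : Type*} [AddCommGroup V] [Module ℝ V] {x : M}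
    (Φ : (∀ y : M, Tan m y) → V) (f : CRFrame D) (hx : x ∈ f.U)
    (hadd : ∀ X Y : ∀ y : M, Tan m y, SmoothVFAt X x → SmoothVFAt Y x → Φ (X + Y) = Φ X + Φ Y)
    (hsmul : ∀ (h : M → ℝ) (X : ∀ y : M, Tan m y), SmoothAt m h x → SmoothVFAt X x →
      Φ (h • X) = h x • Φ X) {X : ∀ y : M, Tan m y} (hX : SmoothVFAt X x) :
    Φ X = ∑ i, f.coord x (X x) i • Φ (fun y ↦ f.vec y i) := by
  classical
  let E : Option (Fin m ⊕ Fin m) → ∀ y : M, Tan m y := fun i y ↦ f.vec y i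
  let c : Option (Fin m ⊕ Fin m) → M → ℝ := fun i y ↦ f.coord y (X y) i
  have hE : ∀ i, SmoothVFAt (E i) x := fun i ↦ f.smooth_vec i hx
  have hc : ∀ i, SmoothAt m (c i) x := fun i ↦ f.smoothAt_coord hx hX i
  have hvf : ∀ s : Finset (Option (Fin m ⊕ Fin m)), SmoothVFAt (∑ i ∈ s, c i • E i) x := by
    intro s
    refine (SmoothVFAt.sum (s := s) fun i _ ↦ (hE i).smul (hc i)).congr ?_
    exact Filter.Eventually.of_forall fun y ↦ Finset.sum_apply ..
  have h1 : ∀ s : Finset (Option (Fin m ⊕ Fin m)),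
      Φ (∑ i ∈ s, c i • E i) = ∑ i ∈ s, c i x • Φ (E i) := by
    intro s
    induction s using Finset.induction_on with
    | empty =>
      have h0 : SmoothVFAt (0 : ∀ y : M, Tan m y) x := by simpa using hvf ∅
      have := hsmul 0 0 contMDiffAt_const h0
      rw [smul_zero] at this
      simpa using this
    | insert i s hi ih =>
      rw [Finset.sum_insert hi, Finset.sum_insert hi, ← ih, ← hsmul _ _ (hc i) (hE i)]
      exact hadd _ _ ((hE i).smul (hc i)) (hvf s)
  let ψ : M → ℝ := f.U.indicator 1
  have hψ : SmoothAt m ψ x := by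
    refine (contMDiffAt_const (c := (1 : ℝ))).congr_of_eventuallyEq ?_
    filter_upwards [f.eventually_mem hx] with y hy
    simp [ψ, hy]
  have hψx : ψ x = 1 := by simp [ψ, hx]
  have h2 : ψ • X = ψ • ∑ i, c i • E i := by
    funext y
    by_cases hy : y ∈ f.U
    · have := f.sum_coord hy (X y)
      simp only [Pi.smul_apply', Finset.sum_apply, c, E]
      rw [this]
    · simp [ψ, hy]
  have h3 := hsmul ψ X hψ hX
  rw [h2, hsmul _ _ hψ (hvf _), hψx, one_smul, one_smul, h1] at h3
  exact h3.symm

/-- The exterior derivative `V t(W) - W t(V) - t([V, W])`. -/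
def extDer (t : ∀ y : M, Tan m y →ₗ[ℝ] ℝ) (V W : ∀ y : M, Tan m y) (x : M) : ℝ :=
  der m (fun y ↦ t y (W y)) x (V x) - der m (fun y ↦ t y (V y)) x (W x) - t x (bracket V W x)

/-- Smoothness of a one-form at a point, tested on vector fields. -/
def SmoothFormAt (t : ∀ y : M, Tan m y →ₗ[ℝ] ℝ) (x : M) : Prop :=
  ∀ V : ∀ y : M, Tan m y, SmoothVFAt V x → SmoothAt m (fun y ↦ t y (V y)) x

section ExtDer

variable {t : ∀ y : M, Tan m y →ₗ[ℝ] ℝ} {x : M} {V W V' : ∀ y : M, Tan m y}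

lemma extDer_swap : extDer t V W x = - extDer t W V x := by
  rw [extDer, extDer, bracket_swap, map_neg]
  ring

lemma extDer_add_left (ht : SmoothFormAt t x) (hV : SmoothVFAt V x) (hV' : SmoothVFAt V' x) :
    extDer t (V + V') W x = extDer t V W x + extDer t V' W x := by
  have h : (fun y ↦ t y ((V + V') y)) = fun y ↦ t y (V y) + t y (V' y) :=
    funext fun y ↦ map_add _ _ _
  have h' : (V + V') x = V x + V' x := rfl
  rw [extDer, extDer, extDer, bracket_add_left hV hV', h, der_add (ht V hV) (ht V' hV'), map_add,
    h', map_add]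
  ring

lemma extDer_smul_left (ht : SmoothFormAt t x) {h : M → ℝ} (hh : SmoothAt m h x)
    (hV : SmoothVFAt V x) : extDer t (h • V) W x = h x • extDer t V W x := by
  have h1 : (fun y ↦ t y ((h • V) y)) = fun y ↦ h y * t y (V y) :=
    funext fun y ↦ map_smul (t y) (h y) (V y)
  have h2 : (h • V) x = h x • V x := rfl
  rw [extDer, extDer, bracket_smul_left hh hV, h1, der_mul hh (ht V hV), h2]
  simp only [map_add, map_smul, smul_eq_mul]
  ring

/-- The exterior derivative of a one-form is a two-form. -/
lemma exists_extDer (C : CRStructure m M) (ht : SmoothFormAt t x) :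
    ∃ β : Tan m x →ₗ[ℝ] Tan m x →ₗ[ℝ] ℝ, (∀ u v, β u v = - β v u) ∧
      ∀ V W : ∀ y : M, Tan m y, SmoothVFAt V x → SmoothVFAt W x →
        extDer t V W x = β (V x) (W x) := by
  set f := C.frameAt x
  have hx : x ∈ f.U := C.mem_frameAt x
  let E : Option (Fin m ⊕ Fin m) → ∀ y : M, Tan m y := fun i y ↦ f.vec y i
  have key : ∀ (W : ∀ y : M, Tan m y) {V : ∀ y : M, Tan m y}, SmoothVFAt V x →
      extDer t V W x = ∑ i, f.coord x (V x) i * extDer t (E i) W x := fun W V hV ↦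
    tensorial_expand_vf (fun V ↦ extDer t V W x) f hx (fun _ _ h h' ↦ extDer_add_left ht h h')
      (fun _ _ h h' ↦ extDer_smul_left ht h h') hV
  let β : Tan m x →ₗ[ℝ] Tan m x →ₗ[ℝ] ℝ := ∑ i, ∑ j, extDer t (E i) (E j) x •
    (LinearMap.proj i ∘ₗ f.coord x).smulRight (LinearMap.proj j ∘ₗ f.coord x)
  have hβ : ∀ u v, β u v =
      ∑ i, ∑ j, f.coord x u i * (f.coord x v j * extDer t (E i) (E j) x) := by
    intro u v
    simp only [β, LinearMap.sum_apply, LinearMap.smul_apply, LinearMap.smulRight_apply,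
      LinearMap.comp_apply, LinearMap.proj_apply, smul_eq_mul]
    exact Finset.sum_congr rfl fun i _ ↦ Finset.sum_congr rfl fun j _ ↦ by ring
  refine ⟨β, fun u v ↦ ?_, fun V W hV hW ↦ ?_⟩
  · rw [hβ, hβ, Finset.sum_comm, ← Finset.sum_neg_distrib]
    refine Finset.sum_congr rfl fun i _ ↦ ?_
    rw [← Finset.sum_neg_distrib]
    refine Finset.sum_congr rfl fun j _ ↦ ?_
    rw [extDer_swap]
    ring
  · rw [key W hV, hβ]
    refine Finset.sum_congr rfl fun i _ ↦ ?_
    rw [extDer_swap, key (E i) hW, ← Finset.mul_sum, ← Finset.sum_neg_distrib]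
    refine congrArg _ (Finset.sum_congr rfl fun j _ ↦ ?_)
    rw [extDer_swap]
    ring

end ExtDer

/-! ## The curvature of the Tanaka-Webster connection -/

lemma commute_J_of_frame {C : CRStructure m M} (f : CRFrame C.toCRData) {x : M} (hx : x ∈ f.U)
    (Φ : C.H x →ₗ[ℝ] C.H x) (h : ∀ α, Φ (C.J x (f.e α x)) = C.J x (Φ (f.e α x))) (u : C.H x) :
    Φ (C.J x u) = C.J x (Φ u) := by
  obtain ⟨a, b, rfl⟩ := f.span_H hx u
  simp only [map_sum]
  refine Finset.sum_congr rfl fun α _ ↦ ?_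
  simp only [map_add, map_smul, h, C.J_sq, map_neg]

/-- The endomorphism of `H` with prescribed values on a frame. -/
def CRFrame.endo {D : CRData m M} (f : CRFrame D) (x : M) (A : Fin m ⊕ Fin m → D.H x) :
    D.H x →ₗ[ℝ] D.H x :=
  ∑ j, (LinearMap.proj (some j) ∘ₗ f.coord x ∘ₗ (D.H x).subtype).smulRight (A j)

lemma CRFrame.endo_apply {D : CRData m M} (f : CRFrame D) (x : M) (A : Fin m ⊕ Fin m → D.H x)
    (u : D.H x) : f.endo x A u = ∑ j, f.coord x (u : Tan m x) (some j) • A j := by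
  simp [endo, LinearMap.sum_apply]

lemma CRFrame.endo_hvec {D : CRData m M} (f : CRFrame D) {x : M} (hx : x ∈ f.U)
    (A : Fin m ⊕ Fin m → D.H x) (j : Fin m ⊕ Fin m) : f.endo x A (f.hvec j x) = A j := by
  classical
  simp [endo_apply, f.coord_hvec hx]

namespace PseudoHermitian

variable {C : CRStructure m M} (θ : PseudoHermitian C) {x : M} {Y : ∀ y, C.H y}
  {V W : ∀ y : M, Tan m y}

/-- The imaginary part of the trace of the connection matrix of `∇` on `H` in a frame. -/
def connTrace (f : CRFrame C.toCRData) (y : M) : Tan m y →ₗ[ℝ] ℝ :=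
  ∑ α, LinearMap.proj (some (Sum.inr α)) ∘ₗ f.coord y ∘ₗ
    (θ.webster.toFun (C.vf (f.e α)) y).toLinearMap

lemma connTrace_apply (f : CRFrame C.toCRData) (y : M) (v : Tan m y) : θ.connTrace f y v =
    ∑ α, f.coord y (θ.webster.toFun (C.vf (f.e α)) y v) (some (Sum.inr α)) := by
  simp [connTrace, LinearMap.sum_apply]

lemma smooth_connTrace (f : CRFrame C.toCRData) (hx : x ∈ f.U) :
    SmoothFormAt (θ.connTrace f) x := by
  intro V hV
  simp only [connTrace_apply]
  exact SmoothAt.sum fun α _ ↦ f.smoothAt_coord hx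
    (θ.smooth_webster hV (f.smoothNear_hvec hx (Sum.inl α))) _

/-- The section `∇_V Y` of `H`. -/
def covH (V : ∀ y : M, Tan m y) (Y : ∀ y, C.H y) (y : M) : C.H y :=
  θ.projH y (θ.webster.toFun (C.vf Y) y (V y))

lemma covH_eq (hY : SmoothVFAt (C.vf Y) x) :
    (θ.covH V Y x : Tan m x) = θ.webster.toFun (C.vf Y) x (V x) := by
  rw [covH, projH_apply, form_webster θ hY, zero_smul, sub_zero]

lemma smoothNear_covH (hV : SmoothNear V x) (hY : SmoothNear (C.vf Y) x) :
    SmoothNear (C.vf (θ.covH V Y)) x := by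
  filter_upwards [hV, hY.nhds] with y h1 h2
  exact θ.smooth_projH (θ.smooth_webster h1 h2)

/-- The curvature `∇_V ∇_W Y - ∇_W ∇_V Y - ∇_{[V, W]} Y`. -/
def curv (V W : ∀ y : M, Tan m y) (Y : ∀ y, C.H y) (x : M) : Tan m x :=
  θ.webster.toFun (C.vf (θ.covH W Y)) x (V x) - θ.webster.toFun (C.vf (θ.covH V Y)) x (W x)
    - θ.webster.toFun (C.vf Y) x (bracket V W x)

lemma form_curv (hV : SmoothNear V x) (hW : SmoothNear W x) (hY : SmoothNear (C.vf Y) x) :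
    θ.form x (θ.curv V W Y x) = 0 := by
  rw [curv, map_sub, map_sub, form_webster θ (θ.smoothNear_covH hW hY).self,
    form_webster θ (θ.smoothNear_covH hV hY).self, form_webster θ hY.self]
  simp

lemma curv_J (hV : SmoothNear V x) (hW : SmoothNear W x) (hY : SmoothNear (C.vf Y) x) :
    θ.curv V W (C.Jf Y) x = θ.extJ x (θ.curv V W Y x) := by
  have h : ∀ {V : ∀ y : M, Tan m y}, SmoothNear V x → ∀ v,
      θ.webster.toFun (C.vf (θ.covH V (C.Jf Y))) x v =
        θ.extJ x (θ.webster.toFun (C.vf (θ.covH V Y)) x v) := by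
    intro V hV v
    rw [← webster_J θ (θ.smoothNear_covH hV hY)]
    refine congr($(cov_congr θ.webster (θ.smoothNear_covH hV (C.smoothNear_Jf hY)).self
      (C.smoothNear_Jf (θ.smoothNear_covH hV hY)).self ?_) v)
    filter_upwards [hY.nhds] with y hy
    change (θ.covH V (C.Jf Y) y : Tan m y) = (C.J y (θ.covH V Y y) : Tan m y)
    rw [← extJ_coe θ, covH_eq θ hy.self, covH_eq θ (C.smooth_Jf hy.self), webster_J θ hy]
  rw [curv, curv, h hV, h hW, webster_J θ hY, map_sub, map_sub]

lemma curvature_eq (f : CRFrame C.toCRData) (hx : x ∈ f.U) (v w u : Tan m x) :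
    θ.curvature x v w u = ∑ j, (θ.reebFrame f).coord x u (some j) •
      θ.curv (FiberBundle.extend (E := (TangentSpace 𝓘(ℝ, CRModel m) : M → Type)) (CRModel m) v)
        (FiberBundle.extend (E := (TangentSpace 𝓘(ℝ, CRModel m) : M → Type)) (CRModel m) w)
        (f.hvec j) x := by
  let ext : Tan m x → ∀ y : M, Tan m y := fun a ↦
    FiberBundle.extend (E := (TangentSpace 𝓘(ℝ, CRModel m) : M → Type)) (CRModel m) a
  have hext : ∀ a, SmoothNear (ext a) x := smoothNear_bundleExtend
  have hexts : ∀ a, ext a x = a := fun a ↦ FiberBundle.extend_apply_self ..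
  let F := θ.reebFrame f
  have hF : x ∈ F.U := hx
  let E : Fin m ⊕ Fin m → ∀ y, C.H y := f.hvec
  let c : Option (Fin m ⊕ Fin m) → M → ℝ := fun i y ↦ F.coord y (ext u y) i
  have hE : ∀ j, SmoothNear (C.vf (E j)) x := f.smoothNear_hvec hx
  have hFs : ∀ i, SmoothVFAt (fun y ↦ F.vec y i) x := fun i ↦ F.smooth_vec i hF
  have hFE : ∀ j, (fun y ↦ F.vec y (some j)) = C.vf (E j) := fun j ↦
    funext fun y ↦ F.vec_some y j
  have hFT : (fun y ↦ F.vec y none) = θ.reeb := rfl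
  have hcs : ∀ i, FunSmoothNear m (c i) x := fun i ↦ by
    filter_upwards [hext u, F.eventually_mem hF] with y h1 h2 using F.smoothAt_coord h2 h1 i
  have key : ∀ {W : ∀ y : M, Tan m y} (_ : SmoothNear W x) (v : Tan m x),
      θ.webster.toFun (fun y ↦ θ.webster.toFun (ext u) y (W y)) x v =
        (∑ j, (c (some j) x • θ.webster.toFun (C.vf (θ.covH W (E j))) x v
          + der m (c (some j)) x v • θ.webster.toFun (C.vf (E j)) x (W x)))
        + ((∑ j, der m (c (some j)) x (W x) • θ.webster.toFun (C.vf (E j)) x v)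
          + ∑ i, der m (fun y ↦ der m (c i) y (W y)) x v • F.vec x i) := by
    intro W hW v
    have hcd : ∀ i, SmoothAt m (fun y ↦ der m (c i) y (W y)) x := fun i ↦
      F.smooth_der_real hF (hcs i).self hW.self
    have hcov : ∀ j, SmoothVFAt (C.vf (θ.covH W (E j))) x := fun j ↦
      (θ.smoothNear_covH hW (hE j)).self
    have h1 : ∀ᶠ y in 𝓝 x, θ.webster.toFun (ext u) y (W y) =
        ((∑ j, c (some j) • C.vf (θ.covH W (E j))) +
          ∑ i, (fun y ↦ der m (c i) y (W y)) • fun y ↦ F.vec y i) y := by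
      filter_upwards [hext u, F.eventually_mem hF] with y h1 h2
      refine (cov_expand θ.webster F h2 h1 (W y)).trans ?_
      rw [Finset.sum_add_distrib, Pi.add_apply, Finset.sum_apply, Finset.sum_apply,
        Fintype.sum_option, hFT, webster_reeb, smul_zero, zero_add]
      refine congrArg (· + _) (Finset.sum_congr rfl fun j _ ↦ ?_)
      rw [hFE]
      exact congrArg (c (some j) y • ·) (covH_eq θ (f.smooth_hvec h2 j)).symm
    have h2 : SmoothVFAt (∑ j, c (some j) • C.vf (θ.covH W (E j))) x :=
      (SmoothVFAt.sum (s := Finset.univ) fun j _ ↦ (hcov j).smul (hcs (some j)).self).congr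
        (Filter.Eventually.of_forall fun y ↦ Finset.sum_apply ..)
    have h3 : SmoothVFAt (∑ i, (fun y ↦ der m (c i) y (W y)) • fun y ↦ F.vec y i) x :=
      (SmoothVFAt.sum (s := Finset.univ) fun i _ ↦ (hFs i).smul (hcd i)).congr
        (Filter.Eventually.of_forall fun y ↦ Finset.sum_apply ..)
    have h4 := congr($(cov_congr θ.webster ((h2.add h3).congr h1) (h2.add h3) h1) v)
    refine h4.trans ?_
    rw [cov_add θ.webster h2 h3,
      cov_sum_of_mdiff θ.webster Finset.univ (fun j ↦ (hcs (some j)).self.mdiff) hcov,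
      cov_sum_of_mdiff θ.webster Finset.univ (fun i ↦ (hcd i).mdiff) hFs]
    refine congr_arg₂ (· + ·) (Finset.sum_congr rfl fun j _ ↦ ?_) ?_
    · exact congrArg (fun z ↦ c (some j) x • _ + der m (c (some j)) x v • z)
        (covH_eq θ (hE j).self)
    · rw [Finset.sum_add_distrib, Fintype.sum_option, hFT, webster_reeb, smul_zero, zero_add]
      refine congrArg (· + _) (Finset.sum_congr rfl fun j _ ↦ ?_)
      rw [hFE]
  have hbr : θ.webster.toFun (ext u) x (bracket (ext v) (ext w) x) =
      (∑ j, c (some j) x • θ.webster.toFun (C.vf (E j)) x (bracket (ext v) (ext w) x))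
        + ∑ i, (der m (fun y ↦ der m (c i) y (ext w y)) x v
          - der m (fun y ↦ der m (c i) y (ext v y)) x w) • F.vec x i := by
    refine (cov_expand θ.webster F hF (hext u).self _).trans ?_
    rw [Finset.sum_add_distrib, Fintype.sum_option, hFT, webster_reeb, smul_zero, zero_add]
    refine congr_arg₂ (· + ·) (Finset.sum_congr rfl fun j _ ↦ ?_)
      (Finset.sum_congr rfl fun i _ ↦ ?_)
    · rw [hFE]
    · have h := F.bracket_der hF (hcs i).self (hext v).self (hext w).self
      rw [hexts, hexts] at h
      exact congrArg (· • F.vec x i) h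
  have h1 : θ.curvature x v w u =
      θ.webster.toFun (fun y ↦ θ.webster.toFun (ext u) y (ext w y)) x v
      - θ.webster.toFun (fun y ↦ θ.webster.toFun (ext u) y (ext v y)) x w
      - θ.webster.toFun (ext u) x (bracket (ext v) (ext w) x) := by
    simp only [curvature, tanakaWebster_eq]
    rfl
  have h2 : ∀ j, θ.curv (ext v) (ext w) (E j) x =
      θ.webster.toFun (C.vf (θ.covH (ext w) (E j))) x v
      - θ.webster.toFun (C.vf (θ.covH (ext v) (E j))) x w
      - θ.webster.toFun (C.vf (E j)) x (bracket (ext v) (ext w) x) := by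
    intro j
    rw [curv, hexts, hexts]
  have hc : ∀ j, F.coord x u (some j) = c (some j) x := fun j ↦ by simp only [c, hexts]
  change _ = ∑ j, F.coord x u (some j) • θ.curv (ext v) (ext w) (E j) x
  simp only [h1, h2, hc]
  rw [key (hext w), key (hext v), hbr, hexts, hexts]
  simp only [Finset.sum_add_distrib, smul_sub, sub_smul, Finset.sum_sub_distrib]
  abel

end PseudoHermitian

namespace PseudoHermitian

variable {C : CRStructure m M} (θ : PseudoHermitian C) {x : M}
  {V W : ∀ y : M, Tan m y} {ε : Fin m → C.H x}

lemma trace_J_comp (f : CRFrame C.toCRData) (hx : x ∈ f.U)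
    (Φ : C.H x →ₗ[ℝ] C.H x) (hΦ : ∀ u, Φ (C.J x u) = C.J x (Φ u)) :
    LinearMap.trace ℝ (C.H x) (C.J x ∘ₗ Φ) =
      -2 * ∑ α, f.coord x (Φ (f.e α x) : Tan m x) (some (Sum.inr α)) := by
  have h2 := trace_frame f hx (C.J x ∘ₗ Φ)
  have h3 : ∀ α, f.hvec (Sum.inl α) x = f.e α x := fun α ↦ rfl
  have h4 : ∀ α, f.hvec (Sum.inr α) x = C.J x (f.e α x) := fun α ↦ rfl
  rw [h2, Fintype.sum_sum_type]
  simp only [LinearMap.comp_apply, hΦ, C.J_sq, h3, h4, (coord_J f hx _ _).1, Submodule.coe_neg,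
    map_neg, Pi.neg_apply, Finset.sum_neg_distrib]
  ring

/-- The connection matrix `∇_v` in a frame. -/
def frameCov (f : CRFrame C.toCRData) (x : M) (v : Tan m x) : C.H x →ₗ[ℝ] C.H x :=
  f.endo x fun j ↦ θ.projH x (θ.webster.toFun (C.vf (f.hvec j)) x v)

lemma frameCov_hvec (f : CRFrame C.toCRData) (hx : x ∈ f.U) (v : Tan m x) (j : Fin m ⊕ Fin m) :
    (θ.frameCov f x v (f.hvec j x) : Tan m x) = θ.webster.toFun (C.vf (f.hvec j)) x v := by
  rw [frameCov, f.endo_hvec hx, projH_apply, form_webster θ (f.smooth_hvec hx j), zero_smul,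
    sub_zero]

lemma frameCov_J (f : CRFrame C.toCRData) (hx : x ∈ f.U) (v : Tan m x) (u : C.H x) :
    θ.frameCov f x v (C.J x u) = C.J x (θ.frameCov f x v u) := by
  refine commute_J_of_frame f hx _ (fun α ↦ ?_) u
  ext1
  have h1 := θ.frameCov_hvec f hx v (Sum.inr α)
  have h2 := θ.frameCov_hvec f hx v (Sum.inl α)
  have h3 := webster_J θ (f.smoothNear_hvec hx (Sum.inl α)) v
  refine (h1.trans h3).trans ?_
  rw [← h2, extJ_coe]
  rfl

lemma sum_frameCov_symm (f : CRFrame C.toCRData) (hx : x ∈ f.U) (v w : Tan m x) :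
    ∑ α, f.coord x (θ.frameCov f x v (θ.frameCov f x w (f.e α x)) : Tan m x)
      (some (Sum.inr α)) =
    ∑ α, f.coord x (θ.frameCov f x w (θ.frameCov f x v (f.e α x)) : Tan m x)
      (some (Sum.inr α)) := by
  have h1 := trace_J_comp f hx (θ.frameCov f x v ∘ₗ θ.frameCov f x w) fun u ↦ by
    simp [frameCov_J θ f hx]
  have h2 := trace_J_comp f hx (θ.frameCov f x w ∘ₗ θ.frameCov f x v) fun u ↦ by
    simp [frameCov_J θ f hx]
  have h3 : C.J x ∘ₗ θ.frameCov f x w ∘ₗ θ.frameCov f x v =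
      (θ.frameCov f x w) ∘ₗ (C.J x ∘ₗ θ.frameCov f x v) := by
    ext1 u
    simp [frameCov_J θ f hx]
  rw [h3, LinearMap.trace_comp_comm', LinearMap.comp_assoc, h1] at h2
  simp only [LinearMap.comp_apply] at h2
  linarith

/-- The trace of the curvature is the exterior derivative of the trace of the connection matrix. -/
lemma sum_curv (f : CRFrame C.toCRData) (hx : x ∈ f.U) (hV : SmoothNear V x)
    (hW : SmoothNear W x) :
    ∑ α, f.coord x (θ.curv V W (f.e α) x) (some (Sum.inr α)) =
      extDer (θ.connTrace f) V W x := by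
  have hE : ∀ j, SmoothNear (C.vf (f.hvec j)) x := f.smoothNear_hvec hx
  have hFE : ∀ j, (fun y ↦ f.vec y (some j)) = C.vf (f.hvec j) := fun j ↦
    funext fun y ↦ f.vec_some y j
  have key : ∀ {W : ∀ y : M, Tan m y} (_ : SmoothNear W x) (v : Tan m x),
      ∑ α, f.coord x (θ.webster.toFun (C.vf (θ.covH W (f.e α))) x v) (some (Sum.inr α)) =
        (∑ α, f.coord x (θ.frameCov f x v (θ.frameCov f x (W x) (f.e α x)) : Tan m x)
          (some (Sum.inr α))) + der m (fun y ↦ θ.connTrace f y (W y)) x v := by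
    intro W hW v
    have hs : ∀ α, SmoothNear (C.vf (θ.covH W (f.e α))) x := fun α ↦
      θ.smoothNear_covH hW (hE (Sum.inl α))
    have h1 : ∀ᶠ y in 𝓝 x, θ.connTrace f y (W y) =
        ∑ α, f.coord y (θ.covH W (f.e α) y : Tan m y) (some (Sum.inr α)) := by
      filter_upwards [f.eventually_mem hx] with y hy
      rw [connTrace_apply]
      exact Finset.sum_congr rfl fun α _ ↦ congrArg (fun z ↦ f.coord y z _)
        (covH_eq θ (f.smooth_e α y hy)).symm
    rw [der_congr h1, der_sum fun α _ ↦ f.smoothAt_coord hx (hs α).self _,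
      ← Finset.sum_add_distrib]
    refine Finset.sum_congr rfl fun α _ ↦ ?_
    have h0 : f.coord x (θ.covH W (f.e α) x : Tan m x) none = 0 := f.coord_none_coe hx _
    have h0' : der m (fun y ↦ f.coord y (θ.covH W (f.e α) y : Tan m y) none) x v = 0 := by
      refine der_eq_zero 0 ?_ v
      filter_upwards [f.eventually_mem hx] with y hy using f.coord_none_coe hy _
    have h2 := cov_expand θ.webster f hx (hs α).self v
    rw [Fintype.sum_option, h0, h0', zero_smul, zero_smul, zero_add, zero_add] at h2
    have h3 : θ.frameCov f x (W x) (f.e α x) = θ.covH W (f.e α) x := by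
      ext1
      exact (θ.frameCov_hvec f hx (W x) (Sum.inl α)).trans (covH_eq θ (hE (Sum.inl α)).self).symm
    have h4 : (θ.frameCov f x v (θ.covH W (f.e α) x) : Tan m x) =
        ∑ j, f.coord x (θ.covH W (f.e α) x : Tan m x) (some j) •
          θ.webster.toFun (C.vf (f.hvec j)) x v := by
      conv_lhs => rw [← f.sum_hvec hx (θ.covH W (f.e α) x)]
      rw [map_sum, AddSubmonoidClass.coe_finsetSum]
      refine Finset.sum_congr rfl fun j _ ↦ ?_
      rw [map_smul, Submodule.coe_smul, frameCov_hvec θ f hx]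
    rw [h3, h4]
    rw [Finset.sum_add_distrib] at h2
    refine (congrArg (fun z ↦ f.coord x z (some (Sum.inr α))) h2).trans ?_
    rw [map_add, Pi.add_apply]
    refine congr_arg₂ (· + ·) ?_ ?_
    · refine congrArg (fun z ↦ f.coord x z (some (Sum.inr α)))
        (Finset.sum_congr rfl fun j _ ↦ ?_)
      rw [hFE]
    · rw [map_sum, Finset.sum_apply]
      classical
      simp [f.coord_vec hx, Pi.single_apply]
  rw [extDer, connTrace_apply θ f x (bracket V W x)]
  have h1 := key hW (V x)
  have h2 := key hV (W x)
  rw [sum_frameCov_symm θ f hx] at h1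
  have h3 : ∀ α, f.coord x (θ.curv V W (f.e α) x) (some (Sum.inr α)) =
      f.coord x (θ.webster.toFun (C.vf (θ.covH W (f.e α))) x (V x)) (some (Sum.inr α))
      - f.coord x (θ.webster.toFun (C.vf (θ.covH V (f.e α))) x (W x)) (some (Sum.inr α))
      - f.coord x (θ.webster.toFun (C.vf (f.e α)) x (bracket V W x)) (some (Sum.inr α)) := by
    intro α
    rw [curv, map_sub, map_sub]
    rfl
  simp only [h3, Finset.sum_sub_distrib]
  rw [h1, h2]
  ring

lemma reebFrame_coord_coe (f : CRFrame C.toCRData) (hx : x ∈ f.U) (u : C.H x)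
    (j : Fin m ⊕ Fin m) :
    (θ.reebFrame f).coord x (u : Tan m x) (some j) = f.coord x (u : Tan m x) (some j) := by
  classical
  have h : ∀ i, (θ.reebFrame f).coord x (f.hvec i x : Tan m x) (some j) = if j = i then 1 else 0 :=
    fun i ↦ (θ.reebFrame f).coord_hvec hx i j
  conv_lhs => rw [← f.sum_hvec hx u]
  rw [AddSubmonoidClass.coe_finsetSum, map_sum, Finset.sum_apply]
  simp only [Submodule.coe_smul, map_smul, Pi.smul_apply, h]
  simp

lemma IsUnitary.sum_curvature {θ : PseudoHermitian C} (hε : θ.IsUnitary x ε)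
    (f : CRFrame C.toCRData) (hx : x ∈ f.U) (v w : Tan m x) :
    ∑ α, θ.levi x (θ.curvature x v w (ε α : Tan m x)) (C.J x (ε α) : Tan m x) =
      extDer (θ.connTrace f)
        (FiberBundle.extend (E := (TangentSpace 𝓘(ℝ, CRModel m) : M → Type)) (CRModel m) v)
        (FiberBundle.extend (E := (TangentSpace 𝓘(ℝ, CRModel m) : M → Type)) (CRModel m) w)
        x := by
  have hV := smoothNear_bundleExtend (m := m) v
  have hW := smoothNear_bundleExtend (m := m) w
  set V := FiberBundle.extend (E := (TangentSpace 𝓘(ℝ, CRModel m) : M → Type)) (CRModel m) v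
  set W := FiberBundle.extend (E := (TangentSpace 𝓘(ℝ, CRModel m) : M → Type)) (CRModel m) w
  have hE : ∀ j, SmoothNear (C.vf (f.hvec j)) x := f.smoothNear_hvec hx
  let Φ : C.H x →ₗ[ℝ] C.H x := f.endo x fun j ↦ θ.projH x (θ.curv V W (f.hvec j) x)
  have hΦ : ∀ j, (Φ (f.hvec j x) : Tan m x) = θ.curv V W (f.hvec j) x := fun j ↦ by
    simp only [Φ]
    rw [f.endo_hvec hx, projH_apply, form_curv θ hV hW (hE j), zero_smul, sub_zero]
  have hΦJ : ∀ u, Φ (C.J x u) = C.J x (Φ u) := commute_J_of_frame f hx _ fun α ↦ by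
    ext1
    refine ((hΦ (Sum.inr α)).trans (θ.curv_J hV hW (hE (Sum.inl α)))).trans ?_
    exact (congrArg (θ.extJ x) (hΦ (Sum.inl α))).symm.trans (θ.extJ_coe _)
  have h1 : ∀ u : C.H x, θ.curvature x v w (u : Tan m x) = (Φ u : Tan m x) := by
    intro u
    rw [curvature_eq θ f hx]
    conv_rhs => rw [← f.sum_hvec hx u]
    rw [map_sum, AddSubmonoidClass.coe_finsetSum]
    refine Finset.sum_congr rfl fun j _ ↦ ?_
    rw [map_smul, Submodule.coe_smul, hΦ, reebFrame_coord_coe θ f hx]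
  simp only [h1]
  rw [hε.sum_levi_J f hx Φ hΦJ, ← θ.sum_curv f hx hV hW]
  exact Finset.sum_congr rfl fun α _ ↦ congrArg (fun z ↦ f.coord x z _) (hΦ (Sum.inl α))

/-- The Webster scalar curvature in terms of the trace of the connection matrix. -/
lemma IsUnitary.scal_eq {θ : PseudoHermitian C} (hε : θ.IsUnitary x ε) (f : CRFrame C.toCRData)
    (hx : x ∈ f.U) (β : Tan m x →ₗ[ℝ] Tan m x →ₗ[ℝ] ℝ) (hβ : ∀ u v, β u v = - β v u)
    (h : ∀ V W : ∀ y : M, Tan m y, SmoothVFAt V x → SmoothVFAt W x →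
      extDer (θ.connTrace f) V W x = β (V x) (W x)) :
    θ.scal x = - ∑ α, β (ε α : Tan m x) (C.J x (ε α) : Tan m x) := by
  have h1 : ∀ v w, θ.ricci x v w = Complex.I * (β v w : ℂ) := by
    intro v w
    rw [ricci, ← Complex.ofReal_sum, (θ.isUnitary_onb x).sum_curvature f hx,
      h _ _ (smoothNear_bundleExtend v).self (smoothNear_bundleExtend w).self,
      FiberBundle.extend_apply_self, FiberBundle.extend_apply_self]
  have h2 := hε.sum_eq (θ.isUnitary_onb x) (β.domRestrict₁₂ (C.H x) (C.H x)) fun u v ↦ hβ u v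
  simp only [LinearMap.domRestrict₁₂_apply] at h2
  rw [scal, h2]
  simp only [h1]
  rw [← Finset.mul_sum, ← mul_assoc, Complex.I_mul_I, ← Complex.ofReal_sum]
  simp

lemma canonicalConnection_im (v : Tan m x) :
    (θ.canonicalConnection x v).im = - θ.connTrace (C.frameAt x) x v := by
  have hx := C.mem_frameAt x
  set f := C.frameAt x
  have h1 : ∀ (i : Fin (m + 1)) (w : Tan m x),
      f.detForm x (Function.update (f.cvec x) i w) = f.coframe x w i := by
    intro i w
    rw [f.detForm_apply]
    have h2 : (Matrix.of fun k ↦ f.coframe x (Function.update (f.cvec x) i w k)) =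
        (1 : Matrix (Fin (m + 1)) (Fin (m + 1)) ℂ).updateRow i (f.coframe x w) := by
      ext k j
      by_cases hk : k = i
      · subst hk
        simp
      · simp [hk, f.coframe_cvec hx, Matrix.one_apply]
    rw [h2, ← Matrix.cramer_transpose_apply, Matrix.transpose_one, Matrix.cramer_one]
    rfl
  have h2 : θ.canonicalConnection x v =
      - ∑ i, f.coframe x (θ.webster.toFun (fun y ↦ f.cvec y i) x v) i := by
    rw [canonicalConnection]
    simp only [LinearMap.neg_apply, LinearMap.sum_apply, LinearMap.comp_apply, tanakaWebster_eq]
    refine congrArg _ (Finset.sum_congr rfl fun i _ ↦ ?_)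
    exact h1 i _
  rw [h2, Fin.sum_univ_succ, f.coframe_zero]
  simp only [f.coframe_succ, connTrace_apply]
  simp
  rfl

end PseudoHermitian

/-! ## Change of the pseudo-Hermitian form -/

namespace PseudoHermitian

variable {C : CRStructure m M} (θ θ' : PseudoHermitian C) {x : M} {X Y Z : ∀ y, C.H y}

/-- The function `λ` with `θ' = λ θ`. -/
def scale (y : M) : ℝ := θ'.form y (θ.reeb y)

lemma form_eq_scale (v : Tan m x) : θ'.form x v = scale θ θ' x * θ.form x v := by
  have h := congrArg (θ'.form x) (θ.projH_apply x v)
  rw [θ'.vanish, map_sub, map_smul] at h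
  change 0 = θ'.form x v - θ.form x v * scale θ θ' x at h
  linarith

lemma scale_ne_zero : scale θ θ' x ≠ 0 := by
  intro h
  have h1 := form_eq_scale θ θ' (θ'.reeb x)
  rw [h, zero_mul, form_reeb] at h1
  exact one_ne_zero h1

lemma smooth_scale : SmoothAt m (scale θ θ') x := θ'.smooth.apply (θ.smooth_reeb x)

lemma extD_scale (u v : C.H x) : extD θ'.form x (u : Tan m x) (v : Tan m x) =
    scale θ θ' x * extD θ.form x (u : Tan m x) (v : Tan m x) := by
  obtain ⟨X, rfl, hX⟩ := C.exists_extend u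
  obtain ⟨Y, rfl, hY⟩ := C.exists_extend v
  rw [θ.extD_eq_bracket hX.self hY.self, θ'.extD_eq_bracket hX.self hY.self, form_eq_scale θ θ']
  ring

lemma levi_scale_coe (u v : C.H x) : θ'.levi x (u : Tan m x) (v : Tan m x) =
    scale θ θ' x * θ.levi x (u : Tan m x) (v : Tan m x) := by
  rw [levi_coe, levi_coe, extD_scale θ θ', extD_scale θ θ']
  ring

lemma scale_pos (hm : 1 ≤ m) : 0 < scale θ θ' x := by
  have h0 : 0 < Module.finrank ℝ (C.H x) := by rw [C.finrank_H]; omega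
  have := Module.nontrivial_of_finrank_pos h0
  obtain ⟨v, hv⟩ := exists_ne (0 : C.H x)
  have h1 := θ'.levi_pos x v hv
  rw [levi_scale_coe θ θ'] at h1
  exact pos_of_mul_pos_left h1 (θ.levi_pos x v hv).le

/-- The section `λ T' - T` of `H`. -/
def shift (y : M) : C.H y :=
  ⟨scale θ θ' y • θ'.reeb y - θ.reeb y, θ'.mem_H.2 (by
    rw [map_sub, map_smul, form_reeb]
    change scale θ θ' y * 1 - scale θ θ' y = 0
    ring)⟩

lemma coe_shift (y : M) : (shift θ θ' y : Tan m y) = scale θ θ' y • θ'.reeb y - θ.reeb y := rfl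

lemma scale_smul_reeb (y : M) :
    scale θ θ' y • θ'.reeb y = θ.reeb y + (shift θ θ' y : Tan m y) := by
  rw [coe_shift]; abel

lemma smooth_shift (x : M) : SmoothVFAt (C.vf (shift θ θ')) x :=
  ((θ'.smooth_reeb x).smul (smooth_scale θ θ')).sub (θ.smooth_reeb x)

lemma smoothNear_shift (x : M) : SmoothNear (C.vf (shift θ θ')) x :=
  Filter.Eventually.of_forall (smooth_shift θ θ')

lemma projH_change (v : Tan m x) :
    θ'.projH x v = θ.projH x v - θ.form x v • shift θ θ' x := by
  ext1
  rw [projH_apply, form_eq_scale θ θ', Submodule.coe_sub, Submodule.coe_smul, coe_shift,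
    projH_apply]
  module

lemma extJ_change (v : Tan m x) :
    θ'.extJ x v = θ.extJ x v - θ.form x v • (C.J x (shift θ θ' x) : Tan m x) := by
  have h : ∀ θ : PseudoHermitian C, θ.extJ x v = (C.J x (θ.projH x v) : Tan m x) := fun _ ↦ rfl
  rw [h, h, projH_change θ θ', map_sub, map_smul]
  rfl

lemma levi_change (u v : Tan m x) : θ'.levi x u v = scale θ θ' x * (θ.levi x u v
    - θ.form x u * θ.levi x (shift θ θ' x : Tan m x) v
    - θ.form x v * θ.levi x (shift θ θ' x : Tan m x) u
    + θ.form x u * θ.form x v *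
      θ.levi x (shift θ θ' x : Tan m x) (shift θ θ' x : Tan m x)) := by
  rw [← levi_projH θ', ← levi_projH_right θ', levi_scale_coe θ θ', projH_change θ θ',
    projH_change θ θ', Submodule.coe_sub, Submodule.coe_sub, Submodule.coe_smul,
    Submodule.coe_smul]
  simp only [map_sub, LinearMap.sub_apply, map_smul, LinearMap.smul_apply, smul_eq_mul]
  rw [levi_projH, levi_projH_right, levi_projH_right, levi_projH,
    θ.levi_symm x u (shift θ θ' x : Tan m x)]
  ring

lemma levi_change_H (u : Tan m x) (v : C.H x) : θ'.levi x u (v : Tan m x) =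
    scale θ θ' x * (θ.levi x u (v : Tan m x)
      - θ.form x u * θ.levi x (shift θ θ' x : Tan m x) (v : Tan m x)) := by
  rw [levi_change θ θ', θ.vanish]
  ring

/-- The derivative of the conformal factor along `H`. -/
lemma der_scale (u : C.H x) : der m (scale θ θ') x (u : Tan m x) =
    scale θ θ' x * θ.levi x (C.J x (shift θ θ' x) : Tan m x) (u : Tan m x) := by
  obtain ⟨X, rfl, hX⟩ := C.exists_extend u
  have h1 := extD_apply θ'.smooth (θ.smooth_reeb x) hX.self
  have h2 : der m (fun y ↦ θ'.form y (X y : Tan m y)) x (θ.reeb x) = 0 :=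
    der_eq_zero 0 (Filter.Eventually.of_forall fun y ↦ θ'.vanish y (X y)) _
  have h3 : θ'.form x (bracket θ.reeb (C.vf X) x) = 0 := by
    rw [form_eq_scale θ θ', θ.form_bracket_reeb hX.self, mul_zero]
  have h4 : extD θ'.form x (θ.reeb x) (X x : Tan m x) =
      - extD θ'.form x (shift θ θ' x : Tan m x) (X x : Tan m x) := by
    have h5 := θ'.extD_reeb (X x : Tan m x)
    have h6 := congrArg (fun z ↦ extD θ'.form x z (X x : Tan m x)) (scale_smul_reeb θ θ' x)
    simp only [map_smul, map_add, LinearMap.smul_apply, LinearMap.add_apply, h5, smul_zero] at h6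
    linarith
  have h7 : extD θ'.form x (θ.reeb x) (X x : Tan m x) =
      0 - der m (scale θ θ') x (X x : Tan m x) - 0 :=
    h1.trans (congrArg₂ (fun a b ↦ a - der m (scale θ θ') x (X x : Tan m x) - b) h2 h3)
  rw [h4, extD_scale θ θ', extD_eq, extJ_coe] at h7
  linarith

lemma form_bracket (hX : SmoothVFAt (C.vf X) x) (hY : SmoothVFAt (C.vf Y) x) :
    θ.form x (bracket (C.vf X) (C.vf Y) x) =
      - θ.levi x (C.J x (X x) : Tan m x) (Y x : Tan m x) := by
  have h := θ.extD_eq_bracket hX hY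
  rw [extD_eq, extJ_coe] at h
  linarith

lemma levi_mixedBracket_change (hX : SmoothVFAt (C.vf X) x) (hY : SmoothVFAt (C.vf Y) x)
    (v : C.H x) : θ'.levi x (θ'.mixedBracket X Y x) (v : Tan m x) = scale θ θ' x *
      (θ.levi x (θ.mixedBracket X Y x) (v : Tan m x)
        + θ.levi x (C.J x (X x) : Tan m x) (Y x : Tan m x) *
          θ.levi x (shift θ θ' x : Tan m x) (v : Tan m x)
        - θ.levi x (X x : Tan m x) (Y x : Tan m x) *
          θ.levi x (C.J x (shift θ θ' x) : Tan m x) (v : Tan m x)) := by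
  have hJX := C.smooth_Jf hX
  have hJY := C.smooth_Jf hY
  rw [levi_change_H θ θ', mixedBracket, mixedBracket, extJ_change θ θ']
  simp only [map_smul, map_add, map_sub, LinearMap.smul_apply, LinearMap.add_apply,
    LinearMap.sub_apply, smul_eq_mul, form_extJ, θ.form_bracket hX hY, θ.form_bracket hJX hJY,
    θ.form_bracket hJX hY, θ.form_bracket hX hJY, θ.vanish, C.J_sq, Submodule.coe_neg, map_neg,
    LinearMap.neg_apply, levi_J_J]
  have h : θ.levi x (X x : Tan m x) (C.J x (Y x) : Tan m x) =
      - θ.levi x (C.J x (X x) : Tan m x) (Y x : Tan m x) := by rw [levi_J, neg_neg]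
  rw [h]
  ring

lemma der_levi_change (hY : SmoothVFAt (C.vf Y) x) (hZ : SmoothVFAt (C.vf Z) x) (u : C.H x) :
    der m (fun y ↦ θ'.levi y (Y y : Tan m y) (Z y : Tan m y)) x (u : Tan m x) =
      scale θ θ' x * (der m (fun y ↦ θ.levi y (Y y : Tan m y) (Z y : Tan m y)) x (u : Tan m x)
        + θ.levi x (C.J x (shift θ θ' x) : Tan m x) (u : Tan m x) *
          θ.levi x (Y x : Tan m x) (Z x : Tan m x)) := by
  have h : (fun y ↦ θ'.levi y (Y y : Tan m y) (Z y : Tan m y)) =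
      fun y ↦ scale θ θ' y * θ.levi y (Y y : Tan m y) (Z y : Tan m y) :=
    funext fun y ↦ levi_scale_coe θ θ' _ _
  rw [h, der_mul (smooth_scale θ θ') (θ.smooth_levi hY hZ), der_scale θ θ']
  ring

/-- The change `Y ↦ ∇'_X Y - ∇_X Y` of the Tanaka-Webster connection along `H`. -/
def change (X ξ : C.H x) : C.H x →ₗ[ℝ] C.H x :=
  let L : C.H x → C.H x →ₗ[ℝ] ℝ := fun u ↦ θ.levi x (u : Tan m x) ∘ₗ (C.H x).subtype
  (1 / 2 : ℝ) • ((L (C.J x X)).smulRight ξ - (L X).smulRight (C.J x ξ)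
    + L (C.J x ξ) X • LinearMap.id - L ξ X • C.J x
    - (L ξ).smulRight (C.J x X) + (L (C.J x ξ)).smulRight X)

lemma change_apply (X ξ Y : C.H x) : (θ.change X ξ Y : Tan m x) = (1 / 2 : ℝ) •
    (θ.levi x (C.J x X : Tan m x) (Y : Tan m x) • (ξ : Tan m x)
    - θ.levi x (X : Tan m x) (Y : Tan m x) • (C.J x ξ : Tan m x)
    + θ.levi x (C.J x ξ : Tan m x) (X : Tan m x) • (Y : Tan m x)
    - θ.levi x (ξ : Tan m x) (X : Tan m x) • (C.J x Y : Tan m x)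
    - θ.levi x (ξ : Tan m x) (Y : Tan m x) • (C.J x X : Tan m x)
    + θ.levi x (C.J x ξ : Tan m x) (Y : Tan m x) • (X : Tan m x)) := rfl

lemma webster_change (hX : SmoothNear (C.vf X) x) (hY : SmoothNear (C.vf Y) x) :
    θ'.webster.toFun (C.vf Y) x (X x : Tan m x) =
      θ.webster.toFun (C.vf Y) x (X x : Tan m x) + θ.change (X x) (shift θ θ' x) (Y x) := by
  rw [← sub_eq_iff_eq_add', ← sub_eq_zero]
  refine θ'.eq_zero_of_levi ?_ fun v ↦ ?_
  · rw [map_sub, map_sub, θ'.vanish, form_webster θ' hY.self, form_eq_scale θ θ',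
      form_webster θ hY.self]
    simp
  obtain ⟨Z, rfl, hZ⟩ := C.exists_extend v
  have h1 := two_mul_levi_webster θ' hX hY hZ
  have h2 := two_mul_levi_webster θ hX hY hZ
  have h3 := der_levi_change θ θ' hY.self hZ.self (X x)
  have h4 := der_levi_change θ θ' hY.self (C.smooth_Jf hZ.self) (C.J x (X x))
  rw [koszul, levi_mixedBracket_change θ θ' hX.self hY.self,
    levi_mixedBracket_change θ θ' hX.self hZ.self, h3, h4] at h1
  rw [koszul] at h2
  have h5 : ∀ u v : C.H x, θ.levi x (u : Tan m x) (C.J x v : Tan m x) =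
      - θ.levi x (C.J x u : Tan m x) (v : Tan m x) := fun u v ↦ by rw [levi_J, neg_neg]
  have h6 : θ'.levi x (θ.webster.toFun (C.vf Y) x (X x : Tan m x)) (Z x : Tan m x) =
      scale θ θ' x * θ.levi x (θ.webster.toFun (C.vf Y) x (X x : Tan m x)) (Z x : Tan m x) := by
    rw [levi_change_H θ θ', form_webster θ hY.self]
    ring
  rw [map_sub, map_sub, LinearMap.sub_apply, LinearMap.sub_apply, h6, levi_scale_coe θ θ',
    change_apply]
  simp only [map_smul, map_add, map_sub, LinearMap.smul_apply, LinearMap.add_apply,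
    LinearMap.sub_apply, smul_eq_mul, h5, C.J_sq, Submodule.coe_neg, map_neg,
    LinearMap.neg_apply] at h1 ⊢
  linear_combination (1 / 2) * h1 - scale θ θ' x / 2 * h2

end PseudoHermitian

namespace PseudoHermitian

variable {C : CRStructure m M} (θ θ' : PseudoHermitian C) {x : M} {X Y Z : ∀ y, C.H y}
  {ε : Fin m → C.H x}

lemma IsUnitary.sum_levi_mul {θ : PseudoHermitian C} (hε : θ.IsUnitary x ε) (u v : C.H x) :
    ∑ α, (θ.levi x (u : Tan m x) (ε α : Tan m x) * θ.levi x (v : Tan m x) (ε α : Tan m x)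
      + θ.levi x (u : Tan m x) (C.J x (ε α) : Tan m x) *
        θ.levi x (v : Tan m x) (C.J x (ε α) : Tan m x)) =
      θ.levi x (u : Tan m x) (v : Tan m x) := by
  have h := hε.trace_eq (((θ.levi x (u : Tan m x)) ∘ₗ (C.H x).subtype).smulRight v)
  rw [LinearMap.trace_smulRight] at h
  refine Eq.trans ?_ h.symm
  refine Finset.sum_congr rfl fun α _ ↦ ?_
  simp

lemma change_J (X ξ Y : C.H x) : θ.change X ξ (C.J x Y) = C.J x (θ.change X ξ Y) := by
  ext1
  rw [← extJ_coe θ, change_apply, change_apply]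
  have h5 : ∀ u v : C.H x, θ.levi x (u : Tan m x) (C.J x v : Tan m x) =
      - θ.levi x (C.J x u : Tan m x) (v : Tan m x) := fun u v ↦ by rw [levi_J, neg_neg]
  simp only [map_smul, map_add, map_sub, extJ_coe, h5, C.J_sq, Submodule.coe_neg, map_neg,
    LinearMap.neg_apply]
  module

lemma IsUnitary.sum_change {θ : PseudoHermitian C} (hε : θ.IsUnitary x ε) (X ξ : C.H x) :
    ∑ α, θ.levi x (θ.change X ξ (ε α) : Tan m x) (C.J x (ε α) : Tan m x) =
      - ((m + 2) / 2) * θ.levi x (ξ : Tan m x) (X : Tan m x) := by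
  have h1 := hε.sum_levi_mul ξ X
  have h5 : ∀ u v : C.H x, θ.levi x (C.J x u : Tan m x) (v : Tan m x) =
      - θ.levi x (u : Tan m x) (C.J x v : Tan m x) := fun u v ↦ θ.levi_J x u v
  have h2 : ∀ α, θ.levi x (θ.change X ξ (ε α) : Tan m x) (C.J x (ε α) : Tan m x) =
      - (θ.levi x (ξ : Tan m x) (ε α : Tan m x) * θ.levi x (X : Tan m x) (ε α : Tan m x)
      + θ.levi x (ξ : Tan m x) (C.J x (ε α) : Tan m x) *
        θ.levi x (X : Tan m x) (C.J x (ε α) : Tan m x))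
      - (1 / 2) * θ.levi x (ξ : Tan m x) (X : Tan m x) := by
    intro α
    have h6 := (hε α α).2
    have h7 : θ.levi x (ε α : Tan m x) (ε α : Tan m x) = 1 := by rw [(hε α α).1, if_pos rfl]
    rw [change_apply]
    simp only [map_smul, map_add, map_sub, LinearMap.smul_apply, LinearMap.add_apply,
      LinearMap.sub_apply, smul_eq_mul, h5, C.J_sq, Submodule.coe_neg, map_neg, h6, h7]
    ring
  simp only [h2, Finset.sum_sub_distrib, Finset.sum_neg_distrib, h1]
  simp
  ring

/-- The change of the trace of the connection matrix along `H`. -/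
lemma connTrace_change (f : CRFrame C.toCRData) (hx : x ∈ f.U) (u : C.H x) :
    θ'.connTrace f x (u : Tan m x) = θ.connTrace f x (u : Tan m x)
      - ((m + 2) / 2) * θ.levi x (shift θ θ' x : Tan m x) (u : Tan m x) := by
  obtain ⟨X, rfl, hX⟩ := C.exists_extend u
  have h1 := (θ.isUnitary_onb x).sum_levi_J f hx (θ.change (X x) (shift θ θ' x))
    (θ.change_J (X x) (shift θ θ' x))
  rw [(θ.isUnitary_onb x).sum_change] at h1
  rw [connTrace_apply, connTrace_apply, sub_eq_add_neg, ← neg_mul, h1, ← Finset.sum_add_distrib]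
  refine Finset.sum_congr rfl fun α _ ↦ ?_
  refine (congrArg (fun z ↦ f.coord x z (some (Sum.inr α)))
    (webster_change θ θ' hX (f.smoothNear_hvec hx (Sum.inl α)))).trans ?_
  rw [map_add]
  rfl

lemma nijenhuis_J (hX : SmoothVFAt (C.vf X) x) (hY : SmoothVFAt (C.vf Y) x) :
    θ.nijenhuis X (C.Jf Y) x = - θ.extJ x (θ.nijenhuis X Y x) := by
  have hJX := C.smooth_Jf hX
  have hJY := C.smooth_Jf hY
  rw [nijenhuis, nijenhuis, bracket_Jf_Jf_right _ hY, bracket_Jf_Jf_right _ hY]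
  simp only [map_add, map_sub, map_neg, extJ_extJ, θ.form_bracket hJX hY, θ.form_bracket hX hJY,
    C.J_sq, levi_J_J, Submodule.coe_neg, LinearMap.neg_apply]
  module

lemma nijenhuis_self_J (hX : SmoothVFAt (C.vf X) x) : θ.nijenhuis X (C.Jf X) x = 0 := by
  have h : θ.nijenhuis X X x = 0 := by
    have h1 := θ.nijenhuis_swap (X := X) (Y := X) (x := x)
    have h2 : (2 : ℝ) • θ.nijenhuis X X x = 0 := by
      rw [two_smul]
      exact add_eq_zero_iff_eq_neg.2 h1
    exact (smul_eq_zero.1 h2).resolve_left two_ne_zero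
  rw [nijenhuis_J θ hX hX, h, map_zero, neg_zero]

/-- The bracket of sections of `H` in terms of the Tanaka-Webster connection. -/
lemma bracket_eq (hX : SmoothVFAt (C.vf X) x) (hY : SmoothVFAt (C.vf Y) x) :
    bracket (C.vf X) (C.vf Y) x =
      θ.webster.toFun (C.vf Y) x (X x : Tan m x) - θ.webster.toFun (C.vf X) x (Y x : Tan m x)
      - θ.levi x (C.J x (X x) : Tan m x) (Y x : Tan m x) • θ.reeb x
        + (1 / 4 : ℝ) • θ.nijenhuis X Y x := by
  rw [webster_torsion θ hX hY]
  module

lemma bracket_sub_J_bracket (hX : SmoothNear (C.vf X) x) (hY : SmoothNear (C.vf Y) x) :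
    bracket (C.vf X) (C.vf Y) x - θ.extJ x (bracket (C.vf X) (C.vf (C.Jf Y)) x) =
      (2 : ℝ) • θ.webster.toFun (C.vf Y) x (X x : Tan m x)
        - θ.webster.toFun (C.vf X) x (Y x : Tan m x)
        + θ.extJ x (θ.webster.toFun (C.vf X) x (C.J x (Y x) : Tan m x))
        - θ.levi x (C.J x (X x) : Tan m x) (Y x : Tan m x) • θ.reeb x := by
  rw [bracket_eq θ hX.self hY.self, bracket_eq θ hX.self (C.smooth_Jf hY.self),
    nijenhuis_J θ hX.self hY.self, webster_J θ hY]
  simp only [map_add, map_sub, map_smul, map_neg, extJ_extJ, extJ_reeb,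
    form_nijenhuis θ hX.self hY.self, form_webster θ hY.self]
  module

lemma scale_smul_bracket_reeb (Y : ∀ y, C.H y) :
    scale θ θ' x • bracket θ'.reeb (C.vf Y) x = bracket θ.reeb (C.vf Y) x
      + bracket (C.vf (shift θ θ')) (C.vf Y) x
      + θ.levi x (C.J x (shift θ θ' x) : Tan m x) (Y x : Tan m x) •
        (θ.reeb x + (shift θ θ' x : Tan m x)) := by
  have h1 := bracket_smul_left (Y := C.vf Y) (smooth_scale θ θ') (θ'.smooth_reeb x)
  have h2 : bracket (scale θ θ' • θ'.reeb) (C.vf Y) x =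
      bracket (θ.reeb + C.vf (shift θ θ')) (C.vf Y) x :=
    bracket_congr (Filter.Eventually.of_forall fun y ↦ scale_smul_reeb θ θ' y)
      (Filter.Eventually.of_forall fun _ ↦ rfl)
  rw [h2, bracket_add_left (θ.smooth_reeb x) (smooth_shift θ θ' x)] at h1
  have h3 := der_scale θ θ' (Y x)
  have h4 : der m (scale θ θ') x (C.vf Y x) = _ := h3
  rw [h4] at h1
  rw [← scale_smul_reeb θ θ', h1]
  module

/-- The change of the Tanaka-Webster connection along the Reeb field. -/
lemma scale_smul_webster_reeb (hY : SmoothNear (C.vf Y) x) :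
    scale θ θ' x • θ'.webster.toFun (C.vf Y) x (θ'.reeb x) =
      θ.webster.toFun (C.vf Y) x (θ.reeb x)
      + θ.webster.toFun (C.vf Y) x (shift θ θ' x : Tan m x)
      - (1 / 2 : ℝ) • (θ.webster.toFun (C.vf (shift θ θ')) x (Y x : Tan m x)
        - θ.extJ x (θ.webster.toFun (C.vf (shift θ θ')) x (C.J x (Y x) : Tan m x)))
      + (1 / 2 : ℝ) •
        (θ.levi x (C.J x (shift θ θ' x) : Tan m x) (Y x : Tan m x) • (shift θ θ' x : Tan m x)
        - θ.levi x (shift θ θ' x : Tan m x) (Y x : Tan m x) •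
          (C.J x (shift θ θ' x) : Tan m x)) := by
  have hJY := C.smooth_Jf hY.self
  have h1 := bracket_sub_J_bracket θ (smoothNear_shift θ θ' x) hY
  have h2 : θ'.extJ x (bracket θ'.reeb (C.vf (C.Jf Y)) x) =
      θ.extJ x (bracket θ'.reeb (C.vf (C.Jf Y)) x) := by
    have h3 := form_eq_scale θ θ' (bracket θ'.reeb (C.vf (C.Jf Y)) x)
    rw [form_bracket_reeb θ' hJY] at h3
    have h4 := (mul_eq_zero.1 h3.symm).resolve_left (scale_ne_zero θ θ')
    rw [extJ_change θ θ', h4, zero_smul, sub_zero]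
  have h5 := congrArg (θ.extJ x) (scale_smul_bracket_reeb θ θ' (x := x) (C.Jf Y))
  rw [map_smul] at h5
  rw [webster_along_reeb θ' hY.self, webster_along_reeb θ hY.self, reebBracket, reebBracket,
    h2, smul_comm, smul_sub, h5, scale_smul_bracket_reeb θ θ' Y]
  simp only [map_add, map_smul, extJ_reeb, extJ_coe, zero_add, levi_J_J, CRData.Jf]
  have h6 : θ.webster.toFun (C.vf Y) x (shift θ θ' x : Tan m x) = (1 / 2 : ℝ) • (
      bracket (C.vf (shift θ θ')) (C.vf Y) x
        - θ.extJ x (bracket (C.vf (shift θ θ')) (C.vf (C.Jf Y)) x)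
        + θ.webster.toFun (C.vf (shift θ θ')) x (Y x : Tan m x)
        - θ.extJ x (θ.webster.toFun (C.vf (shift θ θ')) x (C.J x (Y x) : Tan m x))
        + θ.levi x (C.J x (shift θ θ' x) : Tan m x) (Y x : Tan m x) • θ.reeb x) := by
    rw [h1]
    module
  rw [h6]
  module

end PseudoHermitian

lemma der_const_mul {x : M} {h : M → ℝ} (c : ℝ) (hh : SmoothAt m h x) (v : Tan m x) :
    der m (fun y ↦ c * h y) x v = c * der m h x v := by
  rw [der_mul contMDiffAt_const hh, der_const]
  ring

namespace PseudoHermitian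

variable {C : CRStructure m M} (θ θ' : PseudoHermitian C) {x : M} {X Y Z : ∀ y, C.H y}
  {ε : Fin m → C.H x}

/-- The trace of the skew-symmetric part of `∇ξ`, where `ξ = λ T' - T`. -/
def shiftTrace (ε : Fin m → C.H x) : ℝ :=
  ∑ α, (θ.levi x (θ.webster.toFun (C.vf (shift θ θ')) x (ε α : Tan m x)) (C.J x (ε α) : Tan m x)
    - θ.levi x (θ.webster.toFun (C.vf (shift θ θ')) x (C.J x (ε α) : Tan m x)) (ε α : Tan m x))

/-- The square length of `ξ = λ T' - T`. -/
def shiftSq (x : M) : ℝ := θ.levi x (shift θ θ' x : Tan m x) (shift θ θ' x : Tan m x)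

/-- The change of the trace of the connection matrix along the Reeb field. -/
lemma IsUnitary.connTrace_change_reeb {θ : PseudoHermitian C} (hε : θ.IsUnitary x ε)
    (f : CRFrame C.toCRData) (hx : x ∈ f.U) :
    θ'.connTrace f x (θ.reeb x) = θ.connTrace f x (θ.reeb x) - shiftTrace θ θ' ε / 2
      + (m + 1) / 2 * shiftSq θ θ' x := by
  let ξ : C.H x := shift θ θ' x
  let D : C.H x →ₗ[ℝ] C.H x := θ.projH x ∘ₗ
    (θ.webster.toFun (C.vf (shift θ θ')) x).toLinearMap ∘ₗ (C.H x).subtype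
  have hD : ∀ u : C.H x, (D u : Tan m x) =
      θ.webster.toFun (C.vf (shift θ θ')) x (u : Tan m x) := fun u ↦ by
    have h := θ.projH_apply x (θ.webster.toFun (C.vf (shift θ θ')) x (u : Tan m x))
    rw [form_webster θ (smooth_shift θ θ' x), zero_smul, sub_zero] at h
    exact h
  let Λ : C.H x → C.H x →ₗ[ℝ] ℝ := fun u ↦ θ.levi x (u : Tan m x) ∘ₗ (C.H x).subtype
  let Ψ : C.H x →ₗ[ℝ] C.H x := (1 / 2 : ℝ) • ((Λ (C.J x ξ)).smulRight ξ
    - (Λ ξ).smulRight (C.J x ξ)) - (1 / 2 : ℝ) • (D - C.J x ∘ₗ D ∘ₗ C.J x)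
  have hΨ : ∀ u, Ψ u = (1 / 2 : ℝ) • (θ.levi x (C.J x ξ : Tan m x) (u : Tan m x) • ξ
      - θ.levi x (ξ : Tan m x) (u : Tan m x) • C.J x ξ)
      - (1 / 2 : ℝ) • (D u - C.J x (D (C.J x u))) := fun u ↦ rfl
  have h5 : ∀ u v : C.H x, θ.levi x (C.J x u : Tan m x) (v : Tan m x) =
      - θ.levi x (u : Tan m x) (C.J x v : Tan m x) := fun u v ↦ θ.levi_J x u v
  have hΨJ : ∀ u, Ψ (C.J x u) = C.J x (Ψ u) := fun u ↦ by
    simp only [hΨ, map_sub, map_smul, C.J_sq, map_neg, h5, Submodule.coe_neg]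
    module
  have h1 := hε.sum_levi_J f hx Ψ hΨJ
  have h2 : ∀ α, scale θ θ' x • θ'.webster.toFun (C.vf (f.e α)) x (θ'.reeb x) =
      θ.webster.toFun (C.vf (f.e α)) x (θ.reeb x) +
        θ.webster.toFun (C.vf (f.e α)) x (ξ : Tan m x) + (Ψ (f.e α x) : Tan m x) := by
    intro α
    refine (scale_smul_webster_reeb θ θ' (f.smoothNear_hvec hx (Sum.inl α))).trans ?_
    rw [hΨ, Submodule.coe_sub, Submodule.coe_smul, Submodule.coe_smul, Submodule.coe_sub,
      Submodule.coe_sub, Submodule.coe_smul, Submodule.coe_smul, ← extJ_coe θ (D _), hD, hD]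
    have h6 : f.hvec (Sum.inl α) x = f.e α x := rfl
    have h7 : f.hvec (Sum.inl α) = f.e α := rfl
    rw [h6, h7]
    module
  have h3 : scale θ θ' x * θ'.connTrace f x (θ'.reeb x) = θ.connTrace f x (θ.reeb x)
      + θ.connTrace f x (ξ : Tan m x) +
      ∑ α, f.coord x (Ψ (f.e α x) : Tan m x) (some (Sum.inr α)) := by
    rw [connTrace_apply, connTrace_apply, connTrace_apply, Finset.mul_sum,
      ← Finset.sum_add_distrib, ← Finset.sum_add_distrib]
    refine Finset.sum_congr rfl fun α _ ↦ ?_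
    have h4 := congrArg (fun z ↦ f.coord x z (some (Sum.inr α))) (h2 α)
    simp only [map_smul, map_add, Pi.smul_apply, Pi.add_apply, smul_eq_mul] at h4
    exact h4
  have h4 := congrArg (θ'.connTrace f x) (scale_smul_reeb θ θ' x)
  rw [map_smul, map_add, connTrace_change θ θ' f hx (shift θ θ' x), smul_eq_mul, h3, ← h1] at h4
  have h8 : ∀ α, θ.levi x (Ψ (ε α) : Tan m x) (C.J x (ε α) : Tan m x) =
      - (1 / 2) * (θ.levi x (ξ : Tan m x) (ε α : Tan m x) * θ.levi x (ξ : Tan m x) (ε α : Tan m x)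
        + θ.levi x (ξ : Tan m x) (C.J x (ε α) : Tan m x) *
          θ.levi x (ξ : Tan m x) (C.J x (ε α) : Tan m x))
      - (1 / 2) *
      (θ.levi x (θ.webster.toFun (C.vf (shift θ θ')) x (ε α : Tan m x)) (C.J x (ε α) : Tan m x)
    - θ.levi x (θ.webster.toFun (C.vf (shift θ θ')) x (C.J x (ε α) : Tan m x)) (ε α : Tan m x)) := by
    intro α
    rw [← hD, ← hD, hΨ]
    simp only [Submodule.coe_sub, Submodule.coe_smul, map_sub, map_smul, LinearMap.sub_apply,
      LinearMap.smul_apply, smul_eq_mul, h5, C.J_sq, Submodule.coe_neg, map_neg]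
    ring
  simp only [h8, Finset.sum_sub_distrib, ← Finset.mul_sum, hε.sum_levi_mul] at h4
  rw [shiftTrace, shiftSq, Finset.sum_sub_distrib]
  linarith

lemma connTrace_change' (f : CRFrame C.toCRData) (hx : x ∈ f.U) (v : Tan m x) :
    θ'.connTrace f x v = θ.connTrace f x v
      - ((m + 2) / 2) * θ.levi x (shift θ θ' x : Tan m x) v
      + θ.form x v * (θ'.connTrace f x (θ.reeb x) - θ.connTrace f x (θ.reeb x)) := by
  have h1 := connTrace_change θ θ' f hx (θ.projH x v)
  rw [levi_projH_right, projH_apply, map_sub, map_sub, map_smul, map_smul, smul_eq_mul,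
    smul_eq_mul] at h1
  linarith

lemma extDer_connTrace_change (f : CRFrame C.toCRData) (hx : x ∈ f.U)
    (hX : SmoothNear (C.vf X) x) :
    extDer (θ'.connTrace f) (C.vf X) (C.vf (C.Jf X)) x =
      extDer (θ.connTrace f) (C.vf X) (C.vf (C.Jf X)) x - (m + 2) / 2 *
        (θ.levi x (θ.webster.toFun (C.vf (shift θ θ')) x (X x : Tan m x))
          (C.J x (X x) : Tan m x)
        - θ.levi x (θ.webster.toFun (C.vf (shift θ θ')) x (C.J x (X x) : Tan m x))
          (X x : Tan m x))
      + θ.levi x (X x : Tan m x) (X x : Tan m x) *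
        (θ'.connTrace f x (θ.reeb x) - θ.connTrace f x (θ.reeb x)) := by
  have hJX := C.smoothNear_Jf hX
  have hξ := smooth_shift θ θ' x
  have key : ∀ {Y : ∀ y, C.H y}, SmoothVFAt (C.vf Y) x → ∀ v,
      der m (fun y ↦ θ'.connTrace f y (C.vf Y y)) x v =
        der m (fun y ↦ θ.connTrace f y (C.vf Y y)) x v - (m + 2) / 2 *
          (θ.levi x (θ.webster.toFun (C.vf (shift θ θ')) x v) (Y x : Tan m x)
          + θ.levi x (shift θ θ' x : Tan m x) (θ.webster.toFun (C.vf Y) x v)) := by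
    intro Y hY v
    have h1 : ∀ᶠ y in 𝓝 x, θ'.connTrace f y (C.vf Y y) = θ.connTrace f y (C.vf Y y)
        - ((m + 2) / 2) * θ.levi y (shift θ θ' y : Tan m y) (Y y : Tan m y) := by
      filter_upwards [f.eventually_mem hx] with y hy using connTrace_change θ θ' f hy (Y y)
    have h2 : SmoothAt m (fun y ↦ θ.levi y (shift θ θ' y : Tan m y) (Y y : Tan m y)) x :=
      θ.smooth_levi hξ hY
    have h2' : SmoothAt m (fun y ↦ ((m : ℝ) + 2) / 2 *
        θ.levi y (shift θ θ' y : Tan m y) (Y y : Tan m y)) x := contMDiffAt_const.mul h2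
    have h3 := θ.levi_webster hξ hY v
    rw [der_congr h1, der_sub (θ.smooth_connTrace f hx _ hY) h2', der_const_mul _ h2, h3]
  have hb := bracket_eq θ hX.self hJX.self
  rw [nijenhuis_self_J θ hX.self, smul_zero, add_zero] at hb
  have h1 : θ.levi x (shift θ θ' x : Tan m x) (bracket (C.vf X) (C.vf (C.Jf X)) x) =
      θ.levi x (shift θ θ' x : Tan m x) (θ.webster.toFun (C.vf (C.Jf X)) x (X x : Tan m x)) -
      θ.levi x (shift θ θ' x : Tan m x)
        (θ.webster.toFun (C.vf X) x (C.J x (X x) : Tan m x)) := by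
    rw [hb, map_sub, map_sub, map_smul, levi_reeb_right, smul_zero, sub_zero]
  have h2 : θ.form x (bracket (C.vf X) (C.vf (C.Jf X)) x) =
      - θ.levi x (X x : Tan m x) (X x : Tan m x) := by
    rw [θ.form_bracket hX.self hJX.self, levi_J_J]
  rw [extDer, extDer, key hX.self, key hJX.self,
    connTrace_change' θ θ' f hx (bracket (C.vf X) (C.vf (C.Jf X)) x), h1, h2]
  ring

lemma IsUnitary.smul {θ : PseudoHermitian C} (hε : θ.IsUnitary x ε) (hm : 1 ≤ m) :
    θ'.IsUnitary x fun α ↦ (Real.sqrt (scale θ θ' x))⁻¹ • ε α := by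
  have h0 := scale_pos θ θ' (x := x) hm
  have h1 : (Real.sqrt (scale θ θ' x))⁻¹ * ((Real.sqrt (scale θ θ' x))⁻¹ * scale θ θ' x) = 1 := by
    have h2 := Real.mul_self_sqrt h0.le
    have h3 := (Real.sqrt_pos.2 h0).ne'
    nth_rewrite 3 [← h2]
    field_simp
  intro α β
  rw [map_smul (C.J x), levi_scale_coe θ θ', levi_scale_coe θ θ']
  simp only [Submodule.coe_smul, map_smul, LinearMap.smul_apply, smul_eq_mul, (hε α β).1,
    (hε α β).2, mul_zero, and_true]
  by_cases h : α = β
  · simp only [h, if_true]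
    linarith
  · simp [h]

/-- The change of the Webster scalar curvature. -/
lemma IsUnitary.scal_change {θ : PseudoHermitian C} (hε : θ.IsUnitary x ε) (hm : 1 ≤ m) :
    scale θ θ' x * θ'.scal x = θ.scal x + (m + 1) * shiftTrace θ θ' ε
      - m * (m + 1) / 2 * shiftSq θ θ' x := by
  set f := C.frameAt x
  have hx : x ∈ f.U := C.mem_frameAt x
  obtain ⟨β, hβ, hβ'⟩ := exists_extDer C (θ.smooth_connTrace f hx)
  obtain ⟨γ, hγ, hγ'⟩ := exists_extDer C (θ'.smooth_connTrace f hx)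
  have h0 := scale_pos θ θ' (x := x) hm
  have h1 := hε.scal_eq f hx β hβ hβ'
  have h2 := (hε.smul θ' hm).scal_eq f hx γ hγ hγ'
  have h3 : (Real.sqrt (scale θ θ' x))⁻¹ * (Real.sqrt (scale θ θ' x))⁻¹ =
      (scale θ θ' x)⁻¹ := by
    rw [← mul_inv, Real.mul_self_sqrt h0.le]
  have h4 : θ'.scal x = - ((scale θ θ' x)⁻¹ *
      ∑ α, γ (ε α : Tan m x) (C.J x (ε α) : Tan m x)) := by
    rw [h2, Finset.mul_sum, ← h3]
    refine congrArg _ (Finset.sum_congr rfl fun α _ ↦ ?_)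
    rw [map_smul (C.J x), Submodule.coe_smul, Submodule.coe_smul, map_smul, map_smul,
      LinearMap.smul_apply, smul_eq_mul, smul_eq_mul]
    ring
  have h5 : ∀ α, γ (ε α : Tan m x) (C.J x (ε α) : Tan m x) =
      β (ε α : Tan m x) (C.J x (ε α) : Tan m x) - (m + 2) / 2 *
        (θ.levi x (θ.webster.toFun (C.vf (shift θ θ')) x (ε α : Tan m x))
          (C.J x (ε α) : Tan m x)
        - θ.levi x (θ.webster.toFun (C.vf (shift θ θ')) x (C.J x (ε α) : Tan m x))
          (ε α : Tan m x))
      + (θ'.connTrace f x (θ.reeb x) - θ.connTrace f x (θ.reeb x)) := by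
    intro α
    obtain ⟨X, hXε, hX⟩ := C.exists_extend (ε α)
    have h6 := extDer_connTrace_change θ θ' f hx hX
    rw [hβ' _ _ hX.self (C.smooth_Jf hX.self), hγ' _ _ hX.self (C.smooth_Jf hX.self)] at h6
    simp only [CRData.vf, CRData.Jf, hXε] at h6
    rw [(hε α α).1, if_pos rfl, one_mul] at h6
    exact h6
  have h6 : scale θ θ' x * θ'.scal x = - ∑ α, γ (ε α : Tan m x) (C.J x (ε α) : Tan m x) := by
    rw [h4]
    field_simp
  rw [h6, h1]
  simp only [h5, Finset.sum_add_distrib, Finset.sum_sub_distrib, ← Finset.mul_sum]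
  rw [hε.connTrace_change_reeb θ' f hx, shiftTrace, Finset.sum_sub_distrib]
  simp only [Finset.sum_const, Finset.card_univ, Fintype.card_fin, nsmul_eq_mul]
  ring

open CircleBundle

variable (ℓ : ImaginaryForm m M)

lemma connForm_im (p : CircleBundle C) (w : FTan p) : (θ.connForm ℓ p w).im =
    ((fibreCoord p p)⁻¹ * dfibreCoord p w).im + (θ.canonicalConnection p.proj (dproj p w)).im
      - θ.scal p.proj / (2 * (m + 1)) * θ.form p.proj (dproj p w)
      + (ℓ.form p.proj (dproj p w)).im := by
  have h : (Complex.I / (2 * (m + 1)) * θ.scal p.proj) * (θ.form p.proj (dproj p w) : ℝ) =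
      ((θ.scal p.proj / (2 * (m + 1)) * θ.form p.proj (dproj p w) : ℝ) : ℂ) * Complex.I := by
    push_cast; ring
  have hI : ∀ r : ℝ, ((r : ℂ) * Complex.I).im = r := fun r ↦ by simp
  rw [connForm_apply, h, Complex.add_im, Complex.sub_im, mul_comm Complex.I, hI, hI, Complex.add_im]

/-- The change of the connection form `A_{θ,ℓ}`. -/
lemma connForm_change (hm : 1 ≤ m) (p : CircleBundle C) (w : FTan p) :
    (θ'.connForm ℓ p w).im = (θ.connForm ℓ p w).im + (m + 2) / 2 *
      (θ.levi p.proj (shift θ θ' p.proj : Tan m p.proj) (dproj p w)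
        - shiftSq θ θ' p.proj / 2 * θ.form p.proj (dproj p w)) := by
  have hε := θ.isUnitary_onb p.proj
  have h1 := hε.scal_change θ' hm
  have h2 := hε.connTrace_change_reeb θ' (C.frameAt p.proj) (C.mem_frameAt p.proj)
  have h3 := connTrace_change' θ θ' (C.frameAt p.proj) (C.mem_frameAt p.proj) (dproj p w)
  rw [connForm_im, connForm_im, canonicalConnection_im, canonicalConnection_im, h3, h2,
    form_eq_scale θ θ']
  have h4 : θ'.scal p.proj / (2 * (m + 1)) * (scale θ θ' p.proj * θ.form p.proj (dproj p w)) =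
      (scale θ θ' p.proj * θ'.scal p.proj) / (2 * (m + 1)) * θ.form p.proj (dproj p w) := by ring
  rw [h4, h1]
  have h5 : (m : ℝ) + 1 ≠ 0 := by positivity
  field_simp
  ring

end PseudoHermitian

/-! ## Conformal invariance of the Fefferman space and of `J_CR` -/

open CircleBundle in
lemma contMDiff_baseProj {C : CRStructure m M} :
    ContMDiff (model m) 𝓘(ℝ, CRModel m) ∞ (CircleBundle.proj : CircleBundle C → M) := by
  intro p
  have h : ∀ q : CircleBundle C, extChartAt 𝓘(ℝ, CRModel m) p.proj q.proj =
      (extChartAt (model m) p q).1 := fun q ↦ rfl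
  let e : OpenPartialHomeomorph (CircleBundle C) (M × Circle) := chartAt (M × Circle) p
  have hc : ContinuousAt (CircleBundle.proj : CircleBundle C → M) p :=
    continuousAt_fst.comp (e.continuousAt (mem_chart_source _ p))
  refine contMDiffAt_iff.2 ⟨hc, ?_⟩
  refine contDiff_fst.contDiffWithinAt.congr_of_eventuallyEq ?_ ?_
  · filter_upwards [extChartAt_target_mem_nhdsWithin (I := model m) p] with y hy
    exact (h _).trans (congrArg Prod.fst ((extChartAt (model m) p).right_inv hy))
  · exact (h _).trans (congrArg Prod.fst
      ((extChartAt (model m) p).right_inv (mem_extChartAt_target p)))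

namespace PseudoHermitian

open CircleBundle

variable {C : CRStructure m M} (θ θ' : PseudoHermitian C) (ℓ : ImaginaryForm m M)

lemma fefferman_val (p : CircleBundle C) (v w : FTan p) : (θ.fefferman ℓ).val p v w =
    θ.levi p.proj (dproj p v) (dproj p w) + 2 / (m + 2) *
      (θ.form p.proj (dproj p v) * (θ.connForm ℓ p w).im
        + θ.form p.proj (dproj p w) * (θ.connForm ℓ p v).im) := θ.feffermanForm_apply ℓ p v w

lemma connForm_vert_im (p : CircleBundle C) :
    (θ.connForm ℓ p (θ.vert ℓ p)).im = ((m : ℝ) + 2) / 2 :=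
  congrArg Prod.snd ((θ.split ℓ p).apply_symm_apply (0, ((m : ℝ) + 2) / 2))

lemma connForm_hlift_im (p : CircleBundle C) (v : Tan m p.proj) :
    (θ.connForm ℓ p (θ.hlift ℓ p v)).im = 0 := by rw [connForm_hlift]; rfl

/-- Tangent vectors of `F_c` are determined by their projection and by the connection form. -/
lemma ext_FTan {p : CircleBundle C} {v w : FTan p} (h : dproj p v = dproj p w)
    (h' : (θ.connForm ℓ p v).im = (θ.connForm ℓ p w).im) : v = w :=
  (θ.split ℓ p).injective (Prod.ext h h')

lemma eq_hlift_add (p : CircleBundle C) (w : FTan p) : w = θ.hlift ℓ p (dproj p w) +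
    (2 / (m + 2) * (θ.connForm ℓ p w).im) • θ.vert ℓ p := by
  refine θ.ext_FTan ℓ ?_ ?_
  · rw [map_add, map_smul, dproj_hlift, dproj_vert, smul_zero, add_zero]
  · rw [map_add, map_smul, Complex.add_im, Complex.smul_im, connForm_hlift_im, connForm_vert_im,
      smul_eq_mul]
    field_simp
    ring

lemma fefferman_vert (p : CircleBundle C) (w : FTan p) :
    (θ.fefferman ℓ).val p (θ.vert ℓ p) w = θ.form p.proj (dproj p w) := by
  rw [fefferman_val, dproj_vert, connForm_vert_im]
  simp only [map_zero, LinearMap.zero_apply, zero_mul, zero_add]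
  field_simp

lemma fefferman_hlift (p : CircleBundle C) (u : Tan m p.proj) (w : FTan p) :
    (θ.fefferman ℓ).val p (θ.hlift ℓ p u) w = θ.levi p.proj u (dproj p w)
      + 2 / (m + 2) * (θ.form p.proj u * (θ.connForm ℓ p w).im) := by
  rw [fefferman_val, dproj_hlift, connForm_hlift_im]
  ring

lemma slotForm_apply (p : CircleBundle C) (w : FTan p) :
    θ.slotForm ℓ p w = - (θ.connForm ℓ p w).im / (m + 2) := by
  have h1 : θ.slotForm ℓ p w =
      ((2 * Complex.I / (((2 * m + 1 : ℕ) : ℂ) + 3)) * θ.connForm ℓ p w).re := rfl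
  have h2 : (2 * Complex.I / (((2 * m + 1 : ℕ) : ℂ) + 3)) * ((θ.connForm ℓ p w).im * Complex.I) =
      ((- (θ.connForm ℓ p w).im / (m + 2) : ℝ) : ℂ) := by
    have h3 : ((m : ℂ) + 2) ≠ 0 := by exact_mod_cast (by positivity : ((m : ℝ) + 2) ≠ 0)
    have h4 : (((2 * m + 1 : ℕ) : ℂ) + 3) = 2 * (m + 2) := by push_cast; ring
    rw [h4]
    push_cast
    field_simp
    linear_combination ((θ.connForm ℓ p w).im : ℂ) * Complex.I_sq
  exact h1.trans ((congrArg Complex.re ((congrArg (_ * ·) (θ.connForm_eq ℓ p w)).trans h2)).trans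
    (Complex.ofReal_re _))

lemma sharp_slotForm (p : CircleBundle C) :
    (θ.fefferman ℓ).sharp p (θ.slotForm ℓ p) =
      (-(1 / 2) : ℝ) • θ.hlift ℓ p (θ.reeb p.proj) := by
  refine MetricField.sharp_eq _ _ _ _ fun w ↦ ?_
  rw [map_smul, LinearMap.smul_apply, fefferman_hlift, slotForm_apply, levi_reeb, form_reeb,
    smul_eq_mul]
  ring

/-- The matrix of `J_CR` with respect to the Fefferman metric. -/
lemma slotMatrix_apply (p : CircleBundle C) (a b : ℝ) (w : FTan p) :
    slotMatrix (θ.fefferman ℓ) p ((2 : ℝ) • θ.vert ℓ p) (θ.liftJ ℓ p) (θ.slotForm ℓ p) (a, w, b) =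
      (- (θ.connForm ℓ p w).im / (m + 2),
        a • (2 : ℝ) • θ.vert ℓ p + θ.hlift ℓ p (θ.extJ p.proj (dproj p w))
          + (b / 2) • θ.hlift ℓ p (θ.reeb p.proj),
        - (2 * θ.form p.proj (dproj p w))) := by
  have h1 : slotMatrix (θ.fefferman ℓ) p ((2 : ℝ) • θ.vert ℓ p) (θ.liftJ ℓ p) (θ.slotForm ℓ p)
      (a, w, b) = (θ.slotForm ℓ p w, a • (2 : ℝ) • θ.vert ℓ p + θ.liftJ ℓ p w
        - b • (θ.fefferman ℓ).sharp p (θ.slotForm ℓ p),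
        - (θ.fefferman ℓ).val p ((2 : ℝ) • θ.vert ℓ p) w) := rfl
  have h2 : θ.liftJ ℓ p w = θ.hlift ℓ p (θ.extJ p.proj (dproj p w)) := rfl
  rw [h1, h2, slotForm_apply, sharp_slotForm, map_smul, LinearMap.smul_apply, fefferman_vert,
    smul_eq_mul]
  refine Prod.ext rfl (Prod.ext ?_ rfl)
  module

lemma slotMatrix_sq (p : CircleBundle C) (t : ℝ × FTan p × ℝ) :
    slotMatrix (θ.fefferman ℓ) p ((2 : ℝ) • θ.vert ℓ p) (θ.liftJ ℓ p) (θ.slotForm ℓ p)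
      (slotMatrix (θ.fefferman ℓ) p ((2 : ℝ) • θ.vert ℓ p) (θ.liftJ ℓ p) (θ.slotForm ℓ p) t) =
      - t := by
  obtain ⟨a, w, b⟩ := t
  rw [slotMatrix_apply, slotMatrix_apply]
  have hm : (m : ℝ) + 2 ≠ 0 := by positivity
  simp only [map_add, map_smul, dproj_vert, dproj_hlift, Complex.add_im, Complex.smul_im,
    connForm_vert_im, connForm_hlift_im, smul_eq_mul, mul_zero, add_zero, smul_zero, zero_add,
    form_extJ, form_reeb, extJ_extJ, extJ_reeb, mul_one]
  refine Prod.ext ?_ (Prod.ext ?_ ?_)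
  · change _ = - a
    field_simp
  · change _ = - w
    conv_rhs => rw [θ.eq_hlift_add ℓ p w]
    rw [map_sub, map_smul]
    module
  · change _ = - b
    ring

lemma vert_change (hm : 1 ≤ m) (p : CircleBundle C) : θ'.vert ℓ p = θ.vert ℓ p := by
  refine θ'.ext_FTan ℓ ?_ ?_
  · rw [dproj_vert, dproj_vert]
  · rw [connForm_vert_im, connForm_change θ θ' ℓ hm, dproj_vert, connForm_vert_im]
    simp

lemma hlift_change (hm : 1 ≤ m) (p : CircleBundle C) (u : Tan m p.proj) :
    θ'.hlift ℓ p u = θ.hlift ℓ p u - (θ.levi p.proj (shift θ θ' p.proj : Tan m p.proj) u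
      - shiftSq θ θ' p.proj / 2 * θ.form p.proj u) • θ.vert ℓ p := by
  refine θ'.ext_FTan ℓ ?_ ?_
  · rw [map_sub, map_smul, dproj_hlift, dproj_hlift, dproj_vert, smul_zero, sub_zero]
  · rw [connForm_hlift_im, connForm_change θ θ' ℓ hm]
    simp only [map_sub, map_smul, dproj_hlift, dproj_vert, Complex.sub_im, Complex.smul_im,
      connForm_hlift_im, connForm_vert_im, smul_eq_mul, sub_zero, smul_zero]
    ring

/-- The function `φ` with `θ' = e^{2φ} θ`, on `F_c`. -/
def logScale (p : CircleBundle C) : ℝ := Real.log (scale θ θ' p.proj) / 2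

lemma exp_two_logScale (hm : 1 ≤ m) (p : CircleBundle C) :
    Real.exp (2 * logScale θ θ' p) = scale θ θ' p.proj := by
  rw [logScale, mul_div_cancel₀ _ two_ne_zero, Real.exp_log (scale_pos θ θ' hm)]

lemma smooth_logScale (hm : 1 ≤ m) (x : M) :
    SmoothAt m (fun y ↦ Real.log (scale θ θ' y) / 2) x := by
  have h : ContDiffAt ℝ ∞ (fun r : ℝ ↦ Real.log r / 2) (scale θ θ' x) :=
    (Real.contDiffAt_log.2 (scale_pos θ θ' hm).ne').div_const 2
  exact h.contMDiffAt.comp x (smooth_scale θ θ')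

lemma conformallyRelated (hm : 1 ≤ m) :
    ConformallyRelated (θ.fefferman ℓ) (θ'.fefferman ℓ) (logScale θ θ') := by
  refine ⟨fun p ↦ (smooth_logScale θ θ' hm p.proj).comp p (contMDiff_baseProj p), fun p v w ↦ ?_⟩
  have h : (m : ℝ) + 2 ≠ 0 := by positivity
  rw [exp_two_logScale θ θ' hm, fefferman_val, fefferman_val, connForm_change θ θ' ℓ hm,
    connForm_change θ θ' ℓ hm, levi_change θ θ', form_eq_scale θ θ', form_eq_scale θ θ', shiftSq]
  field_simp
  ring

lemma der_logScale (hm : 1 ≤ m) {x : M} (v : Tan m x) :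
    der m (fun y ↦ Real.log (scale θ θ' y) / 2) x v =
      (1 / 2) * θ.levi x (C.J x (shift θ θ' x) : Tan m x) v
      + der m (fun y ↦ Real.log (scale θ θ' y) / 2) x (θ.reeb x) * θ.form x v := by
  have h0 := (scale_pos θ θ' (x := x) hm).ne'
  have h1 : HasDerivAt (fun r : ℝ ↦ Real.log r / 2) ((scale θ θ' x)⁻¹ / 2) (scale θ θ' x) :=
    (Real.hasDerivAt_log h0).div_const 2
  have h2 := h1.hasFDerivAt.hasMFDerivAt.comp x (smooth_scale θ θ').mdiff.hasMFDerivAt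
  have h3 : ∀ v : Tan m x, der m (fun y ↦ Real.log (scale θ θ' y) / 2) x v =
      der m (scale θ θ') x v * ((scale θ θ' x)⁻¹ / 2) := fun v ↦ congr($(h2.mfderiv) v)
  have h4 := h3 (θ.projH x v)
  rw [der_scale θ θ', levi_projH_right, projH_apply, map_sub, map_smul, smul_eq_mul] at h4
  have h5 : scale θ θ' x * θ.levi x (C.J x (shift θ θ' x) : Tan m x) v *
      ((scale θ θ' x)⁻¹ / 2) = (1 / 2) * θ.levi x (C.J x (shift θ θ' x) : Tan m x) v := by
    field_simp
  rw [h5] at h4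
  linarith

/-- The derivative of `φ` along the Reeb field. -/
def reebDer (x : M) : ℝ := der m (fun y ↦ Real.log (scale θ θ' y) / 2) x (θ.reeb x)

lemma mvfderiv_logScale (hm : 1 ≤ m) (p : CircleBundle C) (w : FTan p) :
    mvfderiv (model m) (logScale θ θ') p w =
      (1 / 2) * θ.levi p.proj (C.J p.proj (shift θ θ' p.proj) : Tan m p.proj) (dproj p w)
      + reebDer θ θ' p.proj * θ.form p.proj (dproj p w) := by
  have h1 := (smooth_logScale θ θ' hm p.proj).mdiff.hasMFDerivAt.comp p
    ((contMDiff_baseProj p).mdifferentiableAt (n := ∞) (by simp)).hasMFDerivAt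
  exact (congr($(h1.mfderiv) w)).trans (der_logScale θ θ' hm (dproj p w))

lemma sharp_logScale (hm : 1 ≤ m) (p : CircleBundle C) :
    (θ.fefferman ℓ).sharp p (mvfderiv (model m) (logScale θ θ') p).toLinearMap =
      (1 / 2 : ℝ) • θ.hlift ℓ p (C.J p.proj (shift θ θ' p.proj) : Tan m p.proj)
        + reebDer θ θ' p.proj • θ.vert ℓ p := by
  refine MetricField.sharp_eq _ _ _ _ fun w ↦ ?_
  rw [map_add, map_smul, map_smul, LinearMap.add_apply, LinearMap.smul_apply,
    LinearMap.smul_apply, fefferman_vert, fefferman_hlift, θ.vanish]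
  refine Eq.trans ?_ (mvfderiv_logScale θ θ' hm p w).symm
  simp only [smul_eq_mul]
  ring

/-- The matrices of the triples of two pseudo-Hermitian forms define the same tractor
endomorphism. -/
lemma slotMatrix_change (hm : 1 ≤ m) (p : CircleBundle C) (t : ℝ × FTan p × ℝ) :
    slotMatrix (θ'.fefferman ℓ) p ((2 : ℝ) • θ'.vert ℓ p) (θ'.liftJ ℓ p) (θ'.slotForm ℓ p)
      (tractorChange (θ.fefferman ℓ) (logScale θ θ') p t) =
    tractorChange (θ.fefferman ℓ) (logScale θ θ') p
      (slotMatrix (θ.fefferman ℓ) p ((2 : ℝ) • θ.vert ℓ p) (θ.liftJ ℓ p) (θ.slotForm ℓ p) t) := by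
  obtain ⟨a, w, b⟩ := t
  have hm2 : (m : ℝ) + 2 ≠ 0 := by positivity
  have e0 : Real.exp (logScale θ θ' p) ≠ 0 := (Real.exp_pos _).ne'
  have e1 : scale θ θ' p.proj = Real.exp (logScale θ θ' p) * Real.exp (logScale θ θ' p) := by
    rw [← exp_two_logScale θ θ' hm, ← Real.exp_add, two_mul]
  have k1 : θ.levi p.proj (C.J p.proj (shift θ θ' p.proj) : Tan m p.proj) (C.J p.proj (shift θ θ' p.proj) : Tan m p.proj) = shiftSq θ θ' p.proj := θ.levi_J_J (shift θ θ' p.proj) (shift θ θ' p.proj)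
  have k2 : θ.levi p.proj (shift θ θ' p.proj : Tan m p.proj) (C.J p.proj (shift θ θ' p.proj) : Tan m p.proj) = 0 := by
    have h1 := θ.levi_J p.proj (shift θ θ' p.proj) (shift θ θ' p.proj)
    rw [θ.levi_symm p.proj (C.J p.proj (shift θ θ' p.proj) : Tan m p.proj)] at h1
    linarith
  have k3 : ∀ u, θ.levi p.proj (C.J p.proj (shift θ θ' p.proj) : Tan m p.proj) (θ.extJ p.proj u) = θ.levi p.proj (shift θ θ' p.proj : Tan m p.proj) u := fun u ↦ by
    rw [← extJ_coe θ, levi_extJ_extJ]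
  have k4 : ∀ u, θ.levi p.proj (shift θ θ' p.proj : Tan m p.proj) (θ.extJ p.proj u) =
      - θ.levi p.proj (C.J p.proj (shift θ θ' p.proj) : Tan m p.proj) u := fun u ↦ by
    rw [← extJ_coe θ, levi_extJ, neg_neg]
  have hr : θ'.hlift ℓ p (θ'.reeb p.proj) = (Real.exp (logScale θ θ' p))⁻¹ •
      (Real.exp (logScale θ θ' p))⁻¹ • (θ.hlift ℓ p (θ.reeb p.proj) + θ.hlift ℓ p (shift θ θ' p.proj : Tan m p.proj)
        - (shiftSq θ θ' p.proj / 2) • θ.vert ℓ p) := by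
    have h1 := congrArg (θ'.hlift ℓ p) (scale_smul_reeb θ θ' p.proj)
    rw [map_smul, hlift_change θ θ' ℓ hm p (_ + _), map_add, map_add, map_add, levi_reeb_right,
      form_reeb, θ.vanish, e1] at h1
    have h2 : θ'.hlift ℓ p (θ'.reeb p.proj) = (Real.exp (logScale θ θ' p))⁻¹ •
      (Real.exp (logScale θ θ' p))⁻¹ • (Real.exp (logScale θ θ' p) * Real.exp (logScale θ θ' p)) •
        θ'.hlift ℓ p (θ'.reeb p.proj) := by
      rw [smul_smul, smul_smul]
      field_simp
      rw [one_smul]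
    rw [h2]
    congr 2
    refine h1.trans ?_
    change _ - (0 + shiftSq θ θ' p.proj - shiftSq θ θ' p.proj / 2 * (1 + 0)) • _ = _
    module
  have k5 : θ.levi p.proj (shift θ θ' p.proj : Tan m p.proj) (shift θ θ' p.proj : Tan m p.proj) =
      shiftSq θ θ' p.proj := rfl
  have hΥ := mvfderiv_logScale θ θ' hm p
  have hN := sharp_logScale θ θ' ℓ hm p
  rw [tractorChange_apply, hN, slotMatrix_apply, slotMatrix_apply, tractorChange_apply, hN,
    vert_change θ θ' ℓ hm]
  simp only [hΥ, connForm_change θ θ' ℓ hm, form_eq_scale θ θ', extJ_change θ θ', hr, e1, Real.exp_neg]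
  rw [hlift_change θ θ' ℓ hm]
  simp only [map_add, map_sub, map_smul, dproj_vert, dproj_hlift, Complex.add_im, Complex.smul_im,
    connForm_vert_im, connForm_hlift_im, smul_eq_mul, mul_zero, add_zero, smul_zero, zero_add,
    form_extJ, form_reeb, extJ_coe, mul_one, θ.vanish]
  refine Prod.ext ?_ (Prod.ext ?_ ?_)
  · simp only [k1, k2, k3, levi_reeb_right]
    field_simp
    ring
  · simp only [k1, k2, k4, k5, C.J_sq, Submodule.coe_neg, map_neg]
    match_scalars <;> field_simp <;> ring
  · dsimp only
    field_simp

lemma JCR_apply {g : MetricField (model m) (CircleBundle C)}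
    (h : θ.fefferman ℓ ∈ conformalClass g) (p : CircleBundle C)
    (t : TractorSpace (conformalClass g) p) :
    splitting h p ((θ.JCR ℓ h p).1 t) =
      slotMatrix (θ.fefferman ℓ) p ((2 : ℝ) • θ.vert ℓ p) (θ.liftJ ℓ p) (θ.slotForm ℓ p)
        (splitting h p t) :=
  (splitting h p).apply_symm_apply _

lemma JCR_change (hm : 1 ≤ m) (h : θ'.fefferman ℓ ∈ conformalClass (θ.fefferman ℓ))
    (p : CircleBundle C) :
    θ'.JCR ℓ h p = θ.JCR ℓ (self_mem_conformalClass (θ.fefferman ℓ)) p := by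
  refine Subtype.ext (LinearMap.ext fun t ↦ (splitting h p).injective ?_)
  have key : ∀ s : TractorSpace (conformalClass (θ.fefferman ℓ)) p, splitting h p s =
      tractorChange (θ.fefferman ℓ) (logScale θ θ') p
        (splitting (self_mem_conformalClass (θ.fefferman ℓ)) p s) := fun s ↦
    s.2 ⟨_, self_mem_conformalClass (θ.fefferman ℓ)⟩ ⟨_, h⟩ _ (conformallyRelated θ θ' ℓ hm)
  rw [JCR_apply, key, key, JCR_apply, slotMatrix_change θ θ' ℓ hm]

lemma JCR_sq (p : CircleBundle C) :
    (θ.JCR ℓ (self_mem_conformalClass (θ.fefferman ℓ)) p).1 ∘ₗ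
      (θ.JCR ℓ (self_mem_conformalClass (θ.fefferman ℓ)) p).1 = - LinearMap.id := by
  refine LinearMap.ext fun t ↦
    (splitting (self_mem_conformalClass (θ.fefferman ℓ)) p).injective ?_
  rw [LinearMap.comp_apply, JCR_apply, JCR_apply, slotMatrix_sq, LinearMap.neg_apply, map_neg]
  rfl

end PseudoHermitian

end CRTractor

end

theorem mainTheorem7 {m : ℕ} (hm : 1 ≤ m) {M : Type*} [TopologicalSpace M]
    [ChartedSpace (CRTractor.CRModel m) M] [IsManifold 𝓘(ℝ, CRTractor.CRModel m) ∞ M]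
    (C : CRTractor.CRStructure m M) (ℓ : CRTractor.ImaginaryForm m M) :
    (∀ θ θ' : CRTractor.PseudoHermitian C,
      ∃ h : θ'.fefferman ℓ ∈ CRTractor.conformalClass (θ.fefferman ℓ),
        ∀ p, θ'.JCR ℓ h p = θ.JCR ℓ (CRTractor.self_mem_conformalClass (θ.fefferman ℓ)) p) ∧
    (∀ (θ : CRTractor.PseudoHermitian C) (p : CRTractor.CircleBundle C),
      (θ.JCR ℓ (CRTractor.self_mem_conformalClass (θ.fefferman ℓ)) p).1 ∘ₗ
        (θ.JCR ℓ (CRTractor.self_mem_conformalClass (θ.fefferman ℓ)) p).1 = - LinearMap.id) :=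
  ⟨fun θ θ' ↦ ⟨⟨_, θ.conformallyRelated θ' ℓ hm⟩, θ.JCR_change θ' ℓ hm _⟩, fun θ ↦ θ.JCR_sq ℓ⟩
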